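/- Let $d\ge 2$ and let $x_1,x_2,\dots$ be independent uniformly distributed random points of $[0,1]^d$. For a finite set $X\subset\mathbb{R}^d$ let $\mathrm{TSP}(X)$ be the minimum Euclidean length of a closed tour that visits every point of $X$ exactly once and returns to its starting point, and let $\mathrm{MM}(X)$ be the minimum total Euclidean length of a set of pairwise vertex-disjoint edges between distinct points of $X$ that covers all points of $X$ except at most one (none if $|X|$ is even, exactly one if $|X|$ is odd). Then there are (necessarily unique) real constants $\beta_{\mathrm{TSP}}^d$ and $\beta_{\mathrm{MM}}^d$, depending only on $d$, such that almost surely $$\frac{\mathrm{TSP}(\{x_1,\dots,x_n\})}{n^{(d-1)/d}}\to\beta_{\mathrm{TSP}}^d,\qquad \frac{\mathrm{MM}(\{x_1,\dots,x_n\})}{n^{(d-1)/d}}\to\beta_{\mathrm{MM}}^d\qquad(n\to\infty),$$ and these constants satisfy $$2\beta_{\mathrm{MM}}^d<\beta_{\mathrm{TSP}}^d.$$ -/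

import Mathlib

open MeasureTheory Filter Topology

/-- The unit hypercube `[0,1]^d` in Euclidean space. -/
def unitCube (d : ℕ) : Set (EuclideanSpace ℝ (Fin d)) :=
  {x | ∀ i, x i ∈ Set.Icc (0 : ℝ) 1}

/-- The uniform distribution on `[0,1]^d`. -/
noncomputable def uniformCube (d : ℕ) : Measure (EuclideanSpace ℝ (Fin d)) :=
  volume.restrict (unitCube d)

instance uniformCube_isProbabilityMeasure (d : ℕ) : IsProbabilityMeasure (uniformCube d) := by
  constructor
  have h : unitCube d = (WithLp.ofLp : EuclideanSpace ℝ (Fin d) → Fin d → ℝ) ⁻¹'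
      (Set.univ.pi fun _ => Set.Icc (0 : ℝ) 1) := by
    ext x
    simp only [unitCube, Set.mem_ofPred_eq, Set.mem_preimage, Set.mem_univ_pi]
  rw [uniformCube, Measure.restrict_apply_univ, h,
    (PiLp.volume_preserving_ofLp (Fin d)).measure_preimage
      (MeasurableSet.univ_pi fun _ => measurableSet_Icc).nullMeasurableSet, volume_pi_pi]
  simp

/-- The law of a sequence of independent uniformly distributed points of `[0,1]^d`. -/
noncomputable def uniformSequence (d : ℕ) : Measure (ℕ → EuclideanSpace ℝ (Fin d)) :=
  Measure.infinitePi fun _ => uniformCube d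

instance uniformSequence_isProbabilityMeasure (d : ℕ) :
    IsProbabilityMeasure (uniformSequence d) := by
  unfold uniformSequence
  infer_instance

open Classical in
/-- The set consisting of the first `n` points of a sequence. -/
noncomputable def firstPoints {E : Type*} (x : ℕ → E) (n : ℕ) : Finset E :=
  (Finset.range n).image x

/-- The length of the closed tour that visits the points of `X` in the order `e` and then returns
to its starting point. -/
noncomputable def tourLength {E : Type*} [PseudoMetricSpace E] (X : Finset E)
    (e : Fin X.card ≃ X) : ℝ :=
  ∑ i, dist (e i : E) (e (finRotate X.card i) : E)

/-- The minimum length of a travelling salesperson tour through `X`. (This is a minimum over a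
finite non-empty set.) -/
noncomputable def tspLength {E : Type*} [PseudoMetricSpace E] (X : Finset E) : ℝ :=
  ⨅ e : Fin X.card ≃ X, tourLength X e

/-- The length of the edge `s(x, y)`. -/
def edgeLength {E : Type*} [PseudoMetricSpace E] : Sym2 E → ℝ :=
  Sym2.lift ⟨fun x y => dist x y, dist_comm⟩

/-- `M` is a matching of the points of `X`, leaving at most one of them unmatched (none if `X` has
even cardinality, exactly one if it has odd cardinality). -/
def IsMatchingOf {E : Type*} (X : Finset E) (M : (⊤ : SimpleGraph E).Subgraph) : Prop :=
  M.IsMatching ∧ M.verts ⊆ X ∧ ((X : Set E) \ M.verts).Subsingleton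

/-- The total length of the edges of `M`. (The sum is finite for the matchings considered.) -/
noncomputable def matchingLength {E : Type*} [PseudoMetricSpace E]
    (M : (⊤ : SimpleGraph E).Subgraph) : ℝ :=
  ∑ᶠ e ∈ M.edgeSet, edgeLength e

/-- The minimum length of a matching of `X`. (This is a minimum over a finite non-empty set.) -/
noncomputable def minMatchingLength {E : Type*} [PseudoMetricSpace E] (X : Finset E) : ℝ :=
  sInf (matchingLength '' {M : (⊤ : SimpleGraph E).Subgraph | IsMatchingOf X M})

/-- `b` is the asymptotic constant of the functional `L` in dimension `d`: for independent uniform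
points `x₁, x₂, …` of `[0,1]^d`, almost surely `L {x₁, …, xₙ} / n ^ ((d - 1) / d)` tends to `b`. -/
def IsAsymptoticConstant (d : ℕ) (L : Finset (EuclideanSpace ℝ (Fin d)) → ℝ) (b : ℝ) : Prop :=
  ∀ᵐ x ∂uniformSequence d,
    Tendsto (fun n : ℕ => L (firstPoints x n) / (n : ℝ) ^ (((d : ℝ) - 1) / (d : ℝ)))
      atTop (𝓝 b)

/-- A functional has at most one asymptotic constant. -/
theorem IsAsymptoticConstant.unique {d : ℕ} {L : Finset (EuclideanSpace ℝ (Fin d)) → ℝ}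
    {b c : ℝ} (hb : IsAsymptoticConstant d L b) (hc : IsAsymptoticConstant d L c) : b = c := by
  obtain ⟨x, h₁, h₂⟩ := (hb.and hc).exists
  exact tendsto_nhds_unique h₁ h₂

/-! Convergence is the Beardwood–Halton–Hammersley argument, carried out once for both functionals.
Each is rewritten as a minimum `permMin` over the orderings of a multiset of points (of `tourLen`,
or of `pairLen`), and only the properties collected in `IsEuclideanFunctional` are used. Merging the
m^d cells of a grid costs O(m^(d-1)) (`IsEuclideanFunctional.sum_grid_le`). With p = (d-1)/d this
yields L(A) = O(|A|^p) (`exists_growth`), and adding k points changes L by O(1 + k^p)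
(`exists_smooth`). A uniform sample is a mixture of rescaled samples in the grid cells, so the means
satisfy a(m^d k) ≤ m^(d-1) (a(k) + O(k^(p/2))) (`exists_meanValue_sub`), and a(n)/n^p converges
(`exists_tendsto_div_rpow`). Deviations of order n^p from the mean are exponentially unlikely
(`exists_measure_deviation_le`), and Borel–Cantelli gives almost sure convergence.

For the strict inequality, the alternate edges of an optimal tour through an even number of points
form two perfect matchings σ₁, σ₂, whence 2 MM ≤ TSP. The surplus comes from gadgets: k pairs of
close twins, near k places on a small sphere, isolated from all other points. No point is matched to
its twin by both σ₁ and σ₂, so together they miss twins at least 2k times per gadget. But a matching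
that is optimal up to 2δ under exchanges of two edges separates at most N < k/2 of the pairs: a
separated pair must send an edge out of the gadget, and among more than N such edges two point in
directions at most 60° apart, so exchanging them is profitable (`GadgetShape.IsAt.card_missed_le`).
Let σ minimize the length minus a reward δ for each missed twin. Comparing σ with σ₁ and with σ₂
gives 2 MM + δ · (number of gadgets) ≤ TSP (`GadgetShape.two_mul_permMin_pairLen_add_le`).

Among m^d random points, each cell of mesh 1/m holds a gadget scaled by 1/m with probability bounded
below. The expected surplus is thus of order m^d · (1/m) = m^(d-1), the order of the lengths
themselves. -/

/-! ### Minimizing a function of lists over the orderings of a multiset -/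

section PermMin

variable {E : Type*}

/-- The minimum of `c l` over all lists `l` that enumerate the multiset `A`. -/
noncomputable def permMin (c : List E → ℝ) (A : Multiset E) : ℝ :=
  sInf (c '' {l | (l : Multiset E) = A})

theorem finite_setOf_coe_eq (A : Multiset E) : {l : List E | (l : Multiset E) = A}.Finite := by
  induction A using Quotient.inductionOn with
  | h l₀ =>
    refine (l₀.permutations.finite_toSet).subset fun l hl => ?_
    exact List.mem_permutations.2 (Multiset.coe_eq_coe.1 hl)

theorem permMin_le (c : List E → ℝ) {A : Multiset E} {l : List E} (h : (l : Multiset E) = A) :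
    permMin c A ≤ c l :=
  csInf_le ((finite_setOf_coe_eq A).image c).bddBelow ⟨l, h, rfl⟩

theorem exists_eq_permMin (c : List E → ℝ) (A : Multiset E) :
    ∃ l : List E, (l : Multiset E) = A ∧ c l = permMin c A := by
  have hne : (c '' {l : List E | (l : Multiset E) = A}).Nonempty := by
    induction A using Quotient.inductionOn with
    | h l₀ => exact ⟨_, l₀, rfl, rfl⟩
  obtain ⟨l, hl, h⟩ := hne.csInf_mem ((finite_setOf_coe_eq A).image c)
  exact ⟨l, hl, h⟩

theorem le_permMin {c : List E → ℝ} {A : Multiset E} {r : ℝ}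
    (h : ∀ l : List E, (l : Multiset E) = A → r ≤ c l) : r ≤ permMin c A := by
  obtain ⟨l, hl, he⟩ := exists_eq_permMin c A
  exact he ▸ h l hl

theorem permMin_map_le {F : Type*} {c : List E → ℝ} {c' : List F → ℝ} {φ : E → F} {s : ℝ}
    (h : ∀ l, c' (l.map φ) ≤ s * c l) (A : Multiset E) :
    permMin c' (A.map φ) ≤ s * permMin c A := by
  obtain ⟨l, rfl, he⟩ := exists_eq_permMin c A
  rw [← he]
  exact (permMin_le c' (Multiset.map_coe φ l).symm).trans (h l)

/-- An enumeration of the image lifts to one of the indices even when `x` is not injective. The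
minimum over lists of points thereby becomes a minimum over a finite set of index lists that does
not depend on `x`, which gives `continuous_permMin`. -/
theorem coe_eq_map_iff {ι : Type*} {l : List E} {s : Multiset ι} {x : ι → E} :
    (l : Multiset E) = s.map x ↔ ∃ l' : List ι, (l' : Multiset ι) = s ∧ l'.map x = l := by
  constructor
  · intro h
    induction s using Quotient.inductionOn with
    | h t =>
      have h' : l.Perm (t.map x) := Multiset.coe_eq_coe.1 h
      have h2 : List.Forall₂ (fun a b => a = x b) (t.map x) t := by
        rw [List.forall₂_map_left_iff]
        exact List.forall₂_same.2 fun _ _ => rfl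
      obtain ⟨l', hl', hp⟩ := List.perm_comp_forall₂ h' h2
      refine ⟨l', Multiset.coe_eq_coe.2 hp, ?_⟩
      have h3 : List.Forall₂ (fun a b => b = a) (l'.map x) l := by
        rw [List.forall₂_map_left_iff]
        exact hl'.flip
      exact (List.forall₂_eq_eq_eq ▸ (h3.imp fun a b h => h.symm) : l'.map x = l)
  · rintro ⟨l', rfl, rfl⟩
    exact (Multiset.map_coe x l').symm

theorem continuous_permMin [TopologicalSpace E] {ι : Type*} {c : List E → ℝ} (s : Multiset ι)
    (h : ∀ l : List ι, Continuous fun x : ι → E => c (l.map x)) :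
    Continuous fun x : ι → E => permMin c (s.map x) := by
  have hfin := finite_setOf_coe_eq s
  have hne : hfin.toFinset.Nonempty := by
    obtain ⟨l, hl, -⟩ := exists_eq_permMin (fun _ => (0 : ℝ)) s
    exact ⟨l, hfin.mem_toFinset.2 hl⟩
  have heq : (fun x : ι → E => permMin c (s.map x)) =
      fun x => hfin.toFinset.inf' hne fun l => c (l.map x) := by
    funext x
    apply le_antisymm
    · refine Finset.le_inf' _ _ fun l hl => permMin_le c ?_
      rw [← (hfin.mem_toFinset.1 hl : (l : Multiset ι) = s), Multiset.map_coe]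
    · refine le_permMin fun l hl => ?_
      obtain ⟨l', hl', rfl⟩ := coe_eq_map_iff.1 hl
      exact Finset.inf'_le _ (hfin.mem_toFinset.2 hl')
  rw [heq]
  exact Continuous.finset_inf'_apply hne fun l _ => h l

end PermMin

/-! ### Tours and matchings as lists -/

section Lists

variable {E : Type*} [PseudoMetricSpace E]

/-- The length of the polygonal path from `a` through the points of a list to `b`. -/
def chainLen (a : E) : List E → E → ℝ
  | [], b => dist a b
  | c :: t, b => dist a c + chainLen c t b

/-- The length of the closed tour through the points of a list. -/
def tourLen : List E → ℝ
  | [] => 0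
  | a :: t => chainLen a t a

/-- The length of the matching that pairs consecutive points of a list. -/
def pairLen : List E → ℝ
  | [] => 0
  | [_] => 0
  | a :: b :: t => dist a b + pairLen t

theorem chainLen_append (a : E) (s : List E) (c : E) (t : List E) (b : E) :
    chainLen a (s ++ c :: t) b = chainLen a s c + chainLen c t b := by
  induction s generalizing a with
  | nil => rfl
  | cons e s ih => simp only [List.cons_append, chainLen, ih, add_assoc]

theorem chainLen_nonneg (a : E) (t : List E) (b : E) : 0 ≤ chainLen a t b := by
  induction t generalizing a with
  | nil => exact dist_nonneg
  | cons e s ih => exact add_nonneg dist_nonneg (ih e)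

theorem chainLen_le_left (a c : E) (t : List E) (b : E) :
    chainLen a t b ≤ dist a c + chainLen c t b := by
  cases t with
  | nil => exact dist_triangle _ _ _
  | cons e s =>
    have := dist_triangle a c e
    simp only [chainLen]; linarith

theorem chainLen_le_right (a c : E) (t : List E) (b : E) :
    chainLen a t b ≤ chainLen a t c + dist c b := by
  induction t generalizing a with
  | nil => exact dist_triangle _ _ _
  | cons e s ih => simp only [chainLen]; linarith [ih e]

theorem chainLen_mono {s t : List E} (h : s.Sublist t) (a b : E) :
    chainLen a s b ≤ chainLen a t b := by
  induction h generalizing a with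
  | slnil => rfl
  | cons c _ ih => exact (chainLen_le_left a c _ b).trans (add_le_add_right (ih c) _)
  | cons_cons c _ ih => exact add_le_add_right (ih c) _

theorem tourLen_nonneg (l : List E) : 0 ≤ tourLen l := by
  cases l with
  | nil => exact le_rfl
  | cons a t => exact chainLen_nonneg _ _ _

theorem tourLen_mono {s t : List E} (h : s.Sublist t) : tourLen s ≤ tourLen t := by
  induction h with
  | slnil => rfl
  | @cons s t c h ih =>
    refine ih.trans ?_
    cases t with
    | nil => exact tourLen_nonneg _
    | cons e t =>
      have := chainLen_le_right e c t e
      simp only [tourLen, chainLen]; rw [dist_comm c e] at *; linarith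
  | cons_cons c h _ => exact chainLen_mono h _ _

theorem tourLen_append_le {D : ℝ} (hD : 0 ≤ D) {s t : List E}
    (h : ∀ x ∈ s, ∀ y ∈ t, dist x y ≤ D) :
    tourLen (s ++ t) ≤ tourLen s + tourLen t + 2 * D := by
  cases s with
  | nil => simp only [List.nil_append, tourLen]; linarith
  | cons a s =>
    cases t with
    | nil => simp only [List.append_nil, tourLen]; linarith
    | cons b t =>
      have h1 := h a (by simp) b (by simp)
      have h2 := chainLen_le_right a a s b
      have h3 := chainLen_le_right b b t a
      simp only [List.cons_append, tourLen, chainLen_append]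
      rw [dist_comm b a] at h3
      linarith

theorem pairLen_nonneg : ∀ l : List E, 0 ≤ pairLen l
  | [] => le_rfl
  | [_] => le_rfl
  | _ :: _ :: t => add_nonneg dist_nonneg (pairLen_nonneg t)

theorem pairLen_append_of_even : ∀ {s : List E} (_ : Even s.length) (t : List E),
    pairLen (s ++ t) = pairLen s + pairLen t
  | [], _, t => by simp [pairLen]
  | [a], h, t => by simp at h
  | a :: b :: s, h, t => by
    have h' : Even s.length := by simpa [Nat.even_add_one] using h
    simp only [List.cons_append, pairLen, pairLen_append_of_even h' t, add_assoc]

theorem pairLen_append_singleton_of_even {s : List E} (h : Even s.length) (a : E) :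
    pairLen (s ++ [a]) = pairLen s := by
  rw [pairLen_append_of_even h]; simp [pairLen]

theorem exists_append_singleton_of_odd {F : Type*} {s : List F} (h : ¬ Even s.length) :
    ∃ (s' : List F) (a : F), Even s'.length ∧ s = s' ++ [a] := by
  have hne : s ≠ [] := by rintro rfl; simp at h
  refine ⟨s.dropLast, s.getLast hne, ?_, (List.dropLast_append_getLast hne).symm⟩
  rw [← List.dropLast_append_getLast hne] at h
  simpa [Nat.even_add_one] using h

/-- A list of even length can go first without disturbing the pairs of the other. If both lengths
are odd, the two leftover points are joined by one new edge. -/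
theorem exists_perm_append_pairLen_le {D : ℝ} (hD : 0 ≤ D) {s t : List E}
    (h : ∀ x ∈ s, ∀ y ∈ t, dist x y ≤ D) :
    ∃ l : List E, l.Perm (s ++ t) ∧ pairLen l ≤ pairLen s + pairLen t + D := by
  by_cases hs : Even s.length
  · exact ⟨s ++ t, List.Perm.refl _, by rw [pairLen_append_of_even hs]; linarith⟩
  by_cases ht : Even t.length
  · exact ⟨t ++ s, List.perm_append_comm, by rw [pairLen_append_of_even ht]; linarith⟩
  obtain ⟨s', a, hs', rfl⟩ := exists_append_singleton_of_odd hs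
  obtain ⟨t', b, ht', rfl⟩ := exists_append_singleton_of_odd ht
  refine ⟨s' ++ (t' ++ [a, b]), ?_, ?_⟩
  · rw [← Multiset.coe_eq_coe]
    simp only [← Multiset.coe_add]
    have : (([a, b] : List E) : Multiset E) = ([a] : List E) + ([b] : List E) := rfl
    rw [this]; abel
  · rw [pairLen_append_of_even hs', pairLen_append_of_even ht',
      pairLen_append_singleton_of_even hs', pairLen_append_singleton_of_even ht']
    have := h a (by simp) b (by simp)
    simp only [pairLen]; linarith

/-- Here `u` collects the pairs that survive in `s`, and `v` the points whose partner was deleted;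
the extra 1 allows for the point of `t` that had no partner to begin with. -/
theorem exists_perm_of_sublist_pairLen : ∀ {s t : List E} (_ : s.Sublist t),
    ∃ u v : List E, (u ++ v).Perm s ∧ Even u.length ∧ pairLen u ≤ pairLen t ∧
      v.length + s.length ≤ t.length + 1
  | s, [], h => ⟨[], s, by simp, by simp, le_rfl, by simp [List.sublist_nil.1 h]⟩
  | s, [a], h => by
    refine ⟨[], s, by simp, by simp, le_rfl, ?_⟩
    have := h.length_le
    simp at this ⊢
    omega
  | s, a :: b :: t, h => by
    have key : ∀ {s' : List E}, s'.Sublist t → ∀ r : List E, r.length ≤ 1 → s.Perm (s' ++ r) →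
        ∃ u v : List E, (u ++ v).Perm s ∧ Even u.length ∧ pairLen u ≤ pairLen (a :: b :: t) ∧
          v.length + s.length ≤ (a :: b :: t).length + 1 := by
      intro s' hs' r hr hp
      obtain ⟨u, v, huv, hu, hle, hlen⟩ := exists_perm_of_sublist_pairLen hs'
      refine ⟨u, v ++ r, ?_, hu, ?_, ?_⟩
      · rw [← List.append_assoc]
        exact (huv.append_right r).trans hp.symm
      · have := dist_nonneg (x := a) (y := b)
        simp only [pairLen]; linarith
      · have := hp.length_eq
        simp at this ⊢
        omega
    cases h with
    | cons _ h =>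
      cases h with
      | cons _ h => exact key h [] (by simp) (by simp)
      | @cons_cons s' _ _ h => exact key h [b] (by simp) (List.perm_append_singleton b s').symm
    | @cons_cons s₁ _ _ h =>
      cases h with
      | cons _ h => exact key h [a] (by simp) (List.perm_append_singleton a s₁).symm
      | @cons_cons s' _ _ h =>
        obtain ⟨u, v, huv, hu, hle, hlen⟩ := exists_perm_of_sublist_pairLen h
        refine ⟨a :: b :: u, v, (huv.cons b).cons a, ?_, ?_, ?_⟩
        · simpa [Nat.even_add_one] using hu
        · simp only [pairLen]; linarith
        · simp at hlen ⊢; omega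

theorem chainLen_map {F : Type*} [PseudoMetricSpace F] {φ : E → F} {s : ℝ}
    (h : ∀ x y, dist (φ x) (φ y) = s * dist x y) (a : E) (t : List E) (b : E) :
    chainLen (φ a) (t.map φ) (φ b) = s * chainLen a t b := by
  induction t generalizing a with
  | nil => exact h a b
  | cons e t ih => simp only [List.map_cons, chainLen, ih, h, mul_add]

theorem tourLen_map {F : Type*} [PseudoMetricSpace F] {φ : E → F} {s : ℝ}
    (h : ∀ x y, dist (φ x) (φ y) = s * dist x y) (l : List E) :
    tourLen (l.map φ) = s * tourLen l := by
  cases l with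
  | nil => simp [tourLen]
  | cons a t => exact chainLen_map h a t a

theorem pairLen_map {F : Type*} [PseudoMetricSpace F] {φ : E → F} {s : ℝ}
    (h : ∀ x y, dist (φ x) (φ y) = s * dist x y) : ∀ l : List E,
    pairLen (l.map φ) = s * pairLen l
  | [] => by simp [pairLen]
  | [_] => by simp [pairLen]
  | a :: b :: t => by simp only [List.map_cons, pairLen, pairLen_map h t, h, mul_add]

theorem continuous_chainLen {ι : Type*} (i : ι) (t : List ι) (j : ι) :
    Continuous fun x : ι → E => chainLen (x i) (t.map x) (x j) := by
  induction t generalizing i with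
  | nil => simp only [List.map_nil, chainLen]; fun_prop
  | cons e t ih =>
    simp only [List.map_cons, chainLen]
    exact ((continuous_apply i).dist (continuous_apply e)).add (ih e)

theorem continuous_tourLen {ι : Type*} (l : List ι) :
    Continuous fun x : ι → E => tourLen (l.map x) := by
  cases l with
  | nil => simp only [List.map_nil, tourLen]; fun_prop
  | cons a t => exact continuous_chainLen a t a

theorem continuous_pairLen {ι : Type*} : ∀ l : List ι,
    Continuous fun x : ι → E => pairLen (l.map x)
  | [] => by simp only [List.map_nil, pairLen]; fun_prop
  | [_] => by simp only [List.map_cons, List.map_nil, pairLen]; fun_prop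
  | a :: b :: t => by
    simp only [List.map_cons, pairLen]
    exact ((continuous_apply a).dist (continuous_apply b)).add (continuous_pairLen t)

end Lists

/-! ### Subadditive Euclidean functionals -/

/-- A subadditive Euclidean functional on finite multisets, with an approximate monotonicity
property: after the removal of `B`, all but at most `|B| + 1` of the remaining points are
served at no additional cost. -/
structure IsEuclideanFunctional {E : Type*} [PseudoMetricSpace E] (L : Multiset E → ℝ) : Prop where
  nonneg : ∀ A, 0 ≤ L A
  zero : L 0 = 0
  singleton : ∀ x, L {x} = 0
  add_le : ∀ (A B : Multiset E) (D : ℝ), 0 ≤ D → (∀ x ∈ A, ∀ y ∈ B, dist x y ≤ D) →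
    L (A + B) ≤ L A + L B + 2 * D
  map_le : ∀ (φ : E → E) (s : ℝ), (∀ x y, dist (φ x) (φ y) = s * dist x y) →
    ∀ A, L (A.map φ) ≤ s * L A
  remove : ∀ A B : Multiset E, ∃ A₀ D : Multiset E, A = A₀ + D ∧
    Multiset.card D ≤ Multiset.card B + 1 ∧ L A₀ ≤ L (A + B)
  continuous : ∀ {ι : Type} (s : Multiset ι), Continuous fun x : ι → E => L (s.map x)

theorem isEuclideanFunctional_tour {E : Type*} [PseudoMetricSpace E] :
    IsEuclideanFunctional (permMin (tourLen (E := E))) where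
  nonneg A := le_permMin fun l _ => tourLen_nonneg l
  zero := by
    refine le_antisymm ?_ (le_permMin fun l _ => tourLen_nonneg l)
    exact permMin_le tourLen (l := []) rfl
  singleton x := by
    refine le_antisymm ?_ (le_permMin fun l _ => tourLen_nonneg l)
    exact (permMin_le tourLen (l := [x]) rfl).trans (by simp [tourLen, chainLen])
  add_le A B D hD h := by
    obtain ⟨s, rfl, hs⟩ := exists_eq_permMin tourLen A
    obtain ⟨t, rfl, ht⟩ := exists_eq_permMin tourLen B
    rw [← hs, ← ht]
    exact (permMin_le tourLen (Multiset.coe_add s t).symm).trans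
      (tourLen_append_le hD fun x hx y hy => h x hx y hy)
  map_le φ s h A := permMin_map_le (fun l => (tourLen_map h l).le) A
  remove A B := by
    refine ⟨A, 0, by simp, by simp, le_permMin fun l hl => ?_⟩
    have hA : A ≤ (l : Multiset E) := hl ▸ Multiset.le_add_right A B
    induction A using Quotient.inductionOn with
    | h a =>
      obtain ⟨s, hs, hsub⟩ := (Multiset.coe_le.1 hA : List.Subperm a l)
      exact (permMin_le tourLen (Multiset.coe_eq_coe.2 hs)).trans (tourLen_mono hsub)
  continuous s := continuous_permMin s continuous_tourLen

theorem isEuclideanFunctional_pair {E : Type*} [PseudoMetricSpace E] :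
    IsEuclideanFunctional (permMin (pairLen (E := E))) where
  nonneg A := le_permMin fun l _ => pairLen_nonneg l
  zero := by
    refine le_antisymm ?_ (le_permMin fun l _ => pairLen_nonneg l)
    exact permMin_le pairLen (l := []) rfl
  singleton x := by
    refine le_antisymm ?_ (le_permMin fun l _ => pairLen_nonneg l)
    exact permMin_le pairLen (l := [x]) rfl
  add_le A B D hD h := by
    obtain ⟨s, rfl, hs⟩ := exists_eq_permMin pairLen A
    obtain ⟨t, rfl, ht⟩ := exists_eq_permMin pairLen B
    obtain ⟨l, hl, hle⟩ := exists_perm_append_pairLen_le hD (s := s) (t := t)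
      fun x hx y hy => h x hx y hy
    rw [← hs, ← ht]
    have := permMin_le pairLen ((Multiset.coe_eq_coe.2 hl).trans (Multiset.coe_add s t).symm)
    linarith
  map_le φ s h A := permMin_map_le (fun l => (pairLen_map h l).le) A
  remove A B := by
    obtain ⟨l, hl, he⟩ := exists_eq_permMin pairLen (A + B)
    have hA : A ≤ (l : Multiset E) := hl ▸ Multiset.le_add_right A B
    induction A using Quotient.inductionOn with
    | h a =>
      obtain ⟨s, hs, hsub⟩ := (Multiset.coe_le.1 hA : List.Subperm a l)
      obtain ⟨u, v, huv, -, hle, hlen⟩ := exists_perm_of_sublist_pairLen hsub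
      refine ⟨u, v, ?_, ?_, ?_⟩
      · rw [Multiset.coe_add]
        exact (Multiset.coe_eq_coe.2 (huv.trans hs)).symm
      · have h1 := congrArg Multiset.card hl
        have h2 := hs.length_eq
        simp at h1 ⊢
        omega
      · rw [← he]
        exact (permMin_le pairLen rfl).trans hle
  continuous s := continuous_permMin s continuous_pairLen

/-! ### Subadditivity over grids, growth and smoothness -/

section Grid

variable {d : ℕ}

theorem dist_le_of_forall_abs_sub_le {x y : EuclideanSpace ℝ (Fin d)} {h : ℝ} (hh : 0 ≤ h)
    (hxy : ∀ i, |x i - y i| ≤ h) : dist x y ≤ d * h := by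
  rw [EuclideanSpace.dist_eq]
  apply Real.sqrt_le_iff.2 ⟨by positivity, ?_⟩
  calc ∑ i, dist (x i) (y i) ^ 2 ≤ ∑ _i : Fin d, h ^ 2 :=
        Finset.sum_le_sum fun i _ => by
          rw [Real.dist_eq]; exact pow_le_pow_left₀ (abs_nonneg _) (hxy i) 2
    _ = d * h ^ 2 := by simp
    _ ≤ (d * h) ^ 2 := by
      rcases Nat.eq_zero_or_pos d with rfl | hd
      · simp
      · have : (1 : ℝ) ≤ d := by exact_mod_cast hd
        have := sq_nonneg h
        nlinarith [mul_nonneg (by linarith : (0 : ℝ) ≤ d) (sub_nonneg.2 ‹(1 : ℝ) ≤ d›)]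

variable {L : Multiset (EuclideanSpace ℝ (Fin d)) → ℝ}

theorem IsEuclideanFunctional.sum_le {E : Type*} [PseudoMetricSpace E] {L : Multiset E → ℝ}
    (hL : IsEuclideanFunctional L) {ι : Type*}
    (s : Finset ι) (A : ι → Multiset E) {D : ℝ} (hD : 0 ≤ D)
    (h : ∀ i ∈ s, ∀ j ∈ s, ∀ x ∈ A i, ∀ y ∈ A j, dist x y ≤ D) :
    L (∑ i ∈ s, A i) ≤ ∑ i ∈ s, L (A i) + s.card * (2 * D) := by
  classical
  induction s using Finset.induction_on with
  | empty => simp [hL.zero]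
  | insert i s hi ih =>
    rw [Finset.sum_insert hi, Finset.sum_insert hi, Finset.card_insert_of_notMem hi]
    have h1 := ih fun a ha b hb => h a (Finset.mem_insert_of_mem ha) b (Finset.mem_insert_of_mem hb)
    have h2 := hL.add_le (A i) (∑ i ∈ s, A i) D hD fun x hx y hy => by
      obtain ⟨j, hj, hy⟩ := Multiset.mem_sum.1 hy
      exact h i (Finset.mem_insert_self _ _) j (Finset.mem_insert_of_mem hj) x hx y hy
    push_cast
    linarith

theorem IsEuclideanFunctional.le_card_mul {E : Type*} [PseudoMetricSpace E] {L : Multiset E → ℝ}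
    (hL : IsEuclideanFunctional L) (A : Multiset E) {D : ℝ} (hD : 0 ≤ D)
    (h : ∀ x ∈ A, ∀ y ∈ A, dist x y ≤ D) : L A ≤ Multiset.card A * (2 * D) := by
  induction A using Multiset.induction_on with
  | empty => simp [hL.zero]
  | cons a A ih =>
    have h1 := ih fun x hx y hy => h x (Multiset.mem_cons_of_mem hx) y (Multiset.mem_cons_of_mem hy)
    have h2 := hL.add_le {a} A D hD fun x hx y hy => by
      rw [Multiset.mem_singleton.1 hx]
      exact h a (Multiset.mem_cons_self a A) y (Multiset.mem_cons_of_mem hy)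
    rw [Multiset.singleton_add, hL.singleton] at h2
    rw [Multiset.card_cons]
    push_cast
    linarith

/-- The cube of `2 ^ (d * j)` grid cells with corner `o`. -/
def gridBox (o : Fin d → ℕ) (j : ℕ) : Finset (Fin d → ℕ) :=
  Fintype.piFinset fun i => Finset.Ico (o i) (o i + 2 ^ j)

theorem sum_gridBox_succ {M : Type*} [AddCommMonoid M] (o : Fin d → ℕ) (j : ℕ)
    (f : (Fin d → ℕ) → M) :
    ∑ b ∈ gridBox o (j + 1), f b =
      ∑ ε : Fin d → Bool, ∑ b ∈ gridBox (fun i => o i + if ε i then 2 ^ j else 0) j, f b := by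
  classical
  rw [← Finset.sum_fiberwise (gridBox o (j + 1))
    (fun b i => decide (o i + 2 ^ j ≤ b i))]
  refine Finset.sum_congr rfl fun ε _ => Finset.sum_congr ?_ fun _ _ => rfl
  ext b
  simp only [gridBox, Finset.mem_filter, Fintype.mem_piFinset, Finset.mem_Ico, funext_iff]
  rw [← forall_and]
  refine forall_congr' fun i => ?_
  have : 2 ^ (j + 1) = 2 ^ j + 2 ^ j := by ring
  rw [this]
  cases ε i <;> simp <;> omega

/-- Boxes are merged 2^d at a time, so that only boxes of comparable size are joined. The costs form
a geometric series dominated by the finest level; joining all cells at full diameter would cost a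
factor 2^j more. The subtracted 2^j is the slack that makes the induction close. -/
theorem IsEuclideanFunctional.sum_gridBox_le (hL : IsEuclideanFunctional L) (hd : 2 ≤ d)
    {h : ℝ} (hh : 0 ≤ h) (A : (Fin d → ℕ) → Multiset (EuclideanSpace ℝ (Fin d)))
    (hA : ∀ b, ∀ x ∈ A b, ∀ i, h * b i ≤ x i ∧ x i ≤ h * (b i + 1)) (j : ℕ) (o : Fin d → ℕ) :
    L (∑ b ∈ gridBox o j, A b) ≤ ∑ b ∈ gridBox o j, L (A b) +
      2 ^ (d + 2) * d * h * (2 ^ (d * j) - 2 ^ j) := by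
  induction j generalizing o with
  | zero =>
    have : gridBox o 0 = {o} := by
      ext b
      simp only [gridBox, Fintype.mem_piFinset, Finset.mem_Ico, Finset.mem_singleton, funext_iff]
      exact forall_congr' fun i => by omega
    simp [this]
  | succ j ih =>
    rw [sum_gridBox_succ, sum_gridBox_succ]
    have h1 := hL.sum_le Finset.univ
      (fun ε : Fin d → Bool => ∑ b ∈ gridBox (fun i => o i + if ε i then 2 ^ j else 0) j, A b)
      (D := d * (h * 2 ^ (j + 1))) (by positivity) ?_
    · refine h1.trans ?_
      have h2 := Finset.sum_le_sum fun (ε : Fin d → Bool) (_ : ε ∈ Finset.univ) =>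
        ih (fun i => o i + if ε i then 2 ^ j else 0)
      rw [Finset.sum_add_distrib] at h2
      simp only [Finset.sum_const, Finset.card_univ, Fintype.card_fun, Fintype.card_fin,
        Fintype.card_bool, nsmul_eq_mul] at h2 ⊢
      push_cast at h2 ⊢
      have h3 : (4 : ℝ) ≤ 2 ^ d := by
        calc (4 : ℝ) = 2 ^ 2 := by norm_num
          _ ≤ 2 ^ d := pow_le_pow_right₀ (by norm_num) hd
      -- The induction needs 2^d - 1 ≥ 2, the place where the dimension enters.
      have h4 : (0 : ℝ) ≤ 2 ^ d * d * h * 2 ^ j * (2 ^ d - 3) := by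
        have : (0 : ℝ) ≤ 2 ^ d - 3 := by linarith
        positivity
      have e1 : (2 : ℝ) ^ (d * (j + 1)) = 2 ^ (d * j) * 2 ^ d := by rw [mul_add, pow_add, mul_one]
      have e2 : (2 : ℝ) ^ (d + 2) = 2 ^ d * 4 := by rw [pow_add]; norm_num
      have e3 : (2 : ℝ) ^ (j + 1) = 2 ^ j * 2 := pow_succ _ _
      rw [e1, e2, e3]
      rw [e2] at h2
      nlinarith
    · intro ε₁ _ ε₂ _ x hx y hy
      obtain ⟨b, hb, hx⟩ := Multiset.mem_sum.1 hx
      obtain ⟨c, hc, hy⟩ := Multiset.mem_sum.1 hy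
      apply dist_le_of_forall_abs_sub_le (by positivity)
      intro i
      have key : ∀ {b : Fin d → ℕ} {ε : Fin d → Bool}
          (_ : b ∈ gridBox (fun i => o i + if ε i then 2 ^ j else 0) j)
          {x : EuclideanSpace ℝ (Fin d)} (_ : x ∈ A b),
          h * o i ≤ x i ∧ x i ≤ h * (o i + 2 ^ (j + 1)) := by
        intro b ε hb x hx
        have hb' := Finset.mem_Ico.1 (Fintype.mem_piFinset.1 hb i)
        have hx' := hA b x hx i
        have l1 : o i ≤ b i := (Nat.le_add_right _ _).trans hb'.1
        have l2 : b i + 1 ≤ o i + 2 ^ (j + 1) := by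
          rw [pow_succ]
          cases hε : ε i <;> simp [hε] at hb' <;> omega
        have l1' : (o i : ℝ) ≤ b i := by exact_mod_cast l1
        have l2' : (b i : ℝ) + 1 ≤ o i + 2 ^ (j + 1) := by exact_mod_cast l2
        exact ⟨(mul_le_mul_of_nonneg_left l1' hh).trans hx'.1,
          hx'.2.trans (mul_le_mul_of_nonneg_left l2' hh)⟩
      have k1 := key hb hx
      have k2 := key hc hy
      rw [abs_le]
      constructor <;> nlinarith

/-- The grid is padded with empty cells up to a side 2^j ≤ 2m, which costs only the factor 2^d. -/
theorem IsEuclideanFunctional.sum_grid_le (hL : IsEuclideanFunctional L) (hd : 2 ≤ d)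
    {m : ℕ} (hm : 0 < m) (A : (Fin d → Fin m) → Multiset (EuclideanSpace ℝ (Fin d)))
    (hA : ∀ b, ∀ x ∈ A b, ∀ i, (b i : ℝ) / m ≤ x i ∧ x i ≤ ((b i : ℝ) + 1) / m) :
    L (∑ b, A b) ≤ ∑ b, L (A b) + 2 ^ (d + 2) * d * 2 ^ d * (m : ℝ) ^ (d - 1) := by
  classical
  obtain ⟨j, hj1, hj2⟩ : ∃ j : ℕ, m ≤ 2 ^ j ∧ 2 ^ j ≤ 2 * m := by
    refine ⟨Nat.clog 2 m, Nat.le_pow_clog (by norm_num) m, ?_⟩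
    rcases (show m = 1 ∨ 1 < m by omega) with rfl | h1
    · simp
    · have h2 := Nat.pow_pred_clog_lt_self (by norm_num : 1 < 2) h1
      have h3 : 0 < Nat.clog 2 m := Nat.clog_pos (by norm_num) h1
      have h4 : 2 ^ Nat.clog 2 m = 2 ^ (Nat.clog 2 m).pred * 2 := by
        rw [← pow_succ, ← Nat.succ_eq_add_one, Nat.succ_pred_eq_of_pos h3]
      omega
  have hmr : (0 : ℝ) < m := by exact_mod_cast hm
  let A' : (Fin d → ℕ) → Multiset (EuclideanSpace ℝ (Fin d)) := fun b =>
    if h : ∀ i, b i < m then A fun i => ⟨b i, h i⟩ else 0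
  have hA' : ∀ b, ∀ x ∈ A' b, ∀ i, (1 / m : ℝ) * b i ≤ x i ∧ x i ≤ (1 / m : ℝ) * (b i + 1) := by
    intro b x hx i
    by_cases h : ∀ i, b i < m
    · simp only [A', dif_pos h] at hx
      have := hA _ x hx i
      rw [one_div_mul_eq_div, one_div_mul_eq_div]
      exact this
    · simp [A', dif_neg h] at hx
  have hsum : ∀ {M : Type} [AddCommMonoid M] (f : Multiset (EuclideanSpace ℝ (Fin d)) → M),
      f 0 = 0 → ∑ b, f (A b) = ∑ b ∈ gridBox (fun _ => 0) j, f (A' b) := by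
    intro M _ f hf
    refine Finset.sum_of_injOn (fun b i => (b i : ℕ)) ?_ ?_ ?_ ?_
    · intro b _ c _ hbc
      ext i
      exact congrFun hbc i
    · intro b _
      simp only [gridBox, Finset.mem_coe, Fintype.mem_piFinset, Finset.mem_Ico]
      intro i
      have := (b i).2
      omega
    · intro b _ hb
      by_cases h : ∀ i, b i < m
      · exact absurd ⟨fun i => ⟨b i, h i⟩, by simp, rfl⟩ hb
      · simp [A', dif_neg h, hf]
    · intro b _
      have : ∀ i, (b i : ℕ) < m := fun i => (b i).2
      simp [A']
  have h1 := hL.sum_gridBox_le hd (by positivity : (0 : ℝ) ≤ 1 / m) A' hA' j (fun _ => 0)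
  rw [← hsum L hL.zero, ← show ∑ b, A b = ∑ b ∈ gridBox (fun _ => 0) j, A' b from
    hsum id rfl] at h1
  refine h1.trans (add_le_add_right ?_ _)
  have h2 : (2 : ℝ) ^ (d * j) ≤ (2 * m) ^ d := by
    rw [mul_comm d j, pow_mul]
    exact pow_le_pow_left₀ (by positivity) (by exact_mod_cast hj2) d
  have h3 : (0 : ℝ) ≤ 2 ^ j := by positivity
  calc 2 ^ (d + 2) * (d : ℝ) * (1 / m) * (2 ^ (d * j) - 2 ^ j)
      ≤ 2 ^ (d + 2) * (d : ℝ) * (1 / m) * (2 * m) ^ d :=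
        mul_le_mul_of_nonneg_left (by linarith) (by positivity)
    _ = 2 ^ (d + 2) * d * 2 ^ d * (m : ℝ) ^ (d - 1) := by
      obtain ⟨e, rfl⟩ : ∃ e, d = e + 1 := ⟨d - 1, by omega⟩
      rw [Nat.add_sub_cancel, mul_pow, pow_succ (m : ℝ)]
      field_simp

/-- The exponent `(d - 1) / d`. -/
noncomputable abbrev growthExp (d : ℕ) : ℝ := ((d : ℝ) - 1) / d

theorem growthExp_pos (hd : 2 ≤ d) : 0 < growthExp d := by
  have : (2 : ℝ) ≤ d := by exact_mod_cast hd
  exact div_pos (by linarith) (by linarith)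

theorem growthExp_lt_one (hd : 2 ≤ d) : growthExp d < 1 := by
  have : (2 : ℝ) ≤ d := by exact_mod_cast hd
  rw [growthExp, div_lt_one (by linarith)]; linarith

theorem pow_rpow_growthExp (hd : 2 ≤ d) {x : ℝ} (hx : 0 ≤ x) :
    (x ^ d) ^ growthExp d = x ^ (d - 1) := by
  have : (2 : ℝ) ≤ d := by exact_mod_cast hd
  rw [← Real.rpow_natCast, ← Real.rpow_mul hx, growthExp, mul_div_cancel₀ _ (by linarith),
    ← Real.rpow_natCast, Nat.cast_sub (by omega), Nat.cast_one]

/-- With about n cells of side n^(-1/d), inserting the points one by one within their cells costs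
O(n · n^(-1/d)), and merging the cells costs the same order. -/
theorem exists_growth (hL : IsEuclideanFunctional L) (hd : 2 ≤ d) :
    ∃ C : ℝ, 0 ≤ C ∧ ∀ A : Multiset (EuclideanSpace ℝ (Fin d)), (∀ x ∈ A, x ∈ unitCube d) →
      L A ≤ C * (Multiset.card A : ℝ) ^ growthExp d := by
  classical
  refine ⟨2 * d + 2 ^ (d + 2) * d * 2 ^ d * 2 ^ (d - 1), by positivity, fun A hA => ?_⟩
  rcases Nat.eq_zero_or_pos (Multiset.card A) with h0 | hpos
  · rw [Multiset.card_eq_zero.1 h0, hL.zero]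
    simp [Real.zero_rpow (growthExp_pos hd).ne']
  have hn : (1 : ℝ) ≤ Multiset.card A := by exact_mod_cast hpos
  set n : ℝ := (Multiset.card A : ℝ) with hn_def
  set r : ℝ := n ^ (1 / (d : ℝ)) with hr
  have hd0 : (d : ℝ) ≠ 0 := by positivity
  have hr1 : 1 ≤ r := Real.one_le_rpow hn (by positivity)
  have hrd : r ^ d = n := by
    rw [hr, ← Real.rpow_natCast, ← Real.rpow_mul (by linarith), one_div_mul_cancel hd0,
      Real.rpow_one]
  have hrp : n ^ growthExp d = r ^ (d - 1) := by
    rw [← hrd, pow_rpow_growthExp hd (by linarith)]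
  set m : ℕ := ⌈r⌉₊ with hm
  have hm0 : 0 < m := Nat.ceil_pos.2 (by linarith)
  have hmr : (0 : ℝ) < m := by exact_mod_cast hm0
  have hm1 : r ≤ m := Nat.le_ceil r
  have hm2 : (m : ℝ) ≤ 2 * r := by
    have := Nat.ceil_lt_add_one (show 0 ≤ r by linarith)
    linarith
  -- The `min` assigns points with a coordinate equal to 1 to the last slab.
  let cell : EuclideanSpace ℝ (Fin d) → Fin d → Fin m := fun x i =>
    ⟨min ⌊m * x i⌋₊ (m - 1), by omega⟩
  have hcell : ∀ b, ∀ x ∈ A.filter (fun x => cell x = b), ∀ i,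
      (b i : ℝ) / m ≤ x i ∧ x i ≤ ((b i : ℝ) + 1) / m := by
    intro b x hx i
    obtain ⟨hxA, rfl⟩ := Multiset.mem_filter.1 hx
    have hxi := hA x hxA i
    have h0 : (0 : ℝ) ≤ m * x i := mul_nonneg hmr.le hxi.1
    rw [div_le_iff₀ hmr, le_div_iff₀ hmr]
    have e : ((cell x i : ℕ) : ℝ) = min (⌊m * x i⌋₊ : ℝ) ((m - 1 : ℕ) : ℝ) := by
      simp only [cell]; push_cast; rfl
    rw [e, Nat.cast_sub (by omega : 1 ≤ m), Nat.cast_one]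
    constructor
    · refine (min_le_left _ _).trans ((Nat.floor_le h0).trans (le_of_eq (mul_comm _ _)))
    · rw [← min_add_add_right]
      refine le_min ?_ ?_
      · rw [mul_comm]; exact (Nat.lt_floor_add_one _).le
      · have := mul_le_mul_of_nonneg_right hxi.2 hmr.le
        linarith
  have hdecomp : A = ∑ b, A.filter fun x => cell x = b := by
    ext a
    rw [Multiset.count_sum']
    simp only [Multiset.count_filter]
    simp
  have h1 := hL.sum_grid_le hd hm0 _ hcell
  rw [← hdecomp] at h1
  have h2 : ∀ b, L (A.filter fun x => cell x = b) ≤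
      Multiset.card (A.filter fun x => cell x = b) * (2 * (d * (1 / m : ℝ))) := by
    intro b
    refine hL.le_card_mul _ (by positivity) fun x hx y hy => ?_
    refine dist_le_of_forall_abs_sub_le (by positivity) fun i => ?_
    have k1 := hcell b x hx i
    have k2 := hcell b y hy i
    rw [add_div] at k1 k2
    rw [abs_le]; constructor <;> linarith
  have h3 := Finset.sum_le_sum fun (b : Fin d → Fin m) (_ : b ∈ Finset.univ) => h2 b
  rw [← Finset.sum_mul, ← Nat.cast_sum, ← Multiset.card_sum, ← hdecomp, ← hn_def] at h3
  have h4 : n * (2 * (d * (1 / m : ℝ))) ≤ 2 * d * r ^ (d - 1) := by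
    have : n = r ^ (d - 1) * r := by rw [← pow_succ, Nat.sub_add_cancel (by omega), hrd]
    rw [this]
    have : r * (1 / m : ℝ) ≤ 1 := by
      rw [mul_one_div, div_le_one hmr]; exact hm1
    calc r ^ (d - 1) * r * (2 * (d * (1 / m : ℝ))) = 2 * d * r ^ (d - 1) * (r * (1 / m)) := by ring
      _ ≤ 2 * d * r ^ (d - 1) * 1 := mul_le_mul_of_nonneg_left this (by positivity)
      _ = _ := mul_one _
  have h5 : (m : ℝ) ^ (d - 1) ≤ 2 ^ (d - 1) * r ^ (d - 1) := by
    rw [← mul_pow]; exact pow_le_pow_left₀ hmr.le hm2 _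
  have h6 := mul_le_mul_of_nonneg_left h5
    (show (0 : ℝ) ≤ 2 ^ (d + 2) * d * 2 ^ d by positivity)
  rw [hrp]
  linarith

/-- The upper bound inserts `B` at the cost given by `exists_growth`. For the lower bound, the
`remove` property leaves at most |B| + 1 points of `A` unserved, and these are reinserted in the
same way. -/
theorem exists_smooth (hL : IsEuclideanFunctional L) (hd : 2 ≤ d) :
    ∃ C : ℝ, 0 ≤ C ∧ ∀ A B : Multiset (EuclideanSpace ℝ (Fin d)),
      (∀ x ∈ A, x ∈ unitCube d) → (∀ x ∈ B, x ∈ unitCube d) →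
      |L (A + B) - L A| ≤ C * (1 + (Multiset.card B : ℝ) ^ growthExp d) := by
  obtain ⟨C, hC, hgrowth⟩ := exists_growth hL hd
  have hp := growthExp_pos hd
  have hp1 := growthExp_lt_one hd
  refine ⟨C + 2 * d, by positivity, fun A B hA hB => ?_⟩
  have hdist : ∀ x ∈ unitCube d, ∀ y ∈ unitCube d, dist x y ≤ d := by
    intro x hx y hy
    have := dist_le_of_forall_abs_sub_le (x := x) (y := y) zero_le_one fun i => by
      have h1 := hx i; have h2 := hy i
      rw [abs_le]; constructor <;> linarith [h1.1, h1.2, h2.1, h2.2]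
    simpa using this
  have hBp : (0 : ℝ) ≤ (Multiset.card B : ℝ) ^ growthExp d := by positivity
  have hdB : (0 : ℝ) ≤ 2 * d * (Multiset.card B : ℝ) ^ growthExp d := by positivity
  rw [abs_le]
  constructor
  · obtain ⟨A₀, D, rfl, hcard, hle⟩ := hL.remove A B
    have hA₀ : ∀ x ∈ A₀, x ∈ unitCube d := fun x hx => hA x (Multiset.mem_add.2 (Or.inl hx))
    have hD : ∀ x ∈ D, x ∈ unitCube d := fun x hx => hA x (Multiset.mem_add.2 (Or.inr hx))
    have h1 := hL.add_le A₀ D d (by positivity) fun x hx y hy => hdist x (hA₀ x hx) y (hD y hy)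
    have h2 := hgrowth D hD
    have h3 : (Multiset.card D : ℝ) ^ growthExp d ≤ (Multiset.card B : ℝ) ^ growthExp d + 1 := by
      calc (Multiset.card D : ℝ) ^ growthExp d ≤ ((Multiset.card B : ℝ) + 1) ^ growthExp d :=
            Real.rpow_le_rpow (by positivity) (by exact_mod_cast hcard) hp.le
        _ ≤ (Multiset.card B : ℝ) ^ growthExp d + 1 ^ growthExp d :=
            Real.rpow_add_le_add_rpow (by positivity) zero_le_one hp.le hp1.le
        _ = _ := by rw [Real.one_rpow]
    have h4 := mul_le_mul_of_nonneg_left h3 hC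
    linarith
  · have h1 := hL.add_le A B d (by positivity) fun x hx y hy => hdist x (hA x hx) y (hB y hy)
    have h2 := hgrowth B hB
    linarith

end Grid

/-! ### Concentration of measure for smooth functions on product spaces -/

section Concentration

open ProbabilityTheory

variable {Ω : Type*} [MeasurableSpace Ω]

/-- The bounded differences inequality, by induction on the number of coordinates: averaging over
all coordinates but the first splits the deviation into a function of one variable and a conditional
deviation, and the sub-Gaussian parameters add. The one-sided hypothesis suffices because an update
can be undone. -/
theorem hasSubgaussianMGF_pi_of_forall_update (μ : Measure Ω) [IsProbabilityMeasure μ] {B : ℝ} {c : NNReal}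
    (n : ℕ) (f : (Fin n → Ω) → ℝ) (hf : Measurable f) (hB : ∀ x, |f x| ≤ B)
    (hfc : ∀ x i a, f (Function.update x i a) ≤ f x + c) :
    HasSubgaussianMGF (fun x => f x - ∫ y, f y ∂Measure.pi fun _ => μ)
      (n * c ^ 2) (Measure.pi fun _ => μ) := by
  have hint : ∀ {α : Type _} [MeasurableSpace α] (ν : Measure α) [IsProbabilityMeasure ν]
      (g : α → ℝ), Measurable g → ∀ K, (∀ x, |g x| ≤ K) → Integrable g ν := by
    intro α _ ν _ g hg K hK
    exact Integrable.of_bound hg.aestronglyMeasurable K (ae_of_all _ fun x => by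
      simpa [Real.norm_eq_abs] using hK x)
  have hexp : ∀ (t v w K : ℝ), |v| ≤ K → |w| ≤ K → |Real.exp (t * (v - w))| ≤
      Real.exp (|t| * (2 * K)) := by
    intro t v w K hv hw
    rw [abs_of_pos (Real.exp_pos _)]
    refine Real.exp_le_exp.2 ((le_abs_self _).trans ?_)
    rw [abs_mul]
    refine mul_le_mul_of_nonneg_left ?_ (abs_nonneg _)
    have := abs_sub v w
    linarith
  have hI : ∀ {α : Type _} [MeasurableSpace α] (ν : Measure α) [IsProbabilityMeasure ν]
      (g : α → ℝ), (∀ x, |g x| ≤ B) → |∫ x, g x ∂ν| ≤ B := by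
    intro α _ ν _ g hg
    have := norm_integral_le_of_norm_le_const (μ := ν) (f := g) (C := B) (ae_of_all _ hg)
    simpa using this
  induction n with
  | zero =>
    have : (fun x => f x - ∫ y, f y ∂Measure.pi fun _ : Fin 0 => μ) = fun _ => (0 : ℝ) := by
      funext x
      have : ∀ y, f y = f x := fun y => congrArg f (Subsingleton.elim y x)
      simp [this]
    rw [this]
    simp
  | succ n ih =>
    have hmp := measurePreserving_piFinSuccAbove (fun _ : Fin (n + 1) => μ) 0
    set e := MeasurableEquiv.piFinSuccAbove (fun _ : Fin (n + 1) => Ω) 0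
    have hmp' : MeasurePreserving e.symm (μ.prod (Measure.pi fun _ : Fin n => μ))
        (Measure.pi fun _ : Fin (n + 1) => μ) := hmp.symm
    have he : ∀ a y, e.symm (a, y) = Fin.cons a y := by
      intro a y
      ext i
      refine Fin.cases ?_ (fun i => ?_) i <;> simp [e, MeasurableEquiv.piFinSuccAbove]
    let F : Ω × (Fin n → Ω) → ℝ := fun q => f (e.symm q)
    have hF : Measurable F := hf.comp e.symm.measurable
    let g : Ω → ℝ := fun a => ∫ y, F (a, y) ∂Measure.pi fun _ : Fin n => μ
    have hg : Measurable g := by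
      have : StronglyMeasurable g := hF.stronglyMeasurable.integral_prod_right'
      exact this.measurable
    have hgB : ∀ a, |g a| ≤ B := fun a => hI _ _ fun y => hB _
    have htot : ∫ y, f y ∂(Measure.pi fun _ : Fin (n + 1) => μ) = ∫ a, g a ∂μ := by
      rw [← hmp'.integral_comp e.symm.measurableEmbedding]
      exact integral_prod _ (hint _ F hF B fun q => hB _)
    have hgdiff : ∀ a b, g a ≤ g b + c := by
      intro a b
      have h1 : ∀ y, F (a, y) ≤ F (b, y) + c := by
        intro y
        have := hfc (e.symm (b, y)) 0 a
        simpa only [F, he, Fin.update_cons_zero] using this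
      have hib := hint (Measure.pi fun _ : Fin n => μ) (fun y => F (b, y))
        (hF.comp measurable_prodMk_left) B fun q => hB _
      calc g a ≤ ∫ y, (F (b, y) + c) ∂Measure.pi fun _ : Fin n => μ := by
            refine integral_mono (hint _ _ (hF.comp measurable_prodMk_left) B fun q => hB _)
              (hib.add (integrable_const (c : ℝ))) h1
        _ = g b + c := by rw [integral_add hib (integrable_const (c : ℝ))]; simp [g]
    have hgsub : HasSubgaussianMGF (fun a => g a - ∫ a, g a ∂μ) (c ^ 2) μ := by
      obtain ⟨b⟩ : Nonempty Ω := by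
        by_contra hne
        rw [not_nonempty_iff] at hne
        have := measure_univ (μ := μ)
        rw [Measure.eq_zero_of_isEmpty μ] at this
        simp at this
      -- The values lie in an interval of length 2c around a fixed value `g b`, so Hoeffding's lemma
      -- gives the parameter c^2.
      have := hasSubgaussianMGF_of_mem_Icc (μ := μ) (a := g b - c) (b := g b + c) hg.aemeasurable
        (ae_of_all _ fun a => ⟨by linarith [hgdiff b a], hgdiff a b⟩)
      convert this using 1
      apply NNReal.coe_injective
      simp only [NNReal.coe_pow, NNReal.coe_div, coe_nnnorm, Real.norm_eq_abs]
      have : g b + c - (g b - c) = 2 * c := by ring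
      rw [this, abs_of_nonneg (by positivity)]
      simp
    have hsec : ∀ a, HasSubgaussianMGF (fun y => F (a, y) - g a) (n * c ^ 2)
        (Measure.pi fun _ : Fin n => μ) := by
      intro a
      refine ih (fun y => F (a, y)) (hF.comp measurable_prodMk_left) (fun y => hB _) ?_
      intro y i b
      have := hfc (e.symm (a, y)) i.succ b
      simpa only [F, he, Fin.cons_update] using this
    constructor
    · intro t
      refine hint _ _ (by fun_prop) (Real.exp (|t| * (2 * B))) fun x => hexp _ _ _ _ (hB x) (hI _ _ hB)
    · intro t
      rw [mgf, htot, ← hmp'.integral_comp e.symm.measurableEmbedding]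
      have hsplit : ∀ q : Ω × (Fin n → Ω), Real.exp (t * (f (e.symm q) - ∫ a, g a ∂μ)) =
          Real.exp (t * (g q.1 - ∫ a, g a ∂μ)) * Real.exp (t * (F q - g q.1)) := by
        intro q
        rw [← Real.exp_add]
        congr 1
        simp only [F]; ring
      rw [integral_prod _ (hint _ _ (by fun_prop) (Real.exp (|t| * (2 * B)))
        fun x => hexp _ _ _ _ (hB _) (hI _ _ hgB))]
      simp only [hsplit, integral_const_mul]
      calc ∫ a, Real.exp (t * (g a - ∫ a, g a ∂μ)) *
              ∫ y, Real.exp (t * (F (a, y) - g a)) ∂(Measure.pi fun _ : Fin n => μ) ∂μ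
          ≤ ∫ a, Real.exp (t * (g a - ∫ a, g a ∂μ)) *
              Real.exp ((n * c ^ 2 : ℝ) * t ^ 2 / 2) ∂μ := by
            refine integral_mono_of_nonneg (ae_of_all _ fun a => ?_) ?_ (ae_of_all _ fun a => ?_)
            · exact mul_nonneg (Real.exp_pos _).le (integral_nonneg fun y => (Real.exp_pos _).le)
            · exact (hgsub.integrable_exp_mul t).mul_const _
            · refine mul_le_mul_of_nonneg_left ?_ (Real.exp_pos _).le
              have := (hsec a).mgf_le t
              simpa [mgf] using this
        _ ≤ Real.exp (c ^ 2 * t ^ 2 / 2) * Real.exp ((n * c ^ 2 : ℝ) * t ^ 2 / 2) := by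
            rw [integral_mul_const]
            refine mul_le_mul_of_nonneg_right ?_ (Real.exp_pos _).le
            have := hgsub.mgf_le t
            simpa [mgf] using this
        _ = _ := by
            rw [← Real.exp_add]
            congr 1
            push_cast
            ring

/-- The function `f` is Lipschitz for the Hamming distance only up to the error ε. Its
inf-convolution `g` with r times the Hamming distance is genuinely r-Lipschitz and lies between f -
ε and f, so bounded differences for `g` control `f`. -/
theorem measure_abs_sub_integral_ge_le [TopologicalSpace Ω] [BorelSpace Ω]
    [SecondCountableTopology Ω] (μ : Measure Ω) [IsProbabilityMeasure μ] {n : ℕ}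
    (f : (Fin n → Ω) → ℝ) (hf : Continuous f) {B : ℝ} (hB : ∀ x, |f x| ≤ B) {r : NNReal} {ε : ℝ}
    (hsmooth : ∀ (S : Finset (Fin n)) (x z : Fin n → Ω),
      |f (S.piecewise z x) - f x| ≤ r * S.card + ε) {s : ℝ} (hs : 0 ≤ s) :
    (Measure.pi fun _ : Fin n => μ).real
      {x | s + 2 * ε ≤ |f x - ∫ y, f y ∂Measure.pi fun _ => μ|} ≤
      2 * Real.exp (-s ^ 2 / (2 * (n * r ^ 2))) := by
  classical
  obtain ⟨ω⟩ : Nonempty Ω := by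
    by_contra hne
    rw [not_nonempty_iff] at hne
    have := measure_univ (μ := μ)
    rw [Measure.eq_zero_of_isEmpty μ] at this
    simp at this
  have : Nonempty (Finset (Fin n) × (Fin n → Ω)) := ⟨(∅, fun _ => ω)⟩
  let h : Finset (Fin n) × (Fin n → Ω) → (Fin n → Ω) → ℝ := fun q x =>
    f (q.1.piecewise q.2 x) + r * q.1.card
  have hhB : ∀ q x, -B ≤ h q x := by
    intro q x
    have h1 := (abs_le.1 (hB (q.1.piecewise q.2 x))).1
    have h2 : 0 ≤ r * q.1.card := by positivity
    simp only [h]; linarith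
  have hbdd : ∀ x, BddBelow (Set.range fun q => h q x) := fun x =>
    ⟨-B, by rintro _ ⟨q, rfl⟩; exact hhB q x⟩
  let g : (Fin n → Ω) → ℝ := fun x => ⨅ q, h q x
  have hgle : ∀ q x, g x ≤ h q x := fun q x => ciInf_le (hbdd x) q
  -- The infimum runs over an uncountable family, so measurability comes from upper semicontinuity;
  -- this is what continuity of `f` is for.
  have hgmeas : Measurable g := by
    have : UpperSemicontinuous g := by
      refine upperSemicontinuous_ciInf hbdd fun q => Continuous.upperSemicontinuous ?_
      refine (hf.comp (continuous_pi fun i => ?_)).add continuous_const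
      by_cases hi : i ∈ q.1
      · simp only [Finset.piecewise_eq_of_mem _ _ _ hi]; fun_prop
      · simp only [Finset.piecewise_eq_of_notMem _ _ _ hi]; fun_prop
    exact this.measurable
  have hgf : ∀ x, g x ≤ f x := fun x => by
    have := hgle (∅, x) x
    simpa [h] using this
  have hfg : ∀ x, f x - ε ≤ g x := fun x => by
    refine le_ciInf fun q => ?_
    have := (abs_le.1 (hsmooth q.1 x q.2)).1
    simp only [h]; linarith
  have hgB : ∀ x, |g x| ≤ B := fun x => by
    rw [abs_le]
    exact ⟨le_ciInf fun q => hhB q x, (hgf x).trans (abs_le.1 (hB x)).2⟩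
  have hglip : ∀ x i a, g (Function.update x i a) ≤ g x + r := by
    intro x i a
    rw [← sub_le_iff_le_add]
    refine le_ciInf fun q => ?_
    rw [sub_le_iff_le_add]
    by_cases hi : i ∈ q.1
    · refine (hgle q _).trans ?_
      have : q.1.piecewise q.2 (Function.update x i a) = q.1.piecewise q.2 x := by
        ext j
        by_cases hj : j ∈ q.1
        · simp [hj]
        · have : j ≠ i := fun h => hj (h ▸ hi)
          simp [hj, this]
      simp only [h, this]; linarith
    -- Adding `i` to the replaced coordinates, with the old value `x i`, undoes the update at the
    -- price r.
    · refine (hgle (insert i q.1, Function.update q.2 i (x i)) _).trans ?_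
      have : (insert i q.1).piecewise (Function.update q.2 i (x i)) (Function.update x i a) =
          q.1.piecewise q.2 x := by
        ext j
        by_cases hij : j = i
        · subst hij; simp [hi]
        · by_cases hj : j ∈ q.1
          · simp [hj, hij]
          · simp [hj, hij]
      simp only [h, this, Finset.card_insert_of_notMem hi]
      push_cast; linarith
  have hsub := hasSubgaussianMGF_pi_of_forall_update μ (c := r) n g hgmeas hgB hglip
  have hif : Integrable f (Measure.pi fun _ => μ) :=
    Integrable.of_bound hf.measurable.aestronglyMeasurable B (ae_of_all _ fun x => by
      simpa [Real.norm_eq_abs] using hB x)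
  have hig : Integrable g (Measure.pi fun _ => μ) :=
    Integrable.of_bound hgmeas.aestronglyMeasurable B (ae_of_all _ fun x => by
      simpa [Real.norm_eq_abs] using hgB x)
  have hI1 : ∫ y, g y ∂(Measure.pi fun _ => μ) ≤ ∫ y, f y ∂(Measure.pi fun _ => μ) :=
    integral_mono hig hif hgf
  have hI2 : ∫ y, f y ∂(Measure.pi fun _ => μ) - ε ≤ ∫ y, g y ∂(Measure.pi fun _ => μ) := by
    have := integral_mono (hif.sub (integrable_const ε)) hig hfg
    rw [integral_sub' hif (integrable_const ε)] at this
    simpa using this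
  have hincl : {x | s + 2 * ε ≤ |f x - ∫ y, f y ∂Measure.pi fun _ => μ|} ⊆
      {x | s ≤ g x - ∫ y, g y ∂Measure.pi fun _ => μ} ∪
      {x | s ≤ (-fun x => g x - ∫ y, g y ∂Measure.pi fun _ => μ) x} := by
    intro x hx
    simp only [Set.mem_ofPred_eq, Set.mem_union, Pi.neg_apply] at hx ⊢
    have h1 := hgf x
    have h2 := hfg x
    rcases le_abs.1 hx with hx | hx
    · left; linarith
    · right; linarith
  refine (measureReal_mono hincl).trans ((measureReal_union_le _ _).trans ?_)
  have h1 := hsub.measure_ge_le hs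
  have h2 := hsub.neg.measure_ge_le hs
  have e : ((n * r ^ 2 : NNReal) : ℝ) = n * r ^ 2 := by simp
  rw [e] at h1 h2
  linarith

end Concentration

/-! ### Self-similarity of the uniform distribution -/

section SelfSimilar

/-- A product of mixtures is the mixture, over all assignments of components to coordinates, of the
products. -/
theorem pi_smul_sum {Ω ι κ : Type*} [MeasurableSpace Ω] [Fintype ι] [DecidableEq ι]
    [Fintype κ] (ν : κ → Measure Ω) [∀ k, SigmaFinite (ν k)] (μ : Measure Ω) [SigmaFinite μ] (c : ENNReal)
    (hμ : μ = c • ∑ k, ν k) :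
    Measure.pi (fun _ : ι => μ) =
      c ^ Fintype.card ι • ∑ u : ι → κ, Measure.pi fun j => ν (u j) := by
  refine Measure.pi_eq fun s hs => ?_
  simp only [Measure.smul_apply, Measure.finsetSum_apply, Measure.pi_pi, smul_eq_mul, hμ]
  rw [Finset.prod_mul_distrib, Finset.prod_const, Finset.card_univ, Finset.prod_univ_sum,
    Fintype.piFinset_univ]

theorem restrict_Icc_eq_smul_sum_map {m : ℕ} (hm : 0 < m) :
    (volume.restrict (Set.Icc (0 : ℝ) 1)) = (m : ENNReal)⁻¹ •
      ∑ i : Fin m, (volume.restrict (Set.Icc (0 : ℝ) 1)).map fun t => ((i : ℝ) + t) / m := by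
  have hmr : (0 : ℝ) < m := by exact_mod_cast hm
  -- Half-open intervals make the subintervals disjoint.
  rw [← Measure.restrict_congr_set (Ico_ae_eq_Icc (μ := volume) (a := (0 : ℝ)) (b := 1))]
  ext s hs
  simp only [Measure.smul_apply, Measure.finsetSum_apply, smul_eq_mul]
  have hmeas : ∀ i : Fin m, Measurable fun t : ℝ => ((i : ℝ) + t) / m := fun i => by fun_prop
  have key : ∀ i : Fin m, ((volume.restrict (Set.Ico (0 : ℝ) 1)).map
      fun t => ((i : ℝ) + t) / m) s = m * volume (s ∩ Set.Ico ((i : ℝ) / m) (((i : ℝ) + 1) / m)) := by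
    intro i
    rw [Measure.map_apply (hmeas i) hs, Measure.restrict_apply (hmeas i hs)]
    have e : (fun t : ℝ => ((i : ℝ) + t) / m) ⁻¹' s ∩ Set.Ico 0 1 =
        (fun t => (i : ℝ) + t) ⁻¹' ((fun t => t * (m : ℝ)⁻¹) ⁻¹'
          (s ∩ Set.Ico ((i : ℝ) / m) (((i : ℝ) + 1) / m))) := by
      ext t
      simp only [Set.mem_inter_iff, Set.mem_preimage, Set.mem_Ico, ← div_eq_mul_inv,
        div_le_div_iff_of_pos_right hmr, div_lt_div_iff_of_pos_right hmr]
      constructor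
      · rintro ⟨h1, h2, h3⟩; exact ⟨h1, by linarith, by linarith⟩
      · rintro ⟨h1, h2, h3⟩; exact ⟨h1, by linarith, by linarith⟩
    rw [e, measure_preimage_add, Real.volume_preimage_mul_right (inv_ne_zero hmr.ne'), inv_inv,
      abs_of_pos hmr, ENNReal.ofReal_natCast]
  simp only [key]
  rw [← Finset.mul_sum, ← mul_assoc, ENNReal.inv_mul_cancel (by exact_mod_cast hm.ne')
    (ENNReal.natCast_ne_top m), one_mul, Measure.restrict_apply hs, ← measure_biUnion_finset]
  · congr 1
    rw [← Set.inter_iUnion₂]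
    congr 1
    ext t
    simp only [Set.mem_Ico, Set.mem_iUnion, Finset.mem_univ, exists_prop, true_and]
    constructor
    · rintro ⟨h0, h1⟩
      have h2 : (0 : ℝ) ≤ t * m := by positivity
      have h3 : ⌊t * m⌋₊ < m := (Nat.floor_lt h2).2 (by nlinarith)
      refine ⟨⟨_, h3⟩, ?_, ?_⟩
      · rw [div_le_iff₀ hmr]; exact Nat.floor_le h2
      · rw [lt_div_iff₀ hmr]; exact Nat.lt_floor_add_one _
    · rintro ⟨i, h0, h1⟩
      have hi : ((i : ℕ) : ℝ) + 1 ≤ m := by exact_mod_cast i.2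
      exact ⟨le_trans (by positivity) h0, h1.trans_le ((div_le_one hmr).2 hi)⟩
  · intro i _ j _ hij
    refine Set.disjoint_left.2 fun t ht ht' => hij (Fin.ext ?_)
    have h1 := ht.2.1; have h2 := ht.2.2; have h3 := ht'.2.1; have h4 := ht'.2.2
    rw [div_le_iff₀ hmr] at h1 h3
    rw [lt_div_iff₀ hmr] at h2 h4
    have h5 : ((i : ℕ) : ℝ) < (j : ℕ) + 1 := by linarith
    have h6 : ((j : ℕ) : ℝ) < (i : ℕ) + 1 := by linarith
    have h5' : (i : ℕ) < j + 1 := by exact_mod_cast h5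
    have h6' : (j : ℕ) < i + 1 := by exact_mod_cast h6
    omega
  · intro i _
    exact hs.inter measurableSet_Ico

/-- The similarity that maps the unit cube onto the cell `b` of the grid of mesh `1 / m`. -/
noncomputable def cellMap {d m : ℕ} (b : Fin d → Fin m) (v : EuclideanSpace ℝ (Fin d)) :
    EuclideanSpace ℝ (Fin d) :=
  WithLp.toLp 2 fun i => ((b i : ℝ) + v i) / m

@[simp] theorem cellMap_apply {d m : ℕ} (b : Fin d → Fin m) (v : EuclideanSpace ℝ (Fin d))
    (i : Fin d) : cellMap b v i = ((b i : ℝ) + v i) / m := rfl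

theorem measurable_cellMap {d m : ℕ} (b : Fin d → Fin m) : Measurable (cellMap b) := by
  unfold cellMap
  fun_prop

theorem dist_cellMap {d m : ℕ} (b : Fin d → Fin m) (x y : EuclideanSpace ℝ (Fin d)) :
    dist (cellMap b x) (cellMap b y) = (1 / m : ℝ) * dist x y := by
  have : cellMap b x - cellMap b y = (1 / m : ℝ) • (x - y) := by
    ext i
    simp only [PiLp.sub_apply, PiLp.smul_apply, cellMap_apply, smul_eq_mul]
    ring
  rw [dist_eq_norm, this, norm_smul, dist_eq_norm, Real.norm_of_nonneg (by positivity)]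

theorem uniformCube_eq_map_pi (d : ℕ) : uniformCube d =
    (Measure.pi fun _ : Fin d => volume.restrict (Set.Icc (0 : ℝ) 1)).map (WithLp.toLp 2) := by
  have h : unitCube d = (WithLp.ofLp : EuclideanSpace ℝ (Fin d) → Fin d → ℝ) ⁻¹'
      (Set.univ.pi fun _ => Set.Icc (0 : ℝ) 1) := by
    ext x
    simp only [unitCube, Set.mem_ofPred_eq, Set.mem_preimage, Set.mem_univ_pi]
  rw [← Measure.restrict_pi_pi, ← volume_pi]
  have hmp := (PiLp.volume_preserving_toLp (Fin d))
  have hmeas : MeasurableSet (unitCube d) := by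
    rw [h]
    exact (MeasurableSet.univ_pi fun _ => measurableSet_Icc).preimage (by fun_prop)
  rw [uniformCube, ← hmp.map_eq, Measure.restrict_map hmp.measurable hmeas, h]
  congr 1

theorem measurableSet_unitCube (d : ℕ) : MeasurableSet (unitCube d) := by
  have h : unitCube d = (WithLp.ofLp : EuclideanSpace ℝ (Fin d) → Fin d → ℝ) ⁻¹'
      (Set.univ.pi fun _ => Set.Icc (0 : ℝ) 1) := by
    ext x
    simp only [unitCube, Set.mem_ofPred_eq, Set.mem_preimage, Set.mem_univ_pi]
  rw [h]
  exact (MeasurableSet.univ_pi fun _ => measurableSet_Icc).preimage (by fun_prop)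

theorem uniformCube_eq_smul_sum_map (d : ℕ) {m : ℕ} (hm : 0 < m) :
    uniformCube d = ((m : ENNReal)⁻¹ ^ d) • ∑ b : Fin d → Fin m, (uniformCube d).map (cellMap b) := by
  have hmt : Measurable (WithLp.toLp 2 : (Fin d → ℝ) → EuclideanSpace ℝ (Fin d)) := by fun_prop
  have hmeas : ∀ i : Fin m, Measurable fun t : ℝ => ((i : ℝ) + t) / m := fun i => by fun_prop
  have hprob : ∀ i : Fin m, IsFiniteMeasure ((volume.restrict (Set.Icc (0 : ℝ) 1)).map
      fun t : ℝ => ((i : ℝ) + t) / m) := fun i => by infer_instance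
  have h1 := pi_smul_sum (ι := Fin d) _ _ _ (restrict_Icc_eq_smul_sum_map hm)
  have h2 := congrArg (Measure.map (WithLp.toLp 2 : (Fin d → ℝ) → EuclideanSpace ℝ (Fin d))) h1
  rw [← uniformCube_eq_map_pi, Measure.map_smul, Fintype.card_fin, Measure.map_finset_sum (by fun_prop)] at h2
  refine h2.trans (congrArg _ (Finset.sum_congr rfl fun b _ => ?_))
  rw [uniformCube_eq_map_pi, ← Measure.pi_map_pi fun i => (hmeas (b i)).aemeasurable,
    Measure.map_map hmt (by fun_prop), Measure.map_map (measurable_cellMap b) hmt]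
  rfl

theorem ae_mem_unitCube (d : ℕ) (ι : Type*) [Fintype ι] :
    ∀ᵐ x ∂(Measure.pi fun _ : ι => uniformCube d), ∀ i, x i ∈ unitCube d := by
  refine ae_all_iff.2 fun i => ?_
  have h : ∀ᵐ v ∂uniformCube d, v ∈ unitCube d := ae_restrict_mem (measurableSet_unitCube d)
  exact (measurePreserving_eval (fun _ : ι => uniformCube d) i).quasiMeasurePreserving.ae h

end SelfSimilar

/-! ### Convergence of the normalized means -/

section Analytic

/-- Up to normalization this is the second moment of the occupation numbers when n balls fall
uniformly into the boxes; one ball is added at a time. -/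
theorem sum_sum_sq_count {B : Type*} [Fintype B] [DecidableEq B] [Nonempty B] (n : ℕ) :
    ∑ u : Fin n → B, ∑ b, (∑ j, if u j = b then (1 : ℝ) else 0) ^ 2 =
      (Fintype.card B : ℝ) ^ n * (n + n * (n - 1) / Fintype.card B) := by
  have hM : (Fintype.card B : ℝ) ≠ 0 := by exact_mod_cast Fintype.card_ne_zero
  induction n with
  | zero => simp
  | succ n ih =>
    rw [← Equiv.sum_comp (Fin.consEquiv fun _ : Fin (n + 1) => B), Fintype.sum_prod_type_right]
    simp only [Fin.consEquiv_apply, Fin.sum_univ_succ, Fin.cons_zero, Fin.cons_succ]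
    have key : ∀ u : Fin n → B, ∑ c : B, ∑ b : B,
        ((if c = b then (1 : ℝ) else 0) + ∑ j, if u j = b then (1 : ℝ) else 0) ^ 2 =
        Fintype.card B + 2 * n +
          Fintype.card B * ∑ b, (∑ j, if u j = b then (1 : ℝ) else 0) ^ 2 := by
      intro u
      have h1 : ∀ c, ∑ b : B,
          ((if c = b then (1 : ℝ) else 0) + ∑ j, if u j = b then (1 : ℝ) else 0) ^ 2 =
          1 + 2 * (∑ j, if u j = c then (1 : ℝ) else 0) +
            ∑ b, (∑ j, if u j = b then (1 : ℝ) else 0) ^ 2 := by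
        intro c
        have : ∀ b : B,
            ((if c = b then (1 : ℝ) else 0) + ∑ j, if u j = b then (1 : ℝ) else 0) ^ 2 =
            (if c = b then 1 + 2 * (∑ j, if u j = b then (1 : ℝ) else 0) else 0) +
              (∑ j, if u j = b then (1 : ℝ) else 0) ^ 2 := by
          intro b
          split_ifs <;> ring
        simp only [this, Finset.sum_add_distrib, Finset.sum_ite_eq, Finset.mem_univ, if_true]
      simp only [h1, Finset.sum_add_distrib, ← Finset.mul_sum]
      rw [Finset.sum_comm]
      simp
    simp only [key, Finset.sum_add_distrib, ← Finset.mul_sum, ih]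
    simp only [Finset.sum_const, Finset.card_univ, Fintype.card_fun, Fintype.card_fin,
      nsmul_eq_mul]
    push_cast
    field_simp
    ring

/-- The occupation numbers have mean k, and each contributes a variance of at most k. -/
theorem sum_sum_sq_count_sub_le {B : Type*} [Fintype B] [DecidableEq B] [Nonempty B] (k : ℕ) :
    ∑ u : Fin (Fintype.card B * k) → B, ∑ b, ((∑ j, if u j = b then (1 : ℝ) else 0) - k) ^ 2 ≤
      (Fintype.card B : ℝ) ^ (Fintype.card B * k) * (Fintype.card B * k) := by
  have hM : (0 : ℝ) < Fintype.card B := by exact_mod_cast Fintype.card_pos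
  have h : ∀ u : Fin (Fintype.card B * k) → B,
      ∑ b, ((∑ j, if u j = b then (1 : ℝ) else 0) - k) ^ 2 =
      ∑ b, (∑ j, if u j = b then (1 : ℝ) else 0) ^ 2 - Fintype.card B * (k : ℝ) ^ 2 := by
    intro u
    have h1 : ∑ b, ∑ j, (if u j = b then (1 : ℝ) else 0) = Fintype.card B * k := by
      rw [Finset.sum_comm]
      simp
    simp only [sub_sq, Finset.sum_add_distrib, Finset.sum_sub_distrib, ← Finset.sum_mul,
      ← Finset.mul_sum, h1]
    simp
    ring
  simp only [h, Finset.sum_sub_distrib, sum_sum_sq_count]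
  simp only [Finset.sum_const, Finset.card_univ, Fintype.card_fun, Fintype.card_fin, nsmul_eq_mul]
  push_cast
  rw [← mul_sub]
  refine mul_le_mul_of_nonneg_left ?_ (by positivity)
  have : (Fintype.card B : ℝ) * k * (Fintype.card B * k - 1) / Fintype.card B =
      k * (Fintype.card B * k - 1) := by field_simp
  rw [this]
  have : (0 : ℝ) ≤ k := by positivity
  nlinarith

/-- Trades a fractional moment for a second moment. Applied with s = √k, the typical deviation of an
occupation number with mean k. -/
theorem rpow_le_mul_one_add_sq {p t s : ℝ} (hp : 0 ≤ p) (hp1 : p ≤ 1) (ht : 0 ≤ t) (hs : 0 < s) :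
    t ^ p ≤ s ^ p * (1 + t ^ 2 / s ^ 2) := by
  have h1 : t ^ p = s ^ p * (t / s) ^ p := by
    rw [← Real.mul_rpow hs.le (by positivity), mul_div_cancel₀ _ hs.ne']
  rw [h1, ← div_pow]
  refine mul_le_mul_of_nonneg_left ?_ (by positivity)
  set y := t / s
  have hy : 0 ≤ y := by positivity
  rcases le_total y 1 with h | h
  · have := Real.rpow_le_one hy h hp
    nlinarith [sq_nonneg y]
  · have h2 := Real.rpow_le_rpow_of_exponent_le h (show p ≤ 2 by linarith)
    rw [Real.rpow_two] at h2
    linarith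

/-- A Fekete-type argument. Subadditivity controls only the indices m^d k; smoothness fills the
gaps, because with k fixed the distance from n to the nearest such index below is o(n). -/
theorem exists_tendsto_div_rpow {d : ℕ} (hd : 2 ≤ d) {a : ℕ → ℝ} {C : ℝ} (hC : 0 ≤ C)
    (ha : ∀ n, 0 ≤ a n)
    (hsmooth : ∀ n k, k ≤ n → |a n - a k| ≤ C * (1 + ((n - k : ℕ) : ℝ) ^ growthExp d))
    (hsub : ∀ m k, 0 < m → 0 < k →
      a (m ^ d * k) ≤ (m : ℝ) ^ (d - 1) * (a k + C * (√k) ^ growthExp d)) :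
    ∃ β : ℝ, Tendsto (fun n : ℕ => a n / (n : ℝ) ^ growthExp d) atTop (𝓝 β) := by
  set p := growthExp d with hp_def
  have hp := growthExp_pos hd
  have hp1 := growthExp_lt_one hd
  rw [← hp_def] at hp hp1
  have hd0 : (d : ℝ) ≠ 0 := by positivity
  -- Including the error term makes `w k` an upper bound for the normalized value at every m^d k. As
  -- the error vanishes, the infimum of `w` is also an asymptotic lower bound.
  let w : ℕ → ℝ := fun k => a k / (k : ℝ) ^ p + C * ((√k) ^ p / (k : ℝ) ^ p)
  have hw0 : ∀ k, 0 ≤ w k := fun k => by have := ha k; positivity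
  set β : ℝ := ⨅ k : ℕ, w (k + 1) with hβ
  have hbdd : BddBelow (Set.range fun k : ℕ => w (k + 1)) :=
    ⟨0, by rintro _ ⟨k, rfl⟩; exact hw0 _⟩
  refine ⟨β, ?_⟩
  have htail : Tendsto (fun n : ℕ => C * ((√n) ^ p / (n : ℝ) ^ p)) atTop (𝓝 0) := by
    have h1 : ∀ n : ℕ, 0 < n → C * ((√n) ^ p / (n : ℝ) ^ p) = C * (√n) ^ (-p) := by
      intro n hn
      have hnr : (0 : ℝ) < n := by exact_mod_cast hn
      have hs : 0 < √(n : ℝ) := Real.sqrt_pos.2 hnr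
      have e : (n : ℝ) ^ p = (√n) ^ p * (√n) ^ p := by
        rw [← Real.mul_rpow hs.le hs.le, Real.mul_self_sqrt hnr.le]
      rw [e, Real.rpow_neg hs.le]
      have : (√(n : ℝ)) ^ p ≠ 0 := by positivity
      field_simp
    have h2 : Tendsto (fun n : ℕ => C * (√(n : ℝ)) ^ (-p)) atTop (𝓝 (C * 0)) :=
      ((tendsto_rpow_neg_atTop hp).comp
        (Real.tendsto_sqrt_atTop.comp tendsto_natCast_atTop_atTop)).const_mul C
    rw [mul_zero] at h2
    refine h2.congr' ?_
    filter_upwards [eventually_gt_atTop 0] with n hn using (h1 n hn).symm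
  rw [Metric.tendsto_atTop']
  intro ε hε
  have hlow : ∀ᶠ n : ℕ in atTop, β - ε < a n / (n : ℝ) ^ p := by
    filter_upwards [htail.eventually_lt_const hε, eventually_gt_atTop 0] with n hn hn0
    have h1 : β ≤ w n := by
      have := ciInf_le hbdd (n - 1)
      rwa [Nat.sub_add_cancel hn0] at this
    simp only [w] at h1
    linarith
  have hupp : ∀ᶠ n : ℕ in atTop, a n / (n : ℝ) ^ p < β + ε := by
    obtain ⟨k', hk'⟩ := exists_lt_of_ciInf_lt (show (⨅ k : ℕ, w (k + 1)) < β + ε / 2 by linarith)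
    set k := k' + 1
    have hk : 0 < k := Nat.succ_pos _
    have hkr : (0 : ℝ) < k := by exact_mod_cast hk
    let y : ℕ → ℝ := fun n => ((n : ℝ) / k) ^ (1 / (d : ℝ))
    have hy : Tendsto y atTop atTop :=
      (tendsto_rpow_atTop (by positivity)).comp (tendsto_natCast_atTop_atTop.atTop_div_const hkr)
    have herr : Tendsto (fun n : ℕ => C * ((n : ℝ) ^ (-p) + (1 - (1 - (y n)⁻¹) ^ d) ^ p))
        atTop (𝓝 0) := by
      have h1 : Tendsto (fun n : ℕ => (n : ℝ) ^ (-p)) atTop (𝓝 0) :=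
        (tendsto_rpow_neg_atTop hp).comp tendsto_natCast_atTop_atTop
      have h2 : Tendsto (fun n => (1 - (1 - (y n)⁻¹) ^ d) ^ p) atTop (𝓝 0) := by
        have h3 : Tendsto (fun n => 1 - (1 - (y n)⁻¹) ^ d) atTop (𝓝 (1 - (1 - 0) ^ d)) :=
          ((hy.inv_tendsto_atTop.const_sub 1).pow d).const_sub 1
        have h4 := h3.rpow_const (p := p) (Or.inr hp.le)
        simpa [Real.zero_rpow hp.ne'] using h4
      simpa using (h1.add h2).const_mul C
    filter_upwards [herr.eventually_lt_const (show 0 < ε / 2 by linarith),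
      hy.eventually_ge_atTop 1, eventually_gt_atTop 0] with n hn hy1 hn0
    have hnr : (0 : ℝ) < n := by exact_mod_cast hn0
    have hnp : 0 < (n : ℝ) ^ p := by positivity
    -- The largest m with m^d k ≤ n.
    set m := ⌊y n⌋₊ with hm
    have hm0 : 0 < m := Nat.floor_pos.2 hy1
    have hmr : (0 : ℝ) < m := by exact_mod_cast hm0
    have hyn : 0 < y n := by linarith
    have hyd : y n ^ d = n / k := by
      simp only [y]
      rw [← Real.rpow_natCast, ← Real.rpow_mul (by positivity), one_div_mul_cancel hd0,
        Real.rpow_one]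
    have hmy : (m : ℝ) ≤ y n := Nat.floor_le hyn.le
    have hle : (m : ℝ) ^ d * k ≤ n := by
      rw [← le_div_iff₀ hkr, ← hyd]
      exact pow_le_pow_left₀ hmr.le hmy d
    have hle' : m ^ d * k ≤ n := by exact_mod_cast hle
    have h1 := (abs_le.1 (hsmooth n (m ^ d * k) hle')).2
    have h2 := hsub m k hm0 hk
    have h3 : (m : ℝ) ^ (d - 1) * (k : ℝ) ^ p ≤ (n : ℝ) ^ p := by
      rw [← pow_rpow_growthExp hd hmr.le, ← Real.mul_rpow (by positivity) hkr.le]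
      exact Real.rpow_le_rpow (by positivity) hle hp.le
    have h4 : a k + C * (√k) ^ p = w k * (k : ℝ) ^ p := by
      have : (k : ℝ) ^ p ≠ 0 := by positivity
      simp only [w]; field_simp
    rw [h4] at h2
    have h5 : (m : ℝ) ^ (d - 1) * (w k * (k : ℝ) ^ p) ≤ w k * (n : ℝ) ^ p := by
      have := mul_le_mul_of_nonneg_left h3 (hw0 k)
      linarith
    have h6 : ((n - m ^ d * k : ℕ) : ℝ) ≤ n * (1 - (1 - (y n)⁻¹) ^ d) := by
      have h7 : y n * (1 - (y n)⁻¹) ≤ m := by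
        have := Nat.lt_floor_add_one (y n)
        rw [mul_sub, mul_inv_cancel₀ hyn.ne']
        linarith
      have h8 : (0 : ℝ) ≤ 1 - (y n)⁻¹ := sub_nonneg.2 (inv_le_one_of_one_le₀ hy1)
      have h9 := pow_le_pow_left₀ (by positivity) h7 d
      rw [mul_pow, hyd] at h9
      have h10 := mul_le_mul_of_nonneg_right h9 hkr.le
      have h11 : (n : ℝ) / k * (1 - (y n)⁻¹) ^ d * k = n * (1 - (y n)⁻¹) ^ d := by
        field_simp
      rw [Nat.cast_sub hle']
      push_cast
      rw [h11] at h10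
      linarith
    have h7 : ((n - m ^ d * k : ℕ) : ℝ) ^ p ≤ (n : ℝ) ^ p * (1 - (1 - (y n)⁻¹) ^ d) ^ p := by
      have h8 : (0 : ℝ) ≤ 1 - (1 - (y n)⁻¹) ^ d := by
        have h9 : (1 - (y n)⁻¹) ^ d ≤ 1 :=
          pow_le_one₀ (sub_nonneg.2 (inv_le_one_of_one_le₀ hy1))
            (by linarith [inv_pos.2 hyn])
        linarith
      rw [← Real.mul_rpow hnr.le h8]
      exact Real.rpow_le_rpow (by positivity) h6 hp.le
    have h8 : C * (1 + ((n - m ^ d * k : ℕ) : ℝ) ^ p) ≤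
        C * ((n : ℝ) ^ (-p) + (1 - (1 - (y n)⁻¹) ^ d) ^ p) * (n : ℝ) ^ p := by
      have h9 : (n : ℝ) ^ (-p) * (n : ℝ) ^ p = 1 := by
        rw [Real.rpow_neg hnr.le, inv_mul_cancel₀ hnp.ne']
      have h10 : C * ((n : ℝ) ^ (-p) + (1 - (1 - (y n)⁻¹) ^ d) ^ p) * (n : ℝ) ^ p =
          C * (1 + (n : ℝ) ^ p * (1 - (1 - (y n)⁻¹) ^ d) ^ p) := by
        rw [mul_assoc, add_mul, h9]; ring
      rw [h10]
      exact mul_le_mul_of_nonneg_left (by linarith) hC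
    rw [div_lt_iff₀ hnp]
    have h9 := mul_lt_mul_of_pos_right hn hnp
    have h10 := mul_lt_mul_of_pos_right hk' hnp
    linarith
  obtain ⟨N, hN⟩ := (hlow.and hupp).exists_forall_of_atTop
  refine ⟨N, fun n hn => ?_⟩
  obtain ⟨h1, h2⟩ := hN n hn.le
  rw [Real.dist_eq, abs_lt]
  constructor <;> linarith

end Analytic

/-! ### Smoothness and approximate subadditivity of the expected values -/

section Mean

variable {d : ℕ} {L : Multiset (EuclideanSpace ℝ (Fin d)) → ℝ}

/-- The expected value of a functional of `n` independent uniform points of the unit cube. -/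
noncomputable def meanValue (d : ℕ) (L : Multiset (EuclideanSpace ℝ (Fin d)) → ℝ) (n : ℕ) : ℝ :=
  ∫ x, L (Finset.univ.val.map x) ∂Measure.pi fun _ : Fin n => uniformCube d

theorem IsEuclideanFunctional.integrable_pi (hL : IsEuclideanFunctional L) (hd : 2 ≤ d)
    {ι : Type} [Fintype ι] (s : Finset ι) :
    Integrable (fun x : ι → EuclideanSpace ℝ (Fin d) => L (s.val.map x))
      (Measure.pi fun _ => uniformCube d) := by
  obtain ⟨C, hC, hgrowth⟩ := exists_growth hL hd
  refine Integrable.of_bound (hL.continuous s.val).measurable.aestronglyMeasurable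
    (C * (s.card : ℝ) ^ growthExp d) ?_
  filter_upwards [ae_mem_unitCube d ι] with x hx
  rw [Real.norm_of_nonneg (hL.nonneg _)]
  have := hgrowth (s.val.map x) fun y hy => by
    obtain ⟨i, -, rfl⟩ := Multiset.mem_map.1 hy
    exact hx i
  rwa [Multiset.card_map] at this

/-- A subfamily of the points is again an independent uniform sample. This couples samples of
different sizes on one product space. -/
theorem integral_map_eq_meanValue (hL : IsEuclideanFunctional L) {n : ℕ} (s : Finset (Fin n)) :
    ∫ x, L (s.val.map x) ∂(Measure.pi fun _ : Fin n => uniformCube d) = meanValue d L s.card := by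
  have h := Measure.map_infinitePi_infinitePi_of_inj (P := fun _ : Fin n => uniformCube d)
    (s.orderEmbOfFin rfl).injective
  rw [Measure.infinitePi_eq_pi, Measure.infinitePi_eq_pi] at h
  have hmeas : Measurable fun (ω : Fin n → EuclideanSpace ℝ (Fin d)) (i : Fin s.card) =>
      ω (s.orderEmbOfFin rfl i) := measurable_pi_lambda _ fun i => measurable_pi_apply _
  rw [meanValue, ← h, integral_map hmeas.aemeasurable
    (hL.continuous _).measurable.aestronglyMeasurable]
  refine integral_congr_ae (ae_of_all _ fun x => ?_)
  have hs : s.val = Finset.univ.val.map (s.orderEmbOfFin rfl) := by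
    conv_lhs => rw [← Finset.map_orderEmbOfFin_univ s rfl]
    rfl
  simp only
  conv_lhs => rw [hs]
  rw [Multiset.map_map]
  rfl

theorem exists_meanValue_smooth (hL : IsEuclideanFunctional L) (hd : 2 ≤ d) :
    ∃ C : ℝ, 0 ≤ C ∧ ∀ n k, k ≤ n →
      |meanValue d L n - meanValue d L k| ≤ C * (1 + ((n - k : ℕ) : ℝ) ^ growthExp d) := by
  obtain ⟨C, hC, hsmooth⟩ := exists_smooth hL hd
  refine ⟨C, hC, fun n k hkn => ?_⟩
  obtain ⟨s, -, hs⟩ := Finset.exists_subset_card_eq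
    (s := (Finset.univ : Finset (Fin n))) (n := k) (by simpa using hkn)
  have h1 : meanValue d L k = _ := hs ▸ (integral_map_eq_meanValue hL s).symm
  rw [h1, meanValue, ← integral_sub (hL.integrable_pi hd _) (hL.integrable_pi hd _)]
  have h2 := norm_integral_le_of_norm_le_const (μ := Measure.pi fun _ : Fin n => uniformCube d)
    (f := fun x => L (Finset.univ.val.map x) - L (s.val.map x))
    (C := C * (1 + ((n - k : ℕ) : ℝ) ^ growthExp d)) ?_
  · simpa using h2
  filter_upwards [ae_mem_unitCube d (Fin n)] with x hx
  have hmem : ∀ t : Finset (Fin n), ∀ y ∈ t.val.map x, y ∈ unitCube d := by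
    intro t y hy
    obtain ⟨i, -, rfl⟩ := Multiset.mem_map.1 hy
    exact hx i
  have h3 := hsmooth (s.val.map x) (sᶜ.val.map x) (hmem s) (hmem sᶜ)
  have h4 : s.val.map x + sᶜ.val.map x = Finset.univ.val.map x := by
    have hdis : Disjoint s sᶜ := disjoint_compl_right
    rw [← Multiset.map_add, ← Finset.disjUnion_val (h := hdis), Finset.disjUnion_eq_union,
      Finset.union_compl]
  rw [h4, Multiset.card_map] at h3
  have h5 : Multiset.card sᶜ.val = n - k := by
    change sᶜ.card = n - k
    rw [Finset.card_compl, hs, Fintype.card_fin]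
  rwa [h5] at h3

/-- Conditioning on the cells: `u` records the cell of each point, and given `u` the positions
inside the cells are again independent and uniform. -/
theorem integral_pi_eq_average (d : ℕ) {m : ℕ} (hm : 0 < m) (n : ℕ)
    {F : (Fin n → EuclideanSpace ℝ (Fin d)) → ℝ} (hF : Continuous F)
    (hint : ∀ u : Fin n → Fin d → Fin m, Integrable (fun v => F fun j => cellMap (u j) (v j))
      (Measure.pi fun _ => uniformCube d)) :
    ∫ x, F x ∂(Measure.pi fun _ : Fin n => uniformCube d) =
      ((m : ℝ) ^ d)⁻¹ ^ n * ∑ u : Fin n → Fin d → Fin m,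
        ∫ v, F (fun j => cellMap (u j) (v j)) ∂Measure.pi fun _ : Fin n => uniformCube d := by
  have hprob : ∀ b : Fin d → Fin m, IsFiniteMeasure ((uniformCube d).map (cellMap b)) :=
    fun b => by infer_instance
  have hmap : ∀ u : Fin n → Fin d → Fin m,
      (Measure.pi fun j => (uniformCube d).map (cellMap (u j))) =
      (Measure.pi fun _ : Fin n => uniformCube d).map fun v j => cellMap (u j) (v j) := fun u =>
    (Measure.pi_map_pi fun i => (measurable_cellMap (u i)).aemeasurable).symm
  have hmeas : ∀ u : Fin n → Fin d → Fin m, Measurable fun (v : Fin n → EuclideanSpace ℝ (Fin d)) j =>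
      cellMap (u j) (v j) := fun u =>
    measurable_pi_lambda _ fun j => (measurable_cellMap (u j)).comp (measurable_pi_apply j)
  conv_lhs => rw [pi_smul_sum (ι := Fin n) _ _ _ (uniformCube_eq_smul_sum_map d hm)]
  rw [integral_smul_measure, integral_finsetSum_measure]
  · simp only [hmap, Fintype.card_fin, smul_eq_mul, ENNReal.toReal_pow, ENNReal.toReal_inv,
      ENNReal.toReal_natCast, inv_pow]
    congr 1
    refine Finset.sum_congr rfl fun u _ => ?_
    exact integral_map (hmeas u).aemeasurable hF.measurable.aestronglyMeasurable
  · intro u _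
    rw [hmap, integrable_map_measure hF.measurable.aestronglyMeasurable (hmeas u).aemeasurable]
    exact hint u

/-- Given the cells of m^d k points, subadditivity over the grid bounds the mean by 1/m times the
sum of the means for the occupation numbers, plus O(m^(d-1)). Smoothness replaces each occupation
number by k, and their variance bounds the average error by O((√k)^p) per cell. -/
theorem exists_meanValue_sub (hL : IsEuclideanFunctional L) (hd : 2 ≤ d) :
    ∃ C : ℝ, 0 ≤ C ∧ ∀ m k, 0 < m → 0 < k → meanValue d L (m ^ d * k) ≤
      (m : ℝ) ^ (d - 1) * (meanValue d L k + C * (√k) ^ growthExp d) := by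
  obtain ⟨C, hC, hsmooth⟩ := exists_meanValue_smooth hL hd
  set K : ℝ := 2 ^ (d + 2) * d * 2 ^ d with hK
  have hK0 : 0 ≤ K := by positivity
  refine ⟨3 * C + K, by positivity, fun m k hm hk => ?_⟩
  set p := growthExp d with hp_def
  have hp : 0 < p := growthExp_pos hd
  have hp1 : p < 1 := growthExp_lt_one hd
  have hmr : (0 : ℝ) < m := by exact_mod_cast hm
  have hkr : (1 : ℝ) ≤ k := by exact_mod_cast hk
  set s := √(k : ℝ) with hs_def
  have hs : 1 ≤ s := Real.one_le_sqrt.2 hkr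
  have hs2 : s ^ 2 = k := Real.sq_sqrt (by linarith)
  have hsp : 1 ≤ s ^ p := Real.one_le_rpow hs hp.le
  have : Nonempty (Fin d → Fin m) := ⟨fun _ => ⟨0, hm⟩⟩
  have hcard : Fintype.card (Fin d → Fin m) = m ^ d := by simp
  rw [← hcard]
  set n := Fintype.card (Fin d → Fin m) * k with hn
  have hcardr : (Fintype.card (Fin d → Fin m) : ℝ) = (m : ℝ) ^ d := by rw [hcard]; push_cast; rfl
  let N : (Fin n → Fin d → Fin m) → (Fin d → Fin m) → Finset (Fin n) := fun u b =>
    Finset.univ.filter fun j => u j = b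
  have hsplit : ∀ (u : Fin n → Fin d → Fin m) (v : Fin n → EuclideanSpace ℝ (Fin d)),
      Finset.univ.val.map (fun j => cellMap (u j) (v j)) =
        ∑ b, ((N u b).val.map v).map (cellMap b) := by
    intro u v
    have hsing : ∀ (t : Finset (Fin n)) (f : Fin n → EuclideanSpace ℝ (Fin d)),
        t.val.map f = ∑ j ∈ t, {f j} := by
      intro t f
      rw [← Multiset.sum_map_singleton (t.val.map f), Multiset.map_map]
      rfl
    rw [hsing, ← Finset.sum_fiberwise Finset.univ u]
    refine Finset.sum_congr rfl fun b _ => ?_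
    rw [Multiset.map_map, hsing]
    refine Finset.sum_congr rfl fun j hj => ?_
    rw [(Finset.mem_filter.1 hj).2]
    rfl
  have hmap : ∀ (u : Fin n → Fin d → Fin m), Continuous
      fun (v : Fin n → EuclideanSpace ℝ (Fin d)) j => cellMap (u j) (v j) := by
    intro u
    unfold cellMap
    fun_prop
  have hcont := hL.continuous (Finset.univ : Finset (Fin n)).val
  have hpoint : ∀ (u : Fin n → Fin d → Fin m) (v : Fin n → EuclideanSpace ℝ (Fin d)),
      (∀ j, v j ∈ unitCube d) → L (Finset.univ.val.map fun j => cellMap (u j) (v j)) ≤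
        ∑ b, (1 / m : ℝ) * L ((N u b).val.map v) + K * (m : ℝ) ^ (d - 1) := by
    intro u v hv
    rw [hsplit]
    refine (hL.sum_grid_le hd hm _ ?_).trans (add_le_add_left (Finset.sum_le_sum fun b _ => ?_) _)
    · intro b x hx i
      obtain ⟨y, hy, rfl⟩ := Multiset.mem_map.1 hx
      obtain ⟨j, -, rfl⟩ := Multiset.mem_map.1 hy
      rw [cellMap_apply, div_le_div_iff_of_pos_right hmr, div_le_div_iff_of_pos_right hmr]
      have := hv j i
      exact ⟨by linarith [this.1], by linarith [this.2]⟩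
    · exact hL.map_le (cellMap b) (1 / m) (dist_cellMap b) _
  have hintR : ∀ u : Fin n → Fin d → Fin m, Integrable
      (fun v => ∑ b, (1 / m : ℝ) * L ((N u b).val.map v) + K * (m : ℝ) ^ (d - 1))
      (Measure.pi fun _ : Fin n => uniformCube d) := fun u =>
    (integrable_finsetSum _ fun b _ => (hL.integrable_pi hd (N u b)).const_mul _).add
      (integrable_const _)
  have hint : ∀ u : Fin n → Fin d → Fin m, Integrable
      (fun v => L (Finset.univ.val.map fun j => cellMap (u j) (v j)))
      (Measure.pi fun _ : Fin n => uniformCube d) := by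
    intro u
    refine (hintR u).mono' (hcont.comp (hmap u)).measurable.aestronglyMeasurable ?_
    filter_upwards [ae_mem_unitCube d (Fin n)] with v hv
    rw [Real.norm_of_nonneg (hL.nonneg _)]
    exact hpoint u v hv
  -- Smoothness gives an error |t - k|^p, rewritten to be quadratic in t - k so that the variance
  -- bound applies.
  have hmean : ∀ t : ℕ, meanValue d L t ≤
      meanValue d L k + C * (1 + s ^ p) + C * s ^ p / k * ((t : ℝ) - k) ^ 2 := by
    intro t
    have h1 : meanValue d L t - meanValue d L k ≤ C * (1 + |(t : ℝ) - k| ^ p) := by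
      rcases le_total k t with h | h
      · have := (abs_le.1 (hsmooth t k h)).2
        rwa [Nat.cast_sub h, ← abs_of_nonneg (sub_nonneg.2 (Nat.cast_le (α := ℝ).2 h))] at this
      · have := (abs_le.1 (hsmooth k t h)).1
        rw [Nat.cast_sub h, ← abs_of_nonneg (sub_nonneg.2 (Nat.cast_le (α := ℝ).2 h)),
          abs_sub_comm] at this
        linarith
    have h2 := rpow_le_mul_one_add_sq hp.le hp1.le (abs_nonneg ((t : ℝ) - k))
      (by linarith : 0 < s)
    rw [sq_abs, hs2] at h2
    have h3 := mul_le_mul_of_nonneg_left h2 hC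
    have h4 : C * (s ^ p * (1 + ((t : ℝ) - k) ^ 2 / k)) =
        C * s ^ p + C * s ^ p / k * ((t : ℝ) - k) ^ 2 := by ring
    linarith
  have hterm : ∀ u : Fin n → Fin d → Fin m,
      ∫ v, L (Finset.univ.val.map fun j => cellMap (u j) (v j))
        ∂(Measure.pi fun _ : Fin n => uniformCube d) ≤
      (1 / m : ℝ) * ((m : ℝ) ^ d * (meanValue d L k + C * (1 + s ^ p)) +
        C * s ^ p / k * ∑ b, ((∑ j, if u j = b then (1 : ℝ) else 0) - k) ^ 2) +
        K * (m : ℝ) ^ (d - 1) := by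
    intro u
    have h1 := integral_mono_ae (hint u) (hintR u)
      (by filter_upwards [ae_mem_unitCube d (Fin n)] with v hv using hpoint u v hv)
    refine h1.trans ?_
    rw [integral_add (integrable_finsetSum _ fun b _ => (hL.integrable_pi hd (N u b)).const_mul _)
      (integrable_const _), integral_finsetSum _
        fun b _ => (hL.integrable_pi hd (N u b)).const_mul _]
    have h2 : ∫ _, K * (m : ℝ) ^ (d - 1) ∂(Measure.pi fun _ : Fin n => uniformCube d) =
        K * (m : ℝ) ^ (d - 1) := by simp
    rw [h2]
    simp only [integral_const_mul, integral_map_eq_meanValue hL]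
    rw [← Finset.mul_sum]
    refine add_le_add_left (mul_le_mul_of_nonneg_left ?_ (by positivity)) _
    refine (Finset.sum_le_sum fun b _ => hmean (N u b).card).trans (le_of_eq ?_)
    have h3 : ∀ b, ((N u b).card : ℝ) = ∑ j, if u j = b then (1 : ℝ) else 0 := by
      intro b
      rw [Finset.sum_ite, Finset.sum_const_zero, add_zero, Finset.sum_const, nsmul_eq_mul, mul_one]
    simp only [h3]
    rw [Finset.sum_add_distrib, Finset.sum_const, Finset.card_univ, nsmul_eq_mul, hcardr,
      ← Finset.mul_sum]
  have hM : (0 : ℝ) < (m : ℝ) ^ d := by positivity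
  have hsum := Finset.sum_le_sum fun (u : Fin n → Fin d → Fin m) (_ : u ∈ Finset.univ) => hterm u
  rw [Finset.sum_add_distrib, ← Finset.mul_sum, Finset.sum_add_distrib, ← Finset.mul_sum,
    Finset.sum_const, Finset.sum_const, Finset.card_univ, nsmul_eq_mul, nsmul_eq_mul,
    Fintype.card_fun, Fintype.card_fin, Nat.cast_pow, hcardr] at hsum
  have hvar := sum_sum_sq_count_sub_le (B := Fin d → Fin m) k
  rw [hcardr] at hvar
  have hvar' := mul_le_mul_of_nonneg_left hvar (show 0 ≤ C * s ^ p / k by positivity)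
  have e1 : meanValue d L n = ((m : ℝ) ^ d)⁻¹ ^ n * _ := integral_pi_eq_average d hm n hcont hint
  rw [e1]
  have hMn : (0 : ℝ) < ((m : ℝ) ^ d) ^ n := by positivity
  rw [inv_pow, inv_mul_le_iff₀ hMn]
  refine hsum.trans ?_
  have e2 : C * s ^ p / k * (((m : ℝ) ^ d) ^ n * ((m : ℝ) ^ d * k)) =
      ((m : ℝ) ^ d) ^ n * ((m : ℝ) ^ d * (C * s ^ p)) := by
    have : (k : ℝ) ≠ 0 := by positivity
    field_simp
  rw [e2] at hvar'
  have e3 : (m : ℝ) ^ d = m * (m : ℝ) ^ (d - 1) := by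
    rw [← pow_succ', Nat.sub_add_cancel (by omega)]
  rw [← Finset.mul_sum, mul_left_comm ((m : ℝ) ^ d) (((m : ℝ) ^ d) ^ n)]
  have hX := add_le_add_right hvar'
    (((m : ℝ) ^ d) ^ n * ((m : ℝ) ^ d * (meanValue d L k + C * (1 + s ^ p))))
  have hY := mul_le_mul_of_nonneg_left hX (show (0 : ℝ) ≤ 1 / m by positivity)
  refine (add_le_add_left hY _).trans ?_
  have e4 : (1 / m : ℝ) * (((m : ℝ) ^ d) ^ n * ((m : ℝ) ^ d * (meanValue d L k + C * (1 + s ^ p))) +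
      ((m : ℝ) ^ d) ^ n * ((m : ℝ) ^ d * (C * s ^ p))) =
      ((m : ℝ) ^ d) ^ n * ((m : ℝ) ^ (d - 1) * (meanValue d L k + C * (1 + 2 * s ^ p))) := by
    generalize ((m : ℝ) ^ d) ^ n = Z
    rw [e3]
    field_simp
    ring
  rw [e4, ← mul_add]
  refine mul_le_mul_of_nonneg_left ?_ hMn.le
  have hm1 : (0 : ℝ) ≤ (m : ℝ) ^ (d - 1) := by positivity
  have h5 : C * (1 + 2 * s ^ p) + K ≤ (3 * C + K) * s ^ p := by nlinarith
  have h6 := mul_le_mul_of_nonneg_left h5 hm1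
  linarith

/-- The normalized means of a subadditive Euclidean functional converge. -/
theorem exists_tendsto_meanValue (hL : IsEuclideanFunctional L) (hd : 2 ≤ d) :
    ∃ β : ℝ, Tendsto (fun n : ℕ => meanValue d L n / (n : ℝ) ^ growthExp d) atTop (𝓝 β) := by
  obtain ⟨C₁, hC₁, h₁⟩ := exists_meanValue_smooth hL hd
  obtain ⟨C₂, hC₂, h₂⟩ := exists_meanValue_sub hL hd
  refine exists_tendsto_div_rpow hd (C := max C₁ C₂) (le_max_of_le_left hC₁)
    (fun n => integral_nonneg fun x => hL.nonneg _) (fun n k hkn => ?_) fun m k hm hk => ?_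
  · exact (h₁ n k hkn).trans (mul_le_mul_of_nonneg_right (le_max_left _ _) (by positivity))
  · refine (h₂ m k hm hk).trans (mul_le_mul_of_nonneg_left ?_ (by positivity))
    exact add_le_add_right (mul_le_mul_of_nonneg_right (le_max_right _ _) (by positivity)) _

end Mean

/-! ### Almost sure convergence -/

section AlmostSure

variable {d : ℕ} {L : Multiset (EuclideanSpace ℝ (Fin d)) → ℝ}

/-- The retraction onto the unit cube that clamps every coordinate. -/
noncomputable def clampCube (v : EuclideanSpace ℝ (Fin d)) : EuclideanSpace ℝ (Fin d) :=
  WithLp.toLp 2 fun i => max 0 (min 1 (v i))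

theorem clampCube_mem (v : EuclideanSpace ℝ (Fin d)) : clampCube v ∈ unitCube d :=
  fun _ => ⟨le_max_left _ _, max_le zero_le_one (min_le_left _ _)⟩

theorem clampCube_eq {v : EuclideanSpace ℝ (Fin d)} (hv : v ∈ unitCube d) : clampCube v = v := by
  ext i
  have := hv i
  change max 0 (min 1 (v i)) = v i
  rw [min_eq_right this.2, max_eq_right this.1]

theorem continuous_clampCube : Continuous (clampCube (d := d)) := by
  unfold clampCube
  fun_prop

/-- Replaces the concave modulus k^p by a constant plus a linear function of k, with the crossover
at k = ηn. This is the form r |S| + ε required by the concentration inequality. -/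
theorem rpow_le_mul_rpow_add_mul {p η n k : ℝ} (hp : 0 ≤ p) (hp1 : p ≤ 1) (hη : 0 < η)
    (hn : 0 < n) (hk : 0 ≤ k) :
    k ^ p ≤ η ^ p * n ^ p + (η * n) ^ (p - 1) * k := by
  have hηn : 0 < η * n := mul_pos hη hn
  rw [← Real.mul_rpow hη.le hn.le]
  rcases le_total k (η * n) with h | h
  · have h1 := Real.rpow_le_rpow hk h hp
    have : 0 ≤ (η * n) ^ (p - 1) * k := by positivity
    linarith
  · have hk0 : 0 < k := hηn.trans_le h
    have h1 : k ^ p = k ^ (p - 1) * k := by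
      rw [Real.rpow_sub_one hk0.ne', div_mul_cancel₀ _ hk0.ne']
    have h2 : k ^ (p - 1) ≤ (η * n) ^ (p - 1) :=
      Real.rpow_le_rpow_of_nonpos hηn h (by linarith)
    have h3 := mul_le_mul_of_nonneg_right h2 hk
    have : 0 ≤ (η * n) ^ p := by positivity
    linarith

/-- With slope r of order n^(p-1), the sub-Gaussian parameter n r^2 has order n^(2p-1), so a
deviation of order n^p has an exponent linear in n. Clamping makes the bounds hold everywhere and
changes the functional only on a null set. -/
theorem exists_measure_deviation_le (hL : IsEuclideanFunctional L) (hd : 2 ≤ d) {δ : ℝ}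
    (hδ : 0 < δ) : ∃ c : ℝ, 0 < c ∧ ∃ N : ℕ, ∀ n, N ≤ n →
      (Measure.pi fun _ : Fin n => uniformCube d).real
        {x | δ * (n : ℝ) ^ growthExp d ≤
          |L (Finset.univ.val.map fun i => clampCube (x i)) - meanValue d L n|} ≤
      2 * Real.exp (-c * n) := by
  obtain ⟨C₀, hC₀, hgrowth⟩ := exists_growth hL hd
  obtain ⟨C₁, hC₁, hsmooth⟩ := exists_smooth hL hd
  set p := growthExp d with hp_def
  have hp : 0 < p := growthExp_pos hd
  have hp1 : p < 1 := growthExp_lt_one hd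
  set C := C₁ + 1 with hC
  have hCpos : 0 < C := by linarith
  -- Twice the error is 4C + 4C η^p n^p. This choice makes the second term (δ/4) n^p, and `N` below
  -- makes the first no larger, so 3δ/4 of the allowance δ is used.
  obtain ⟨η, hη, hηp⟩ : ∃ η : ℝ, 0 < η ∧ 4 * C * η ^ p = δ / 4 := by
    refine ⟨(δ / (16 * C)) ^ (1 / p), by positivity, ?_⟩
    rw [← Real.rpow_mul (by positivity), one_div_mul_cancel hp.ne', Real.rpow_one]
    field_simp
    norm_num
  refine ⟨(δ / 4) ^ 2 / (8 * C ^ 2 * (η ^ (p - 1)) ^ 2), by positivity, ?_⟩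
  have hlim : Tendsto (fun n : ℕ => δ / 4 * (n : ℝ) ^ p) atTop atTop :=
    ((tendsto_rpow_atTop hp).comp tendsto_natCast_atTop_atTop).const_mul_atTop (by positivity)
  obtain ⟨N, hN⟩ := (hlim.eventually_ge_atTop (4 * C)).exists_forall_of_atTop
  refine ⟨max N 1, fun n hn => ?_⟩
  have hn1 : 0 < n := (le_max_right N 1).trans hn
  have hnr : (0 : ℝ) < n := by exact_mod_cast hn1
  have hn2 := hN n ((le_max_left N 1).trans hn)
  let f : (Fin n → EuclideanSpace ℝ (Fin d)) → ℝ := fun x =>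
    L (Finset.univ.val.map fun i => clampCube (x i))
  have hfc : Continuous f := (hL.continuous (Finset.univ : Finset (Fin n)).val).comp
    (continuous_pi fun i => continuous_clampCube.comp (continuous_apply i))
  have hmem : ∀ (x : Fin n → EuclideanSpace ℝ (Fin d)) (s : Finset (Fin n)),
      ∀ y ∈ s.val.map fun i => clampCube (x i), y ∈ unitCube d := by
    intro x s y hy
    obtain ⟨i, -, rfl⟩ := Multiset.mem_map.1 hy
    exact clampCube_mem _
  have hfB : ∀ x, |f x| ≤ C₀ * (n : ℝ) ^ p := by
    intro x
    rw [abs_of_nonneg (hL.nonneg _)]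
    have := hgrowth _ (hmem x Finset.univ)
    rwa [Multiset.card_map, Finset.card_val, Finset.card_univ, Fintype.card_fin] at this
  have hmean : ∫ x, f x ∂(Measure.pi fun _ : Fin n => uniformCube d) = meanValue d L n := by
    refine integral_congr_ae ?_
    filter_upwards [ae_mem_unitCube d (Fin n)] with x hx
    simp only [f, fun i => clampCube_eq (hx i)]
  have hfs : ∀ (S : Finset (Fin n)) (x z : Fin n → EuclideanSpace ℝ (Fin d)),
      |f (S.piecewise z x) - f x| ≤ 2 * C * (1 + (S.card : ℝ) ^ p) := by
    intro S x z
    have hsplit : ∀ w : Fin n → EuclideanSpace ℝ (Fin d),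
        (Finset.univ.val.map fun i => clampCube (w i)) =
        (Sᶜ.val.map fun i => clampCube (w i)) + S.val.map fun i => clampCube (w i) := by
      intro w
      have hdis : Disjoint Sᶜ S := disjoint_compl_left
      rw [← Multiset.map_add, ← Finset.disjUnion_val (h := hdis), Finset.disjUnion_eq_union,
        Finset.union_comm, Finset.union_compl]
    have hpw : (Sᶜ.val.map fun i => clampCube (S.piecewise z x i)) =
        Sᶜ.val.map fun i => clampCube (x i) := by
      refine Multiset.map_congr rfl fun i hi => ?_
      have : i ∉ S := Finset.mem_compl.1 hi
      rw [Finset.piecewise_eq_of_notMem _ _ _ this]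
    have h1 := hsmooth _ _ (hmem x Sᶜ) (hmem x S)
    have h2 := hsmooth _ _ (hmem (S.piecewise z x) Sᶜ) (hmem (S.piecewise z x) S)
    rw [← hsplit] at h1 h2
    rw [hpw] at h2
    rw [Multiset.card_map, Finset.card_val] at h1 h2
    have h3 := abs_sub_le (f (S.piecewise z x)) (L (Sᶜ.val.map fun i => clampCube (x i))) (f x)
    rw [abs_sub_comm (L (Sᶜ.val.map fun i => clampCube (x i))) (f x)] at h3
    have h4 : (0 : ℝ) ≤ 1 + (S.card : ℝ) ^ p := by positivity
    simp only [f] at h3 ⊢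
    have h5 : C₁ * (1 + (S.card : ℝ) ^ p) ≤ C * (1 + (S.card : ℝ) ^ p) :=
      mul_le_mul_of_nonneg_right (by linarith) h4
    linarith
  have hr : 0 ≤ 2 * C * (η * n) ^ (p - 1) := by positivity
  have hfs' : ∀ (S : Finset (Fin n)) (x z : Fin n → EuclideanSpace ℝ (Fin d)),
      |f (S.piecewise z x) - f x| ≤ (NNReal.mk (2 * C * (η * n) ^ (p - 1)) hr : ℝ) * S.card +
        (2 * C + 2 * C * (η ^ p * (n : ℝ) ^ p)) := by
    intro S x z
    refine (hfs S x z).trans ?_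
    have h1 := rpow_le_mul_rpow_add_mul hp.le hp1.le hη hnr (Nat.cast_nonneg' S.card)
    have h2 := mul_le_mul_of_nonneg_left h1 (show 0 ≤ 2 * C by positivity)
    rw [NNReal.coe_mk]
    linarith
  have hmain := measure_abs_sub_integral_ge_le (uniformCube d) f hfc hfB hfs'
    (s := δ / 4 * (n : ℝ) ^ p) (by positivity)
  rw [hmean] at hmain
  refine (measureReal_mono ?_).trans (hmain.trans (le_of_eq ?_))
  · intro x hx
    refine le_trans ?_ (Set.mem_ofPred_eq ▸ hx)
    have : 2 * (2 * C * (η ^ p * (n : ℝ) ^ p)) = δ / 4 * (n : ℝ) ^ p := by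
      rw [← hηp]; ring
    linarith
  · congr 2
    rw [NNReal.coe_mk, Real.mul_rpow hη.le hnr.le, Real.rpow_sub_one hnr.ne']
    have : (0 : ℝ) < (n : ℝ) ^ p := by positivity
    have : (0 : ℝ) < η ^ (p - 1) := by positivity
    field_simp
    norm_num

theorem map_uniformSequence (d n : ℕ) :
    (uniformSequence d).map (fun x (i : Fin n) => x i) =
      Measure.pi fun _ : Fin n => uniformCube d := by
  have h := Measure.map_infinitePi_infinitePi_of_inj (P := fun _ : ℕ => uniformCube d)
    (f := fun i : Fin n => (i : ℕ)) Fin.val_injective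
  rw [Measure.infinitePi_eq_pi (μ := fun _ : Fin n => uniformCube d)] at h
  exact h

theorem ae_mem_unitCube_uniformSequence (d : ℕ) :
    ∀ᵐ x ∂uniformSequence d, ∀ n, x n ∈ unitCube d := by
  refine ae_all_iff.2 fun n => ?_
  have h : ∀ᵐ v ∂uniformCube d, v ∈ unitCube d := ae_restrict_mem (measurableSet_unitCube d)
  have h2 := Measure.infinitePi_map_eval (fun _ : ℕ => uniformCube d) n
  rw [← h2] at h
  exact ae_of_ae_map (measurable_pi_apply n).aemeasurable h

/-- Borel–Cantelli for each tolerance 1/(j+1), the probabilities being geometrically summable. -/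
theorem ae_tendsto_of_tendsto_meanValue (hL : IsEuclideanFunctional L) (hd : 2 ≤ d) {β : ℝ}
    (hβ : Tendsto (fun n : ℕ => meanValue d L n / (n : ℝ) ^ growthExp d) atTop (𝓝 β)) :
    ∀ᵐ x ∂uniformSequence d, Tendsto
      (fun n : ℕ => L (Finset.univ.val.map fun i : Fin n => x i) / (n : ℝ) ^ growthExp d)
      atTop (𝓝 β) := by
  have hdev : ∀ j : ℕ, ∀ᵐ x ∂uniformSequence d, ∀ᶠ n : ℕ in atTop,
      |L (Finset.univ.val.map fun i : Fin n => clampCube (x i)) - meanValue d L n| <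
        1 / ((j : ℝ) + 1) * (n : ℝ) ^ growthExp d := by
    intro j
    obtain ⟨c, hc, N, hN⟩ := exists_measure_deviation_le hL hd
      (δ := 1 / ((j : ℝ) + 1)) (by positivity)
    let S : ∀ n, Set (Fin n → EuclideanSpace ℝ (Fin d)) := fun n =>
      {x | 1 / ((j : ℝ) + 1) * (n : ℝ) ^ growthExp d ≤
          |L (Finset.univ.val.map fun i => clampCube (x i)) - meanValue d L n|}
    have hS : ∀ n, MeasurableSet (S n) := by
      intro n
      have : Continuous fun x : Fin n → EuclideanSpace ℝ (Fin d) =>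
          L (Finset.univ.val.map fun i => clampCube (x i)) :=
        (hL.continuous (Finset.univ : Finset (Fin n)).val).comp
          (continuous_pi fun i => continuous_clampCube.comp (continuous_apply i))
      exact measurableSet_le measurable_const (this.sub continuous_const).abs.measurable
    let T : ℕ → Set (ℕ → EuclideanSpace ℝ (Fin d)) := fun n =>
      {x | N ≤ n ∧ (fun i : Fin n => x i) ∈ S n}
    have hT : ∀ n, uniformSequence d (T n) ≤ ENNReal.ofReal (2 * Real.exp (-c * n)) := by
      intro n
      by_cases hn : N ≤ n
      · have e : T n = (fun x (i : Fin n) => x i) ⁻¹' S n := by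
          ext x; simp [T, hn]
        rw [e, ← Measure.map_apply (by fun_prop) (hS n), map_uniformSequence,
          ← ofReal_measureReal]
        exact ENNReal.ofReal_le_ofReal (hN n hn)
      · have : T n = ∅ := by ext x; simp [T, hn]
        rw [this]; simp
    have hsum : Summable fun n : ℕ => 2 * Real.exp (-c * n) := by
      have : Summable fun n : ℕ => Real.exp (-c * n) := by
        simp only [mul_comm (-c)]
        exact Real.summable_exp_nat_mul_iff.2 (by linarith)
      exact this.mul_left 2
    have hfin : ∑' n, uniformSequence d (T n) ≠ ⊤ :=
      ne_top_of_le_ne_top hsum.tsum_ofReal_ne_top (ENNReal.tsum_le_tsum hT)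
    filter_upwards [ae_eventually_notMem hfin] with x hx
    filter_upwards [hx, eventually_ge_atTop N] with n hn hNn
    by_contra hcon
    exact hn ⟨hNn, not_lt.1 hcon⟩
  filter_upwards [ae_all_iff.2 hdev, ae_mem_unitCube_uniformSequence d] with x hx hcube
  simp only [fun n => clampCube_eq (hcube n)] at hx
  have hdiff : Tendsto (fun n : ℕ => (L (Finset.univ.val.map fun i : Fin n => x i) -
      meanValue d L n) / (n : ℝ) ^ growthExp d) atTop (𝓝 0) := by
    rw [Metric.tendsto_atTop']
    intro ε hε
    obtain ⟨j, hj⟩ := exists_nat_one_div_lt hε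
    obtain ⟨M, hM⟩ := ((hx j).and (eventually_gt_atTop 0)).exists_forall_of_atTop
    refine ⟨M, fun n hn => ?_⟩
    obtain ⟨h1, h2⟩ := hM n hn.le
    have hnp : 0 < (n : ℝ) ^ growthExp d := by positivity
    rw [Real.dist_eq, sub_zero, abs_div, abs_of_pos hnp, div_lt_iff₀ hnp]
    exact h1.trans (mul_lt_mul_of_pos_right hj hnp)
  have := hdiff.add hβ
  rw [zero_add] at this
  refine this.congr fun n => ?_
  rw [← add_div, sub_add_cancel]

end AlmostSure

/-! ### Matchings as involutions -/

section Involutions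

variable {ι E : Type*} [PseudoMetricSpace E]

/-- A fixed-point-free involution is a perfect matching; the sum over points counts every edge
twice. -/
theorem exists_list_of_involutive (x : ι → E) {σ : ι → ι} (hσ : Function.Involutive σ)
    (hfix : ∀ i, σ i ≠ i) (s : Finset ι) (hs : ∀ i ∈ s, σ i ∈ s) :
    ∃ l : List ι, (l : Multiset ι) = s.val ∧
      2 * pairLen (l.map x) = ∑ i ∈ s, dist (x i) (x (σ i)) := by
  classical
  induction s using Finset.strongInduction with
  | H s ih =>
    rcases s.eq_empty_or_nonempty with rfl | ⟨a, ha⟩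
    · exact ⟨[], rfl, by simp [pairLen]⟩
    have hb := hs a ha
    have hb' : σ a ∈ s.erase a := Finset.mem_erase.2 ⟨hfix a, hb⟩
    obtain ⟨l, hl, hlen⟩ := ih ((s.erase a).erase (σ a))
      ((Finset.erase_ssubset hb').trans_subset (Finset.erase_subset _ _)) fun i hi => by
        simp only [Finset.mem_erase] at hi ⊢
        refine ⟨fun h => hi.2.1 (hσ.injective h), fun h => hi.1 ?_, hs i hi.2.2⟩
        rw [← h, hσ]
    refine ⟨a :: σ a :: l, ?_, ?_⟩
    · rw [← Multiset.cons_coe, ← Multiset.cons_coe, hl, Finset.erase_val, Finset.erase_val,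
        Multiset.cons_erase, Multiset.cons_erase]
      · exact ha
      · exact hb'
    · rw [← Finset.add_sum_erase s _ ha, ← Finset.add_sum_erase _ _ hb', ← hlen, hσ a]
      simp only [List.map_cons, pairLen]
      rw [dist_comm (x (σ a))]
      ring

theorem two_mul_permMin_pairLen_le [Fintype ι] (x : ι → E) {σ : ι → ι}
    (hσ : Function.Involutive σ) (hfix : ∀ i, σ i ≠ i) :
    2 * permMin pairLen (Finset.univ.val.map x) ≤ ∑ i, dist (x i) (x (σ i)) := by
  obtain ⟨l, hl, hlen⟩ := exists_list_of_involutive x hσ hfix Finset.univ fun i _ => Finset.mem_univ _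
  rw [← hlen, ← hl]
  exact mul_le_mul_of_nonneg_left (permMin_le pairLen (Multiset.map_coe x l).symm) zero_le_two

theorem chainLen_ofFn (a b : E) {m : ℕ} (y : Fin m → E) :
    chainLen a (List.ofFn y) b =
      ∑ j : Fin (m + 1), dist ((Fin.cons a y : Fin (m + 1) → E) j)
        ((Fin.snoc y b : Fin (m + 1) → E) j) := by
  induction m generalizing a with
  | zero => simp [chainLen, Fin.snoc]
  | succ m ih =>
    rw [List.ofFn_succ, chainLen, ih, Fin.sum_univ_succ (n := m + 1)]
    congr 1
    refine Finset.sum_congr rfl fun j _ => ?_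
    congr 1
    · refine Fin.cases ?_ (fun j => ?_) j <;> simp
    · have : (Fin.snoc y b : Fin (m + 1 + 1) → E) = Fin.cons (y 0) (Fin.snoc (fun i => y i.succ) b) := by
        rw [Fin.cons_snoc_eq_snoc_cons]
        congr 1
        exact (Fin.cons_self_tail y).symm
      rw [this, Fin.cons_succ]

theorem tourLen_ofFn {n : ℕ} (y : Fin n → E) :
    tourLen (List.ofFn y) = ∑ j, dist (y j) (y (finRotate n j)) := by
  cases n with
  | zero => simp [tourLen]
  | succ m =>
    rw [List.ofFn_succ, tourLen, chainLen_ofFn, Fin.snoc_eq_cons_rotate]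
    have : (Fin.cons (y 0) fun i => y i.succ : Fin (m + 1) → E) = y := Fin.cons_self_tail y
    rw [this]

theorem exists_equiv_of_coe_eq_univ_val [Fintype ι] {n : ℕ} (hn : Fintype.card ι = n) {l : List ι}
    (hl : (l : Multiset ι) = Finset.univ.val) : ∃ e : Fin n ≃ ι, l = List.ofFn e := by
  have hlen : l.length = n := by
    have := congrArg Multiset.card hl
    simpa [hn] using this
  subst hlen
  have hnd : l.Nodup := by
    rw [← Multiset.coe_nodup, hl]; exact Finset.univ.nodup
  refine ⟨Equiv.ofBijective l.get ⟨List.nodup_iff_injective_get.1 hnd, fun i => ?_⟩, ?_⟩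
  · have : i ∈ l := by
      rw [← Multiset.mem_coe, hl]; exact Finset.mem_univ i
    exact List.mem_iff_get.1 this
  · exact (List.ofFn_get l).symm

/-- The two involutions follow the alternate edges of an optimal tour. They disagree everywhere
because predecessor and successor differ once there are at least three points. -/
theorem exists_involutive_pair [Fintype ι] (x : ι → E) (heven : Even (Fintype.card ι))
    (h3 : 3 ≤ Fintype.card ι) :
    ∃ σ₁ σ₂ : ι → ι, Function.Involutive σ₁ ∧ Function.Involutive σ₂ ∧ (∀ i, σ₁ i ≠ i) ∧
      (∀ i, σ₂ i ≠ i) ∧ (∀ i, σ₁ i ≠ σ₂ i) ∧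
      ∑ i, dist (x i) (x (σ₁ i)) + ∑ i, dist (x i) (x (σ₂ i)) =
        2 * permMin tourLen (Finset.univ.val.map x) := by
  obtain ⟨l, hl, hlen⟩ := exists_eq_permMin tourLen (Finset.univ.val.map x)
  obtain ⟨l', hl', rfl⟩ := coe_eq_map_iff.1 hl
  obtain ⟨m, hm⟩ : ∃ m, Fintype.card ι = m + 1 := ⟨Fintype.card ι - 1, by omega⟩
  obtain ⟨e, rfl⟩ := exists_equiv_of_coe_eq_univ_val hm hl'
  rw [List.map_ofFn, tourLen_ofFn] at hlen
  let c : Equiv.Perm ι := e.symm.trans ((finRotate (m + 1)).trans e)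
  let par : ι → Prop := fun i => Even (e.symm i : ℕ)
  classical
  have hval : ∀ j : Fin (m + 1), ((finRotate (m + 1) j : Fin (m + 1)) : ℕ) =
      if (j : ℕ) = m then 0 else (j : ℕ) + 1 := by
    intro j
    rw [finRotate_apply, Fin.val_add_one]
    simp only [Fin.ext_iff, Fin.val_last]
  -- The number of points is m + 1, so parity alternates also across the closing edge.
  have hmodd : ¬ Even m := by
    rw [hm, Nat.even_add_one] at heven; exact heven
  have hcpar : ∀ i, par (c i) ↔ ¬ par i := by
    intro i
    simp only [par, c, Equiv.trans_apply, Equiv.symm_apply_apply, hval]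
    split_ifs with h
    · simp [h, hmodd]
    · rw [Nat.even_add_one]
  have hcpar' : ∀ i, par (c.symm i) ↔ ¬ par i := by
    intro i
    have := hcpar (c.symm i)
    rw [Equiv.apply_symm_apply] at this
    tauto
  have hne : ∀ i, c i ≠ c.symm i := by
    intro i h
    have h1 : c (c i) = i := by rw [h, Equiv.apply_symm_apply]
    have h2 : finRotate (m + 1) (finRotate (m + 1) (e.symm i)) = e.symm i := by
      have := congrArg e.symm h1
      simpa [c] using this
    have h3' := congrArg (fun j : Fin (m + 1) => (j : ℕ)) h2
    simp only [hval] at h3'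
    have := (e.symm i).2
    split_ifs at h3' <;> omega
  have hsum : ∑ i, dist (x i) (x (c i)) = permMin tourLen (Finset.univ.val.map x) := by
    rw [← hlen, ← Equiv.sum_comp e]
    simp [c]
  have hsum' : ∑ i, dist (x i) (x (c.symm i)) = permMin tourLen (Finset.univ.val.map x) := by
    rw [← hsum, ← Equiv.sum_comp c]
    simp [dist_comm]
  refine ⟨fun i => if par i then c i else c.symm i, fun i => if par i then c.symm i else c i,
    ?_, ?_, ?_, ?_, ?_, ?_⟩
  · intro i
    by_cases h : par i <;> simp [h, hcpar, hcpar']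
  · intro i
    by_cases h : par i <;> simp [h, hcpar, hcpar']
  · intro i hi
    by_cases h : par i
    · have := hcpar i; simp [h] at hi; simp [hi, h] at this
    · have := hcpar' i; simp [h] at hi; simp [hi, h] at this
  · intro i hi
    by_cases h : par i
    · have := hcpar' i; simp [h] at hi; simp [hi, h] at this
    · have := hcpar i; simp [h] at hi; simp [hi, h] at this
  · intro i
    by_cases h : par i
    · simpa [h] using hne i
    · simpa [h] using (hne i).symm
  · rw [two_mul]
    nth_rewrite 1 [← hsum]
    rw [← hsum', ← Finset.sum_add_distrib, ← Finset.sum_add_distrib]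
    refine Finset.sum_congr rfl fun i _ => ?_
    by_cases h : par i <;> simp [h, add_comm]

end Involutions

/-! ### Gadgets that separate tours from pairs of matchings -/

section Gadget

/-- The minimizer receives a reward δ for every missed point. Exchanging two edges for two others
affects four directed terms on each side, so ignoring the rewards costs 4δ in the doubled lengths,
hence 2δ. -/
theorem exists_involutive_swap_le {ι E : Type*} [Fintype ι] [PseudoMetricSpace E] (x : ι → E)
    (miss : ι → ι → Prop) [DecidableRel miss] {δ : ℝ} (hδ : 0 ≤ δ)
    (hex : ∃ σ : ι → ι, Function.Involutive σ ∧ ∀ i, σ i ≠ i) :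
    ∃ σ : ι → ι, Function.Involutive σ ∧ (∀ i, σ i ≠ i) ∧
      (∀ σ' : ι → ι, Function.Involutive σ' → (∀ i, σ' i ≠ i) →
        ∑ i, (dist (x i) (x (σ i)) - if miss i (σ i) then δ else 0) ≤
          ∑ i, (dist (x i) (x (σ' i)) - if miss i (σ' i) then δ else 0)) ∧
      ∀ i j, i ≠ j → dist (x i) (x (σ i)) + dist (x j) (x (σ j)) ≤
        dist (x i) (x j) + dist (x (σ i)) (x (σ j)) + 2 * δ := by
  classical
  let w : ι → ι → ℝ := fun i j => dist (x i) (x j) - if miss i j then δ else 0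
  have hw : ∀ i j, w i j ≤ dist (x i) (x j) := fun i j => by
    simp only [w]; split_ifs <;> linarith
  have hw' : ∀ i j, dist (x i) (x j) - δ ≤ w i j := fun i j => by
    simp only [w]; split_ifs <;> linarith
  obtain ⟨σ, hσ, hmin⟩ := Finset.exists_min_image
    (Finset.univ.filter fun σ : ι → ι => Function.Involutive σ ∧ ∀ i, σ i ≠ i)
    (fun σ => ∑ i, w i (σ i)) (by
      obtain ⟨σ, h⟩ := hex
      exact ⟨σ, Finset.mem_filter.2 ⟨Finset.mem_univ _, h⟩⟩)
  obtain ⟨hinv, hfix⟩ := (Finset.mem_filter.1 hσ).2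
  have hmin' : ∀ σ' : ι → ι, Function.Involutive σ' → (∀ i, σ' i ≠ i) →
      ∑ i, w i (σ i) ≤ ∑ i, w i (σ' i) := fun σ' h1 h2 =>
    hmin σ' (Finset.mem_filter.2 ⟨Finset.mem_univ _, h1, h2⟩)
  refine ⟨σ, hinv, hfix, hmin', fun i j hij => ?_⟩
  by_cases hji : j = σ i
  · subst hji
    rw [hinv i, dist_comm (x (σ i)) (x i)]
    linarith
  -- Conjugating σ by this transposition replaces the edges {i, σ i}, {j, σ j} by {i, j}, {σ i, σ
  -- j}.
  let s : Equiv.Perm ι := Equiv.swap j (σ i)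
  have hss : ∀ t, s (s t) = t := fun t => Equiv.swap_apply_self _ _ _
  have h1 := hmin' (fun t => s (σ (s t)))
    (fun t => by simp only [hss, hinv (s t)])
    (fun t h => hfix (s t) (by simpa only [hss] using congrArg s h))
  have h2 : ∑ t, w t (s (σ (s t))) = ∑ t, w (s t) (s (σ t)) := by
    rw [← Equiv.sum_comp s]
    simp only [hss]
  rw [h2, ← sub_nonneg, ← Finset.sum_sub_distrib] at h1
  have hσij : σ i ≠ σ j := fun h => hij (hinv.injective h)
  have hiσj : i ≠ σ j := fun h => hji (by rw [h, hinv])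
  have h3 : ∑ t, (w (s t) (s (σ t)) - w t (σ t)) =
      ∑ t ∈ {i, σ i, j, σ j}, (w (s t) (s (σ t)) - w t (σ t)) := by
    refine (Finset.sum_subset (Finset.subset_univ _) fun t _ ht => ?_).symm
    simp only [Finset.mem_insert, Finset.mem_singleton, not_or] at ht
    have e1 : s t = t := Equiv.swap_apply_of_ne_of_ne ht.2.2.1 ht.2.1
    have e2 : s (σ t) = σ t := by
      refine Equiv.swap_apply_of_ne_of_ne (fun h => ht.2.2.2 ?_) fun h => ht.1 (hinv.injective h)
      rw [← h, hinv]
    rw [e1, e2, sub_self]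
  have hsi : s i = i := Equiv.swap_apply_of_ne_of_ne hij (hfix i).symm
  have hsσi : s (σ i) = j := Equiv.swap_apply_right _ _
  have hsj : s j = σ i := Equiv.swap_apply_left _ _
  have hsσj : s (σ j) = σ j := Equiv.swap_apply_of_ne_of_ne (hfix j) hσij.symm
  rw [h3, Finset.sum_insert (by simp [(hfix i).symm, hij, hiσj]),
    Finset.sum_insert (by simp [Ne.symm hji, hσij]), Finset.sum_insert (by simp [(hfix j).symm]),
    Finset.sum_singleton, hinv i, hinv j, hsi, hsσi, hsj, hsσj] at h1
  have := hw i j; have := hw j i; have := hw (σ i) (σ j); have := hw (σ j) (σ i)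
  have := hw' i (σ i); have := hw' (σ i) i; have := hw' j (σ j); have := hw' (σ j) j
  rw [dist_comm (x j) (x i)] at *
  rw [dist_comm (x (σ j)) (x (σ i))] at *
  rw [dist_comm (x (σ i)) (x i)] at *
  rw [dist_comm (x (σ j)) (x j)] at *
  linarith

variable {V : Type*} [NormedAddCommGroup V] [NormedSpace ℝ V]

/-- Move along the sphere of the shorter vector, at a cost of at most its norm, and then radially.
-/
theorem dist_le_of_norm_sub_normalize_le_one {u v : V} (hu : u ≠ 0) (hv : v ≠ 0)
    (h : ‖‖u‖⁻¹ • u - ‖v‖⁻¹ • v‖ ≤ 1) : ‖u - v‖ ≤ max ‖u‖ ‖v‖ := by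
  wlog huv : ‖u‖ ≤ ‖v‖ generalizing u v
  · rw [norm_sub_rev, max_comm]
    exact this hv hu (by rwa [norm_sub_rev]) (le_of_not_ge huv)
  have hu' := norm_pos_iff.2 hu
  have hv' := norm_pos_iff.2 hv
  have e : u - v = ‖u‖ • (‖u‖⁻¹ • u - ‖v‖⁻¹ • v) - (‖v‖ - ‖u‖) • (‖v‖⁻¹ • v) := by
    rw [smul_sub, sub_smul, smul_inv_smul₀ hu'.ne', smul_inv_smul₀ hv'.ne']
    abel
  have h1 : ‖‖u‖ • (‖u‖⁻¹ • u - ‖v‖⁻¹ • v)‖ ≤ ‖u‖ := by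
    rw [norm_smul, norm_norm]
    exact mul_le_of_le_one_right hu'.le h
  have h2 : ‖(‖v‖ - ‖u‖) • (‖v‖⁻¹ • v)‖ = ‖v‖ - ‖u‖ := by
    rw [norm_smul, norm_smul, norm_inv, norm_norm, inv_mul_cancel₀ hv'.ne', mul_one,
      Real.norm_of_nonneg (by linarith)]
  rw [max_eq_right huv, e]
  refine (norm_sub_le _ _).trans ?_
  linarith

/-- The shape of a gadget: pairs of points near `k` places `P l`, no place being close to a segment
between two others. Among more than `N` directions, two are at distance at most `1`. -/
structure GadgetShape (V : Type*) [NormedAddCommGroup V] [NormedSpace ℝ V] where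
  k : ℕ
  N : ℕ
  P : Fin k → V
  (ρ τ δ R : ℝ)
  τ_pos : 0 < τ
  δ_pos : 0 < δ
  two_mul_lt : 2 * N < k
  norm_le : ∀ l, ‖P l‖ ≤ ρ
  gap : ∀ l l₁ l₂, l₁ ≠ l → l₂ ≠ l →
    dist (P l₁) (P l₂) + (8 * τ + 2 * δ) < dist (P l) (P l₁) + dist (P l) (P l₂)
  radius : 4 * (ρ + τ) + 2 * δ < R
  cover : ∀ (s : Finset (Fin k)) (v : Fin k → V), (∀ l ∈ s, ‖v l‖ = 1) → N < s.card →
    ∃ l ∈ s, ∃ l' ∈ s, l ≠ l' ∧ ‖v l - v l'‖ ≤ 1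

/-- The points `x (q l s)` form a copy of the gadget with center `c`, all other points being at
distance at least `R` from its center. -/
def GadgetShape.IsAt (S : GadgetShape V) {ι : Type*} (x : ι → V) (q : Fin S.k × Bool → ι) (c : V) :
    Prop :=
  (∀ l s, ‖x (q (l, s)) - c - S.P l‖ ≤ S.τ) ∧
    ∀ i, (∀ a, q a ≠ i) → S.R ≤ ‖x i - c‖

theorem GadgetShape.IsAt.card_missed_le (S : GadgetShape V) {ι : Type*} [DecidableEq ι] {x : ι → V}
    {q : Fin S.k × Bool → ι} {c : V} (h : S.IsAt x q c) (hq : Function.Injective q)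
    {σ : ι → ι} (hinv : Function.Involutive σ) (hfix : ∀ i, σ i ≠ i)
    (hswap : ∀ i j, i ≠ j → dist (x i) (x (σ i)) + dist (x j) (x (σ j)) ≤
        dist (x i) (x j) + dist (x (σ i)) (x (σ j)) + 2 * S.δ) :
    (Finset.univ.filter fun l => σ (q (l, false)) ≠ q (l, true)).card ≤ S.N := by
  have hτ := S.τ_pos
  have hnear : ∀ l s, dist (x (q (l, s)) - c) (S.P l) ≤ S.τ := fun l s => by
    rw [dist_eq_norm]; exact h.1 l s
  have hdist : ∀ i j, dist (x i) (x j) = dist (x i - c) (x j - c) := fun i j => by simp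
  have hlow : ∀ l s l' s', dist (S.P l) (S.P l') - 2 * S.τ ≤ dist (x (q (l, s))) (x (q (l', s'))) := by
    intro l s l' s'
    rw [hdist]
    have h1 := dist_triangle4 (S.P l) (x (q (l, s)) - c) (x (q (l', s')) - c) (S.P l')
    have h2 := hnear l s
    have h3 := hnear l' s'
    rw [dist_comm] at h2
    linarith
  have hupp : ∀ l s l' s', dist (x (q (l, s))) (x (q (l', s'))) ≤ dist (S.P l) (S.P l') + 2 * S.τ := by
    intro l s l' s'
    rw [hdist]
    have h1 := dist_triangle4 (x (q (l, s)) - c) (S.P l) (S.P l') (x (q (l', s')) - c)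
    have h2 := hnear l s
    have h3 := hnear l' s'
    rw [dist_comm] at h3
    linarith
  have hexit : ∀ l, σ (q (l, false)) ≠ q (l, true) → ∃ s, ∀ a, q a ≠ σ (q (l, s)) := by
    intro l hl
    by_contra hcon
    push Not at hcon
    obtain ⟨⟨l₁, s₁⟩, h₁⟩ := hcon false
    obtain ⟨⟨l₂, s₂⟩, h₂⟩ := hcon true
    have hl₁ : l₁ ≠ l := by
      rintro rfl
      cases s₁ with
      | false => exact hfix _ h₁.symm
      | true => exact hl h₁.symm
    have hl₂ : l₂ ≠ l := by
      rintro rfl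
      cases s₂ with
      | false => exact hl (by rw [h₂, hinv])
      | true => exact hfix _ h₂.symm
    -- If both twins had partners inside the gadget, joining the twins and joining the partners
    -- would save more than 2δ, by `gap`.
    have h3 := hswap (q (l, false)) (q (l, true)) fun h => by simpa using hq h
    rw [← h₁, ← h₂] at h3
    have h4 := S.gap l l₁ l₂ hl₁ hl₂
    have h5 := hlow l false l₁ s₁
    have h6 := hlow l true l₂ s₂
    have h7 := hupp l false l true
    have h8 := hupp l₁ s₁ l₂ s₂
    rw [dist_self] at h7
    linarith
  by_contra hcon
  rw [not_le] at hcon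
  choose! s hs using hexit
  set M := Finset.univ.filter fun l => σ (q (l, false)) ≠ q (l, true) with hM
  have hmem : ∀ l ∈ M, ∀ a, q a ≠ σ (q (l, s l)) := fun l hl =>
    hs l (Finset.mem_filter.1 hl).2
  let u : Fin S.k → V := fun l => x (σ (q (l, s l))) - c
  have hur : ∀ l ∈ M, S.R ≤ ‖u l‖ := fun l hl => h.2 _ (hmem l hl)
  have hρ : ∀ l, ‖x (q (l, s l)) - c‖ ≤ S.ρ + S.τ := by
    intro l
    have h1 := norm_add_le (x (q (l, s l)) - c - S.P l) (S.P l)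
    rw [sub_add_cancel] at h1
    have := S.norm_le l
    have := h.1 l (s l)
    linarith
  have hδ := S.δ_pos
  have hR : M.Nonempty → 0 < S.R := by
    rintro ⟨l, -⟩
    have := S.radius
    have := (norm_nonneg _).trans (hρ l)
    linarith
  have hu0 : ∀ l ∈ M, u l ≠ 0 := fun l hl => by
    have := hur l hl
    have := hR ⟨l, hl⟩
    exact norm_pos_iff.1 (by linarith)
  obtain ⟨l, hl, l', hl', hne, hle⟩ := S.cover M (fun l => ‖u l‖⁻¹ • u l) (fun l hl => by
    rw [norm_smul, norm_inv, norm_norm, inv_mul_cancel₀ (norm_pos_iff.2 (hu0 l hl)).ne']) hcon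
  -- Two outgoing edges in nearby directions: exchanging them saves about the smaller of the two
  -- norms, which is at least R and outweighs the gadget's size.
  have h1 := dist_le_of_norm_sub_normalize_le_one (hu0 l hl) (hu0 l' hl') hle
  have h2 := hswap (q (l, s l)) (q (l', s l')) fun h => hne (by
    have := hq h
    exact congrArg Prod.fst this)
  have h3 : ∀ l, ‖u l‖ - (S.ρ + S.τ) ≤ dist (x (q (l, s l))) (x (σ (q (l, s l)))) := by
    intro l
    rw [dist_comm, hdist, dist_eq_norm]
    have := norm_sub_norm_le (u l) (x (q (l, s l)) - c)
    have := hρ l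
    simp only [u] at *
    linarith
  have h4 : dist (x (q (l, s l))) (x (q (l', s l'))) ≤ 2 * (S.ρ + S.τ) := by
    rw [hdist, dist_eq_norm]
    have := norm_sub_le (x (q (l, s l)) - c) (x (q (l', s l')) - c)
    have := hρ l
    have := hρ l'
    linarith
  have h5 : dist (x (σ (q (l, s l)))) (x (σ (q (l', s l')))) = ‖u l - u l'‖ := by
    rw [hdist, dist_eq_norm]
  have h6 := h3 l
  have h7 := h3 l'
  have h8 := hur l hl
  have h9 := hur l' hl'
  have h10 := S.radius
  rw [h5] at h2
  rcases max_cases ‖u l‖ ‖u l'‖ with ⟨h, -⟩ | ⟨h, -⟩ <;> rw [h] at h1 <;> linarith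

/-- Disjoint gadgets separate the length of a tour from twice the length of a matching. -/
theorem GadgetShape.two_mul_permMin_pairLen_add_le (S : GadgetShape V) {ι κ : Type*} [Fintype ι]
    [Fintype κ] (heven : Even (Fintype.card ι)) (h3 : 3 ≤ Fintype.card ι) (x : ι → V)
    (q : κ → Fin S.k × Bool → ι) (hq : Function.Injective fun a : κ × (Fin S.k × Bool) => q a.1 a.2)
    (c : κ → V) (hat : ∀ g, S.IsAt x (q g) (c g)) :
    2 * permMin pairLen (Finset.univ.val.map x) + S.δ * Fintype.card κ ≤
      permMin tourLen (Finset.univ.val.map x) := by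
  classical
  obtain ⟨σ₁, σ₂, hinv₁, hinv₂, hfix₁, hfix₂, hne, hsum⟩ := exists_involutive_pair x heven h3
  let miss : ι → ι → Prop := fun i j => ∃ g l s, q g (l, s) = i ∧ q g (l, !s) ≠ j
  obtain ⟨σ, hinv, hfix, hmin, hswap⟩ := exists_involutive_swap_le x miss S.δ_pos.le
    ⟨σ₁, hinv₁, hfix₁⟩
  let cnt : (ι → ι) → ℕ := fun σ => (Finset.univ.filter fun i => miss i (σ i)).card
  have hcost : ∀ σ : ι → ι, ∑ i, (dist (x i) (x (σ i)) - if miss i (σ i) then S.δ else 0) =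
      ∑ i, dist (x i) (x (σ i)) - S.δ * cnt σ := by
    intro σ
    rw [Finset.sum_sub_distrib, Finset.sum_ite, Finset.sum_const_zero, add_zero, Finset.sum_const,
      nsmul_eq_mul, mul_comm]
  have h1 := hmin σ₁ hinv₁ hfix₁
  have h2 := hmin σ₂ hinv₂ hfix₂
  simp only [hcost] at h1 h2
  have hpair := two_mul_permMin_pairLen_le x hinv hfix
  -- Since σ₁ and σ₂ disagree at every point, at least one of them misses the twin.
  have hlow : 2 * S.k * Fintype.card κ ≤ cnt σ₁ + cnt σ₂ := by
    have hcard : (Finset.univ.image fun a : κ × (Fin S.k × Bool) => q a.1 a.2).card =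
        2 * S.k * Fintype.card κ := by
      rw [Finset.card_image_of_injective _ hq, Finset.card_univ, Fintype.card_prod,
        Fintype.card_prod, Fintype.card_fin, Fintype.card_bool]
      ring
    rw [← hcard]
    refine (Finset.card_le_card fun i hi => ?_).trans (Finset.card_union_le _ _)
    obtain ⟨⟨g, l, s⟩, -, rfl⟩ := Finset.mem_image.1 hi
    simp only [Finset.mem_union, Finset.mem_filter, Finset.mem_univ, true_and]
    by_cases h : q g (l, !s) = σ₁ (q g (l, s))
    · right
      exact ⟨g, l, s, rfl, fun h' => hne _ (h.symm.trans h')⟩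
    · left
      exact ⟨g, l, s, rfl, h⟩
  -- Despite the reward, the minimizer separates at most N pairs per gadget, each accounting for two
  -- missed points.
  have hupp : cnt σ ≤ 2 * S.N * Fintype.card κ := by
    let M : κ → Finset (Fin S.k) := fun g =>
      Finset.univ.filter fun l => σ (q g (l, false)) ≠ q g (l, true)
    have hM : ∀ g, (M g).card ≤ S.N := fun g =>
      (hat g).card_missed_le S (fun a b hab => by
        have := @hq (g, a) (g, b) hab
        exact congrArg Prod.snd this) hinv hfix hswap
    have hsub : (Finset.univ.filter fun i => miss i (σ i)) ⊆
        Finset.univ.biUnion fun g => ((M g) ×ˢ (Finset.univ : Finset Bool)).image (q g) := by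
      intro i hi
      obtain ⟨g, l, s, rfl, hmiss⟩ := (Finset.mem_filter.1 hi).2
      refine Finset.mem_biUnion.2 ⟨g, Finset.mem_univ _, Finset.mem_image.2 ⟨(l, s), ?_, rfl⟩⟩
      simp only [M, Finset.mem_product, Finset.mem_filter, Finset.mem_univ, true_and, and_true]
      cases s with
      | false => exact fun h => hmiss h.symm
      | true =>
        intro h
        apply hmiss
        rw [← h, hinv]
        rfl
    refine (Finset.card_le_card hsub).trans (Finset.card_biUnion_le.trans ?_)
    have : ∀ g ∈ (Finset.univ : Finset κ),
        (((M g) ×ˢ (Finset.univ : Finset Bool)).image (q g)).card ≤ 2 * S.N := by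
      intro g _
      refine Finset.card_image_le.trans ?_
      rw [Finset.card_product, Finset.card_univ, Fintype.card_bool]
      have := hM g
      omega
    refine (Finset.sum_le_card_nsmul _ _ _ this).trans (le_of_eq ?_)
    rw [Finset.card_univ, smul_eq_mul]
    ring
  have hlow' : (2 * S.k * Fintype.card κ : ℝ) ≤ cnt σ₁ + cnt σ₂ := by exact_mod_cast hlow
  have hupp' : (cnt σ : ℝ) ≤ 2 * S.N * Fintype.card κ := by exact_mod_cast hupp
  have hkN : (2 * S.N + 1 : ℝ) ≤ S.k := by exact_mod_cast S.two_mul_lt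
  have hδ := S.δ_pos
  have h4 := mul_le_mul_of_nonneg_left hlow' hδ.le
  have h5 := mul_le_mul_of_nonneg_left hupp' hδ.le
  have h6 : (0 : ℝ) ≤ Fintype.card κ := by positivity
  have h7 := mul_le_mul_of_nonneg_left (mul_le_mul_of_nonneg_right hkN h6) hδ.le
  nlinarith

end Gadget

/-! ### Construction of a gadget -/

section GadgetExists

/-- N is the number of balls of radius 1/2 that cover the unit sphere, so `cover` is the pigeonhole
principle. The 2N + 1 places are distinct points of a small sphere, which is infinite for d ≥ 2. The
strict triangle inequalities among them are finitely many and survive a small perturbation. -/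
theorem exists_gadgetShape {d : ℕ} (hd : 2 ≤ d) :
    ∃ S : GadgetShape (EuclideanSpace ℝ (Fin d)), S.R = 1 / 2 ∧ S.ρ + S.τ < 1 / 2 := by
  classical
  obtain ⟨t, -, htfin, hcover⟩ := (isCompact_sphere (0 : EuclideanSpace ℝ (Fin d)) 1).finite_cover_balls
    (show (0 : ℝ) < 1 / 2 by norm_num)
  set N := htfin.toFinset.card with hN
  have hinf : (Metric.sphere (0 : EuclideanSpace ℝ (Fin d)) (1 / 16)).Infinite := by
    have hrank : 1 < Module.rank ℝ (EuclideanSpace ℝ (Fin d)) := by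
      rw [← Module.finrank_eq_rank, finrank_euclideanSpace_fin]
      exact_mod_cast hd
    refine (isPreconnected_sphere hrank 0 (1 / 16)).infinite_of_nontrivial ?_
    refine ⟨EuclideanSpace.single ⟨0, by omega⟩ (1 / 16), by simp,
      EuclideanSpace.single ⟨0, by omega⟩ (-(1 / 16)), by simp, fun h => ?_⟩
    have := congrArg (fun v : EuclideanSpace ℝ (Fin d) => v ⟨0, by omega⟩) h
    simp at this
    norm_num at this
  let Q := hinf.natEmbedding
  let P : Fin (2 * N + 1) → EuclideanSpace ℝ (Fin d) := fun l => Q l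
  have hPinj : Function.Injective P := fun a b h => by
    have : Q a = Q b := Subtype.ext h
    exact Fin.ext (Q.injective this)
  have hPnorm : ∀ l, ‖P l‖ = 1 / 16 := fun l =>
    mem_sphere_zero_iff_norm.1 (Q l).2
  have hgap : ∀ l l₁ l₂, l₁ ≠ l → l₂ ≠ l →
      dist (P l₁) (P l₂) < dist (P l) (P l₁) + dist (P l) (P l₂) := by
    intro l l₁ l₂ h₁ h₂
    refine lt_of_le_of_ne ?_ fun h => ?_
    · rw [dist_comm (P l) (P l₁)]; exact dist_triangle _ _ _
    rw [dist_comm (P l) (P l₁)] at h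
    have hw := dist_add_dist_eq_iff.1 h.symm
    -- Strict convexity: a point strictly between two points of a sphere is closer to the center.
    have hs : Sbtw ℝ (P l₁) (P l) (P l₂) := ⟨hw, fun h => h₁ (hPinj h).symm, fun h => h₂ (hPinj h).symm⟩
    have := hs.dist_lt_max_dist 0
    simp only [dist_zero_right, hPnorm, max_self, lt_irrefl] at this
  have hev : ∀ᶠ τ : ℝ in 𝓝[>] 0, ∀ l l₁ l₂, l₁ ≠ l → l₂ ≠ l →
      dist (P l₁) (P l₂) + (8 * τ + 2 * τ) < dist (P l) (P l₁) + dist (P l) (P l₂) := by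
    simp only [eventually_all]
    intro l l₁ l₂ h₁ h₂
    have : Tendsto (fun τ : ℝ => dist (P l₁) (P l₂) + (8 * τ + 2 * τ)) (𝓝[>] 0)
        (𝓝 (dist (P l₁) (P l₂) + (8 * 0 + 2 * 0))) :=
      (Continuous.tendsto (by fun_prop) 0).mono_left nhdsWithin_le_nhds
    refine this.eventually_lt_const ?_
    simpa using hgap l l₁ l₂ h₁ h₂
  have hsmall : ∀ᶠ τ : ℝ in 𝓝[>] 0, τ < 1 / 32 :=
    nhdsWithin_le_nhds (gt_mem_nhds (by norm_num))
  obtain ⟨τ, ⟨hτgap, hτ⟩, hτ0⟩ := ((hev.and hsmall).and self_mem_nhdsWithin).exists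
  replace hτ0 : 0 < τ := hτ0
  refine ⟨{ k := 2 * N + 1, N := N, P := P, ρ := 1 / 16, τ := τ, δ := τ, R := 1 / 2,
            τ_pos := hτ0, δ_pos := hτ0, two_mul_lt := Nat.lt_succ_self _,
            norm_le := fun l => (hPnorm l).le, gap := hτgap, radius := by linarith,
            cover := ?_ }, rfl, by simp only; linarith⟩
  intro s v hv hs
  have hball : ∀ l ∈ s, ∃ y ∈ htfin.toFinset, ‖v l - y‖ < 1 / 2 := by
    intro l hl
    have := hcover (show v l ∈ Metric.sphere 0 1 by simpa using hv l hl)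
    simp only [Set.mem_iUnion, Metric.mem_ball, dist_eq_norm, exists_prop] at this
    obtain ⟨y, hy, h⟩ := this
    exact ⟨y, htfin.mem_toFinset.2 hy, h⟩
  choose! f hf hfl using hball
  obtain ⟨l, hl, l', hl', hne, heq⟩ := Finset.exists_ne_map_eq_of_card_lt_of_maps_to hs hf
  refine ⟨l, hl, l', hl', hne, ?_⟩
  have h1 := hfl l hl
  have h2 := hfl l' hl'
  rw [← heq] at h2
  have h3 := norm_sub_le (v l - f l) (v l' - f l)
  rw [sub_sub_sub_cancel_right] at h3
  linarith

theorem measureReal_pi_extend {Ω ι α : Type*} [MeasurableSpace Ω] [Fintype ι] [Fintype α]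
    (μ : Measure Ω) [IsProbabilityMeasure μ] (e : α ↪ ι) (D : α → Set Ω) (O : Set Ω) :
    (Measure.pi fun _ : ι => μ).real (Set.univ.pi (Function.extend e D fun _ => O)) =
      (∏ a, μ.real (D a)) * μ.real O ^ (Fintype.card ι - Fintype.card α) := by
  classical
  rw [measureReal_def, Measure.pi_pi, ENNReal.toReal_prod,
    ← Finset.prod_mul_prod_compl (Finset.univ.map e), Finset.prod_map]
  congr 1
  · refine Finset.prod_congr rfl fun a _ => ?_
    rw [e.injective.extend_apply]; rfl
  · rw [← Finset.card_univ (α := α), ← Finset.card_map e, ← Finset.card_compl]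
    rw [← Finset.prod_const]
    refine Finset.prod_congr rfl fun i hi => ?_
    rw [Function.extend_apply']
    · rfl
    · rintro ⟨a, rfl⟩
      simp at hi

end GadgetExists

/-! ### The expected number of gadgets -/

section GadgetCount

variable {d : ℕ}

/-- The center of the grid cell `b`, in units of the mesh. -/
noncomputable def cellCenter {m : ℕ} (b : Fin d → Fin m) : EuclideanSpace ℝ (Fin d) :=
  WithLp.toLp 2 fun i => (b i : ℝ) + 1 / 2

/-- The ball with center `w` and radius `r` in units of the mesh `1 / m`. -/
def meshBall (m : ℕ) (w : EuclideanSpace ℝ (Fin d)) (r : ℝ) : Set (EuclideanSpace ℝ (Fin d)) :=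
  Metric.ball ((m : ℝ)⁻¹ • w) ((m : ℝ)⁻¹ * r)

theorem mem_meshBall {m : ℕ} (hm : 0 < m) {w v : EuclideanSpace ℝ (Fin d)} {r : ℝ} :
    v ∈ meshBall m w r ↔ ‖(m : ℝ) • v - w‖ < r := by
  have hmr : (0 : ℝ) < m := by exact_mod_cast hm
  rw [meshBall, mem_ball_iff_norm]
  have : v - (m : ℝ)⁻¹ • w = (m : ℝ)⁻¹ • ((m : ℝ) • v - w) := by
    rw [smul_sub, inv_smul_smul₀ hmr.ne']
  rw [this, norm_smul, norm_inv, Real.norm_of_nonneg hmr.le, mul_lt_mul_iff_right₀ (by positivity)]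

theorem abs_sub_apply_le (v w : EuclideanSpace ℝ (Fin d)) (i : Fin d) : |v i - w i| ≤ ‖v - w‖ := by
  have := PiLp.norm_apply_le (v - w) i
  simpa [Real.norm_eq_abs] using this

theorem meshBall_cellCenter_subset {m : ℕ} (hm : 0 < m) (b : Fin d → Fin m) :
    meshBall m (cellCenter b) (1 / 2) ⊆ unitCube d := by
  intro v hv i
  have hmr : (0 : ℝ) < m := by exact_mod_cast hm
  rw [mem_meshBall hm] at hv
  have h1 := (abs_sub_apply_le ((m : ℝ) • v) (cellCenter b) i).trans_lt hv
  simp only [PiLp.smul_apply, smul_eq_mul, cellCenter] at h1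
  rw [abs_lt] at h1
  have h2 : ((b i : ℕ) : ℝ) + 1 ≤ m := by exact_mod_cast (b i).2
  have h3 : (0 : ℝ) ≤ (b i : ℕ) := by positivity
  constructor
  · by_contra h
    have := mul_neg_of_pos_of_neg hmr (not_le.1 h)
    linarith [h1.1]
  · by_contra h
    have := mul_lt_mul_of_pos_left (not_le.1 h) hmr
    linarith [h1.2]

theorem uniformCube_real_meshBall {m : ℕ} (hm : 0 < m) {w : EuclideanSpace ℝ (Fin d)} {r : ℝ}
    (h : meshBall m w r ⊆ unitCube d) :
    (uniformCube d).real (meshBall m w r) =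
      ((m : ℝ) ^ d)⁻¹ * volume.real (Metric.ball (0 : EuclideanSpace ℝ (Fin d)) r) := by
  have hmr : (0 : ℝ) < (m : ℝ)⁻¹ := by positivity
  rw [measureReal_def, uniformCube, Measure.restrict_eq_self _ h, meshBall,
    Measure.addHaar_ball_mul_of_pos _ _ hmr, finrank_euclideanSpace_fin, ENNReal.toReal_mul,
    ENNReal.toReal_ofReal (by positivity), inv_pow]
  rfl

theorem volume_real_ball_half_le :
    volume.real (Metric.ball (0 : EuclideanSpace ℝ (Fin d)) (1 / 2)) ≤ 1 := by
  have h := uniformCube_real_meshBall one_pos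
    (meshBall_cellCenter_subset one_pos (fun _ : Fin d => (0 : Fin 1)))
  have h1 := measureReal_le_one (μ := uniformCube d)
    (s := meshBall 1 (cellCenter fun _ : Fin d => (0 : Fin 1)) (1 / 2))
  rw [h] at h1
  simpa using h1

variable (S : GadgetShape (EuclideanSpace ℝ (Fin d)))

/-- The center of the small ball that contains one point of a gadget. -/
noncomputable def GadgetShape.site (u : EuclideanSpace ℝ (Fin d)) (a : Fin S.k × Bool) :
    EuclideanSpace ℝ (Fin d) :=
  S.P a.1 + (if a.2 then S.τ / 2 else -(S.τ / 2)) • u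

variable {S} {u : EuclideanSpace ℝ (Fin d)}

theorem GadgetShape.norm_site_sub (hu : ‖u‖ = 1) (a : Fin S.k × Bool) :
    ‖S.site u a - S.P a.1‖ = S.τ / 2 := by
  have := S.τ_pos
  rw [site, add_sub_cancel_left, norm_smul, hu, mul_one]
  split_ifs
  · rw [Real.norm_of_nonneg (by linarith)]
  · rw [norm_neg, Real.norm_of_nonneg (by linarith)]

/-- Makes the balls of radius τ/4 around the sites disjoint. Distinct places are far apart by `gap`
with l₁ = l₂. -/
theorem GadgetShape.le_dist_site (hu : ‖u‖ = 1) {a a' : Fin S.k × Bool} (h : a ≠ a') :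
    S.τ / 2 ≤ dist (S.site u a) (S.site u a') := by
  have hτ := S.τ_pos
  have hδ := S.δ_pos
  by_cases hl : a.1 = a'.1
  · obtain ⟨l, s⟩ := a
    obtain ⟨l', s'⟩ := a'
    simp only at hl
    subst hl
    have hs : s ≠ s' := fun hs => h (by rw [hs])
    rw [dist_eq_norm, site, site, add_sub_add_left_eq_sub, ← sub_smul, norm_smul, hu, mul_one,
      Real.norm_eq_abs]
    cases s <;> cases s' <;> simp at hs ⊢
    · rw [abs_of_nonpos (by linarith)]; linarith
    · rw [abs_of_nonneg (by linarith)]; linarith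
  · have h1 := S.gap a.1 a'.1 a'.1 (Ne.symm hl) (Ne.symm hl)
    rw [dist_self] at h1
    have h2 := dist_triangle4 (S.P a.1) (S.site u a) (S.site u a') (S.P a'.1)
    have h3 := S.norm_site_sub hu a
    have h4 := S.norm_site_sub hu a'
    rw [dist_comm (S.P a.1) (S.site u a), dist_eq_norm (S.site u a), h3,
      dist_eq_norm (S.site u a') (S.P a'.1), h4] at h2
    linarith

theorem GadgetShape.norm_lt_of_mem (hu : ‖u‖ = 1) {m : ℕ} (hm : 0 < m) {b : Fin d → Fin m}
    {a : Fin S.k × Bool} {v : EuclideanSpace ℝ (Fin d)}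
    (hv : v ∈ meshBall m (cellCenter b + S.site u a) (S.τ / 4)) :
    ‖(m : ℝ) • v - cellCenter b - S.P a.1‖ < S.τ := by
  rw [mem_meshBall hm] at hv
  have h1 := S.norm_site_sub hu a
  have h2 := norm_add_le ((m : ℝ) • v - (cellCenter b + S.site u a)) (S.site u a - S.P a.1)
  have e : (m : ℝ) • v - (cellCenter b + S.site u a) + (S.site u a - S.P a.1) =
      (m : ℝ) • v - cellCenter b - S.P a.1 := by abel
  rw [e] at h2
  have := S.τ_pos
  linarith

theorem GadgetShape.norm_center_lt_of_mem (hu : ‖u‖ = 1) (hS : S.ρ + S.τ < 1 / 2) {m : ℕ}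
    (hm : 0 < m) {b : Fin d → Fin m} {a : Fin S.k × Bool} {v : EuclideanSpace ℝ (Fin d)}
    (hv : v ∈ meshBall m (cellCenter b + S.site u a) (S.τ / 4)) :
    ‖(m : ℝ) • v - cellCenter b‖ < 1 / 2 := by
  have h1 := S.norm_lt_of_mem hu hm hv
  have h2 := norm_add_le ((m : ℝ) • v - cellCenter b - S.P a.1) (S.P a.1)
  rw [sub_add_cancel] at h2
  have := S.norm_le a.1
  linarith

variable (S) in
/-- The configurations in which the points `x (e a)` form a gadget in the grid cell `b`. -/
noncomputable def GadgetShape.event (u : EuclideanSpace ℝ (Fin d)) {m n : ℕ} (b : Fin d → Fin m)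
    (e : (Fin S.k × Bool) ↪ Fin n) : Set (Fin n → EuclideanSpace ℝ (Fin d)) :=
  Set.univ.pi (Function.extend e (fun a => meshBall m (cellCenter b + S.site u a) (S.τ / 4))
    fun _ => (meshBall m (cellCenter b) (1 / 2))ᶜ)

theorem GadgetShape.mem_event {m n : ℕ} {b : Fin d → Fin m} {e : (Fin S.k × Bool) ↪ Fin n}
    {x : Fin n → EuclideanSpace ℝ (Fin d)} : x ∈ S.event u b e ↔
      (∀ a, x (e a) ∈ meshBall m (cellCenter b + S.site u a) (S.τ / 4)) ∧
      ∀ i, (∀ a, e a ≠ i) → x i ∉ meshBall m (cellCenter b) (1 / 2) := by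
  rw [event, Set.mem_univ_pi]
  constructor
  · intro h
    refine ⟨fun a => ?_, fun i hi => ?_⟩
    · have := h (e a)
      rwa [e.injective.extend_apply] at this
    · have := h i
      rwa [Function.extend_apply' _ _ _ fun ⟨a, ha⟩ => hi a ha] at this
  · rintro ⟨h1, h2⟩ i
    by_cases hi : ∃ a, e a = i
    · obtain ⟨a, rfl⟩ := hi
      rw [e.injective.extend_apply]
      exact h1 a
    · rw [Function.extend_apply' _ _ _ hi]
      exact h2 i fun a ha => hi ⟨a, ha⟩

/-- The embedding can be read off from the configuration: the points of the central ball are exactly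
the gadget points, and the disjoint small balls tell which is which. -/
theorem GadgetShape.disjoint_event (hu : ‖u‖ = 1) (hS : S.ρ + S.τ < 1 / 2) {m n : ℕ} (hm : 0 < m)
    (b : Fin d → Fin m) :
    Pairwise (Function.onFun Disjoint fun e : (Fin S.k × Bool) ↪ Fin n => S.event u b e) := by
  intro e e' hee
  refine Set.disjoint_left.2 fun x hx hx' => hee ?_
  rw [mem_event] at hx hx'
  ext a
  by_contra hne
  have hmem := hx.1 a
  obtain ⟨a', ha'⟩ : ∃ a', e' a' = e a := by
    by_contra hcon
    push Not at hcon
    exact hx'.2 (e a) hcon ((mem_meshBall hm).2 (S.norm_center_lt_of_mem hu hS hm hmem))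
  have hmem' := hx'.1 a'
  rw [ha'] at hmem'
  have haa : a ≠ a' := by
    rintro rfl
    exact hne (congrArg Fin.val ha'.symm)
  rw [mem_meshBall hm, ← dist_eq_norm] at hmem hmem'
  have h1 := S.le_dist_site hu haa
  have h2 := dist_triangle_left (cellCenter b + S.site u a) (cellCenter b + S.site u a')
    ((m : ℝ) • x (e a))
  rw [dist_add_left] at h2
  linarith

theorem measurableSet_meshBall (m : ℕ) (w : EuclideanSpace ℝ (Fin d)) (r : ℝ) :
    MeasurableSet (meshBall m w r) := measurableSet_ball

theorem GadgetShape.measurableSet_event {m n : ℕ} (b : Fin d → Fin m)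
    (e : (Fin S.k × Bool) ↪ Fin n) : MeasurableSet (S.event u b e) := by
  refine MeasurableSet.univ_pi fun i => ?_
  by_cases hi : ∃ a, e a = i
  · obtain ⟨a, rfl⟩ := hi
    rw [e.injective.extend_apply]
    exact measurableSet_meshBall _ _ _
  · rw [Function.extend_apply' _ _ _ hi]
    exact (measurableSet_meshBall _ _ _).compl

/-- By disjointness the probabilities add up over the embeddings, of which there are as many as the
falling factorial. The central ball has probability at most 1/m^d, which bounds the factors of the
remaining points. -/
theorem GadgetShape.le_measureReal_iUnion_event (hu : ‖u‖ = 1)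
    (hS : S.ρ + S.τ < 1 / 2) {m : ℕ} (hm : 0 < m) (b : Fin d → Fin m) :
    ((m ^ d).descFactorial (2 * S.k) : ℝ) *
      ((((m : ℝ) ^ d)⁻¹ * volume.real (Metric.ball (0 : EuclideanSpace ℝ (Fin d)) (S.τ / 4))) ^
        (2 * S.k) * (1 - ((m : ℝ) ^ d)⁻¹) ^ (m ^ d)) ≤
    (Measure.pi fun _ : Fin (m ^ d) => uniformCube d).real
      (⋃ e : (Fin S.k × Bool) ↪ Fin (m ^ d), S.event u b e) := by
  have hmr : (1 : ℝ) ≤ m := by exact_mod_cast hm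
  have hmd : (1 : ℝ) ≤ (m : ℝ) ^ d := one_le_pow₀ hmr
  have hinv : 0 ≤ 1 - ((m : ℝ) ^ d)⁻¹ := sub_nonneg.2 (inv_le_one_of_one_le₀ hmd)
  have hinv1 : 1 - ((m : ℝ) ^ d)⁻¹ ≤ 1 := by
    have : 0 ≤ ((m : ℝ) ^ d)⁻¹ := by positivity
    linarith
  have hcard : Fintype.card (Fin S.k × Bool) = 2 * S.k := by simp [mul_comm]
  rw [measureReal_iUnion_fintype (S.disjoint_event hu hS hm b) fun e => S.measurableSet_event b e]
  have hle : ∀ e : (Fin S.k × Bool) ↪ Fin (m ^ d),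
      (((m : ℝ) ^ d)⁻¹ * volume.real (Metric.ball (0 : EuclideanSpace ℝ (Fin d)) (S.τ / 4))) ^
        (2 * S.k) * (1 - ((m : ℝ) ^ d)⁻¹) ^ (m ^ d) ≤
      (Measure.pi fun _ : Fin (m ^ d) => uniformCube d).real (S.event u b e) := by
    intro e
    rw [event, measureReal_pi_extend]
    have h1 : ∀ a, (uniformCube d).real (meshBall m (cellCenter b + S.site u a) (S.τ / 4)) =
        ((m : ℝ) ^ d)⁻¹ * volume.real (Metric.ball (0 : EuclideanSpace ℝ (Fin d)) (S.τ / 4)) :=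
      fun a => uniformCube_real_meshBall hm fun v hv =>
        meshBall_cellCenter_subset hm b
          ((mem_meshBall hm).2 (S.norm_center_lt_of_mem hu hS hm hv))
    simp only [h1]
    rw [Finset.prod_const, Finset.card_univ, hcard]
    refine mul_le_mul_of_nonneg_left ?_ (by positivity)
    have h2 : 1 - ((m : ℝ) ^ d)⁻¹ ≤
        (uniformCube d).real (meshBall m (cellCenter b) (1 / 2))ᶜ := by
      rw [probReal_compl_eq_one_sub (measurableSet_meshBall _ _ _),
        uniformCube_real_meshBall hm (meshBall_cellCenter_subset hm b)]
      have := mul_le_mul_of_nonneg_left (volume_real_ball_half_le (d := d))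
        (show 0 ≤ ((m : ℝ) ^ d)⁻¹ by positivity)
      linarith
    calc (1 - ((m : ℝ) ^ d)⁻¹) ^ (m ^ d)
        ≤ (1 - ((m : ℝ) ^ d)⁻¹) ^ (Fintype.card (Fin (m ^ d)) - 2 * S.k) :=
          pow_le_pow_of_le_one hinv hinv1 (by rw [Fintype.card_fin]; exact Nat.sub_le _ _)
      _ ≤ _ := pow_le_pow_left₀ hinv h2 _
  refine le_trans (le_of_eq ?_) (Finset.sum_le_sum fun e _ => hle e)
  rw [Finset.sum_const, Finset.card_univ, Fintype.card_embedding_eq, Fintype.card_fin, hcard,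
    nsmul_eq_mul]

/-- The falling factorial is at least (n/2)^k, and (1 - 1/n)^n tends to 1/e. -/
theorem exists_pos_le_descFactorial_mul (k : ℕ) {w : ℝ} (hw : 0 < w) :
    ∃ q : ℝ, 0 < q ∧ ∀ᶠ n : ℕ in atTop,
      q ≤ (n.descFactorial k : ℝ) * (((n : ℝ)⁻¹ * w) ^ k * (1 - (n : ℝ)⁻¹) ^ n) := by
  refine ⟨(w / 2) ^ k * (Real.exp (-1) / 2), by positivity, ?_⟩
  have hexp := (Real.tendsto_one_add_div_pow_exp (-1)).eventually_const_lt
    (show Real.exp (-1) / 2 < Real.exp (-1) by have := Real.exp_pos (-1); linarith)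
  filter_upwards [hexp, eventually_ge_atTop (2 * k + 1)] with n hn hnk
  have hnr : (0 : ℝ) < n := by
    have : 0 < n := by omega
    exact_mod_cast this
  have h1 : (n : ℝ) / 2 ≤ ((n + 1 - k : ℕ) : ℝ) := by
    rw [div_le_iff₀ two_pos]
    have : n ≤ (n + 1 - k) * 2 := by omega
    exact_mod_cast this
  have h2 : ((n : ℝ) / 2) ^ k ≤ n.descFactorial k := by
    refine (pow_le_pow_left₀ (by positivity) h1 k).trans ?_
    exact_mod_cast Nat.pow_sub_le_descFactorial n k
  have h3 : (1 + -1 / (n : ℝ)) = 1 - (n : ℝ)⁻¹ := by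
    rw [neg_div, one_div, sub_eq_add_neg]
  rw [h3] at hn
  have h4 : (w / 2) ^ k = ((n : ℝ) / 2) ^ k * ((n : ℝ)⁻¹ * w) ^ k := by
    rw [← mul_pow]
    congr 1
    field_simp
  rw [h4, mul_assoc]
  refine mul_le_mul h2 (mul_le_mul_of_nonneg_left hn.le (by positivity)) (by positivity)
    (by positivity)

end GadgetCount

/-! ### Strict separation of the two constants -/

section Separation

variable {d : ℕ}

/-- The deterministic gadget inequality is applied after scaling by m; scaling back turns δ into
δ/m. The sum of indicators counts the cells that hold a gadget. -/
theorem GadgetShape.two_mul_pair_add_le_tour (S : GadgetShape (EuclideanSpace ℝ (Fin d)))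
    (hR : S.R = 1 / 2) (hS : S.ρ + S.τ < 1 / 2) {u : EuclideanSpace ℝ (Fin d)} (hu : ‖u‖ = 1)
    {m n : ℕ} (hm : 0 < m) (heven : Even n) (h3 : 3 ≤ n) (x : Fin n → EuclideanSpace ℝ (Fin d)) :
    2 * permMin pairLen (Finset.univ.val.map x) + S.δ / m *
      ∑ b : Fin d → Fin m, (⋃ e : (Fin S.k × Bool) ↪ Fin n, S.event u b e).indicator 1 x ≤
      permMin tourLen (Finset.univ.val.map x) := by
  classical
  have hmr : (0 : ℝ) < m := by exact_mod_cast hm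
  let κ := {b : Fin d → Fin m // ∃ e : (Fin S.k × Bool) ↪ Fin n, x ∈ S.event u b e}
  have hκ : ∀ b : κ, ∃ e : (Fin S.k × Bool) ↪ Fin n, x ∈ S.event u b.1 e := fun b => b.2
  choose e he using hκ
  have hcount : ∑ b : Fin d → Fin m,
      (⋃ e : (Fin S.k × Bool) ↪ Fin n, S.event u b e).indicator (1 : (Fin n → EuclideanSpace ℝ (Fin d)) → ℝ) x =
      Fintype.card κ := by
    simp only [Set.indicator_apply, Set.mem_iUnion, Pi.one_apply]
    rw [Finset.sum_ite, Finset.sum_const_zero, add_zero, Finset.sum_const, nsmul_eq_mul, mul_one,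
      Fintype.card_subtype]
  have hmem : ∀ (b : κ) a, x (e b a) ∈
      meshBall m (cellCenter b.1 + S.site u a) (S.τ / 4) := fun b =>
    (GadgetShape.mem_event.1 (he b)).1
  have hinj : Function.Injective fun a : κ × (Fin S.k × Bool) => e a.1 a.2 := by
    rintro ⟨b, a⟩ ⟨b', a'⟩ h
    -- The central balls of different cells are disjoint.
    have hbb : b = b' := by
      have h1 := S.norm_center_lt_of_mem hu hS hm (hmem b a)
      have h2 := S.norm_center_lt_of_mem hu hS hm (hmem b' a')
      rw [← show e b a = e b' a' from h] at h2
      refine Subtype.ext (funext fun i => Fin.ext ?_)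
      have h3 := (abs_sub_apply_le ((m : ℝ) • x (e b a)) (cellCenter b.1) i).trans_lt h1
      have h4 := (abs_sub_apply_le ((m : ℝ) • x (e b a)) (cellCenter b'.1) i).trans_lt h2
      simp only [cellCenter] at h3 h4
      rw [abs_lt] at h3 h4
      have h5 : ((b.1 i : ℕ) : ℝ) < (b'.1 i : ℕ) + 1 := by linarith [h3.2, h4.1]
      have h6 : ((b'.1 i : ℕ) : ℝ) < (b.1 i : ℕ) + 1 := by linarith [h3.1, h4.2]
      have h5' : (b.1 i : ℕ) < (b'.1 i : ℕ) + 1 := by exact_mod_cast h5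
      have h6' : (b'.1 i : ℕ) < (b.1 i : ℕ) + 1 := by exact_mod_cast h6
      omega
    subst hbb
    exact Prod.ext rfl ((e b).injective h)
  have hmain := S.two_mul_permMin_pairLen_add_le (by rwa [Fintype.card_fin])
    (by rwa [Fintype.card_fin]) (fun i => (m : ℝ) • x i) (fun b a => e b a) hinj
    (fun b => cellCenter b.1) fun b =>
      ⟨fun l s => (S.norm_lt_of_mem hu hm (hmem b (l, s))).le, fun i hi => by
        have := (GadgetShape.mem_event.1 (he b)).2 i hi
        rw [mem_meshBall hm, not_lt] at this
        rw [hR]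
        exact this⟩
  have htour := isEuclideanFunctional_tour.map_le (fun v : EuclideanSpace ℝ (Fin d) => (m : ℝ) • v) m
    (fun v w => by rw [dist_smul₀, Real.norm_of_nonneg hmr.le]) (Finset.univ.val.map x)
  have hpair := isEuclideanFunctional_pair.map_le
    (fun v : EuclideanSpace ℝ (Fin d) => (m : ℝ)⁻¹ • v) (m : ℝ)⁻¹
    (fun v w => by rw [dist_smul₀, norm_inv, Real.norm_of_nonneg hmr.le])
    (Finset.univ.val.map fun i => (m : ℝ) • x i)
  have e1 : (Finset.univ.val.map x).map (fun v : EuclideanSpace ℝ (Fin d) => (m : ℝ) • v) =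
      Finset.univ.val.map fun i => (m : ℝ) • x i := by
    rw [Multiset.map_map]; rfl
  have e2 : (Finset.univ.val.map fun i => (m : ℝ) • x i).map
      (fun v : EuclideanSpace ℝ (Fin d) => (m : ℝ)⁻¹ • v) = Finset.univ.val.map x := by
    rw [Multiset.map_map]
    refine Multiset.map_congr rfl fun i _ => ?_
    exact inv_smul_smul₀ hmr.ne' _
  rw [e1] at htour
  rw [e2, inv_mul_eq_div, le_div_iff₀ hmr] at hpair
  rw [hcount]
  refine le_of_mul_le_mul_left ?_ hmr
  have e3 : (m : ℝ) * (2 * permMin pairLen (Finset.univ.val.map x) + S.δ / m * Fintype.card κ) =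
      2 * (permMin pairLen (Finset.univ.val.map x) * m) + S.δ * Fintype.card κ := by
    field_simp
  rw [e3]
  linarith

theorem exists_pos_two_mul_meanValue_add_le (hd : 2 ≤ d) :
    ∃ q : ℝ, 0 < q ∧ ∀ᶠ m : ℕ in atTop, Even m →
      2 * meanValue d (permMin pairLen) (m ^ d) + q * (m : ℝ) ^ (d - 1) ≤
        meanValue d (permMin tourLen) (m ^ d) := by
  obtain ⟨S, hR, hS⟩ := exists_gadgetShape hd
  set u : EuclideanSpace ℝ (Fin d) := EuclideanSpace.single ⟨0, by omega⟩ 1 with hu_def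
  have hu : ‖u‖ = 1 := by simp [u]
  have hδ := S.δ_pos
  have hτ := S.τ_pos
  have hw : 0 < volume.real (Metric.ball (0 : EuclideanSpace ℝ (Fin d)) (S.τ / 4)) :=
    ENNReal.toReal_pos (Metric.measure_ball_pos _ _ (by linarith)).ne' measure_ball_lt_top.ne
  obtain ⟨q, hq, hev⟩ := exists_pos_le_descFactorial_mul (2 * S.k) hw
  refine ⟨S.δ * q, by positivity, ?_⟩
  have hpow : Tendsto (fun m : ℕ => m ^ d) atTop atTop := tendsto_pow_atTop (by omega)
  filter_upwards [hpow.eventually hev, hpow.eventually_ge_atTop 3, eventually_gt_atTop 0]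
    with m hqm h3 hm heven
  have hmr : (0 : ℝ) < m := by exact_mod_cast hm
  rw [Nat.cast_pow] at hqm
  let G : (Fin d → Fin m) → Set (Fin (m ^ d) → EuclideanSpace ℝ (Fin d)) := fun b =>
    ⋃ e : (Fin S.k × Bool) ↪ Fin (m ^ d), S.event u b e
  have hG : ∀ b, MeasurableSet (G b) := fun b =>
    MeasurableSet.iUnion fun e => GadgetShape.measurableSet_event b e
  have hGq : ∀ b, q ≤ (Measure.pi fun _ : Fin (m ^ d) => uniformCube d).real (G b) := fun b =>
    hqm.trans (GadgetShape.le_measureReal_iUnion_event hu hS hm b)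
  have hIpair := isEuclideanFunctional_pair.integrable_pi hd
    (Finset.univ : Finset (Fin (m ^ d)))
  have hItour := isEuclideanFunctional_tour.integrable_pi hd
    (Finset.univ : Finset (Fin (m ^ d)))
  have hIG : ∀ b ∈ (Finset.univ : Finset (Fin d → Fin m)), Integrable
      ((G b).indicator (1 : (Fin (m ^ d) → EuclideanSpace ℝ (Fin d)) → ℝ))
      (Measure.pi fun _ : Fin (m ^ d) => uniformCube d) := fun b _ =>
    (integrable_const (1 : ℝ)).indicator (hG b)
  have hmono := integral_mono ((hIpair.const_mul 2).add
      ((integrable_finsetSum _ hIG).const_mul (S.δ / m))) hItour fun x =>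
    S.two_mul_pair_add_le_tour hR hS hu hm ((Nat.even_pow.2 ⟨heven, by omega⟩)) h3 x
  simp only [Pi.add_apply] at hmono
  rw [integral_add (hIpair.const_mul 2) ((integrable_finsetSum _ hIG).const_mul (S.δ / m)),
    integral_const_mul, integral_const_mul, integral_finsetSum _ hIG] at hmono
  simp only [integral_indicator_one (hG _)] at hmono
  have hsum : (m : ℝ) ^ d * q ≤
      ∑ b, (Measure.pi fun _ : Fin (m ^ d) => uniformCube d).real (G b) := by
    have := Finset.card_nsmul_le_sum (Finset.univ : Finset (Fin d → Fin m)) _ q fun b _ => hGq b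
    simpa [Finset.card_univ] using this
  have h4 := mul_le_mul_of_nonneg_left hsum (show 0 ≤ S.δ / m by positivity)
  have h5 : S.δ / m * ((m : ℝ) ^ d * q) = S.δ * q * (m : ℝ) ^ (d - 1) := by
    obtain ⟨c, rfl⟩ : ∃ c, d = c + 1 := ⟨d - 1, by omega⟩
    rw [Nat.add_sub_cancel, pow_succ]
    field_simp
  rw [h5] at h4
  unfold meanValue
  linarith

/-- The limits exist already, so the subsequence n = (2j)^d suffices; it makes n even, as the
splitting of tours requires. -/
theorem two_mul_lt_of_tendsto_meanValue (hd : 2 ≤ d) {βMM βTSP : ℝ}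
    (hMM : Tendsto (fun n : ℕ => meanValue d (permMin pairLen) n / (n : ℝ) ^ growthExp d) atTop
      (𝓝 βMM))
    (hTSP : Tendsto (fun n : ℕ => meanValue d (permMin tourLen) n / (n : ℝ) ^ growthExp d) atTop
      (𝓝 βTSP)) : 2 * βMM < βTSP := by
  obtain ⟨q, hq, hev⟩ := exists_pos_two_mul_meanValue_add_le hd
  have hlim : Tendsto (fun j : ℕ => (2 * j) ^ d) atTop atTop :=
    (tendsto_pow_atTop (by omega : d ≠ 0)).comp (tendsto_id.const_mul_atTop' two_pos)
  have hlim2 : Tendsto (fun j : ℕ => 2 * j) atTop atTop := tendsto_id.const_mul_atTop' two_pos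
  have h1 : Tendsto (fun j : ℕ => 2 * (meanValue d (permMin pairLen) ((2 * j) ^ d) /
      (((2 * j) ^ d : ℕ) : ℝ) ^ growthExp d) + q) atTop (𝓝 (2 * βMM + q)) :=
    ((hMM.comp hlim).const_mul 2).add_const q
  have h2 := hTSP.comp hlim
  have hle : 2 * βMM + q ≤ βTSP := by
    refine le_of_tendsto_of_tendsto h1 h2 ?_
    filter_upwards [hlim2.eventually hev, eventually_gt_atTop 0] with j hj hj0
    have hj' := hj (even_two_mul j)
    have hjr : (0 : ℝ) < ((2 * j : ℕ) : ℝ) := by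
      have : 0 < 2 * j := by omega
      exact_mod_cast this
    simp only [Function.comp_apply]
    rw [Nat.cast_pow, pow_rpow_growthExp hd hjr.le, le_div_iff₀ (by positivity), add_mul,
      mul_assoc, div_mul_cancel₀ _ (by positivity)]
    exact hj'
  linarith

end Separation

/-! ### Tours and matchings of finite sets in terms of lists -/

section Transfer

variable {E : Type*} [PseudoMetricSpace E]

theorem tspLength_eq_permMin (X : Finset E) : tspLength X = permMin tourLen X.val := by
  have hX : X.val = (Finset.univ : Finset X).val.map Subtype.val := by
    rw [Finset.univ_eq_attach, Finset.attach_val, Multiset.attach_map_val]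
  have hlen : ∀ e : Fin X.card ≃ X,
      tourLength X e = tourLen ((List.ofFn e).map Subtype.val) := fun e => by
    rw [List.map_ofFn, tourLen_ofFn]; rfl
  have : Nonempty (Fin X.card ≃ X) := ⟨X.equivFin.symm⟩
  apply le_antisymm
  · refine le_permMin fun l hl => ?_
    rw [hX] at hl
    obtain ⟨l', hl', rfl⟩ := coe_eq_map_iff.1 hl
    obtain ⟨e, rfl⟩ := exists_equiv_of_coe_eq_univ_val (Fintype.card_coe X) hl'
    rw [← hlen]
    exact ciInf_le (Set.finite_range _).bddBelow e
  · refine le_ciInf fun e => ?_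
    rw [hlen]
    refine permMin_le _ ?_
    rw [hX, ← Multiset.map_coe]
    congr 1
    refine (Multiset.Nodup.ext ?_ Finset.univ.nodup).2 fun a => ?_
    · exact Multiset.coe_nodup.2 (List.nodup_ofFn.2 e.injective)
    · rw [Multiset.mem_coe, List.mem_ofFn]
      exact ⟨fun _ => Finset.mem_univ a, fun _ => ⟨e.symm a, e.apply_symm_apply a⟩⟩

/-- The edges are listed endpoint by endpoint, with the at most one uncovered vertex at the end,
where `pairLen` ignores it. -/
theorem exists_list_of_pairwise_disjoint (F : Finset (Sym2 E)) (R : Set E) (hR : R.Subsingleton)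
    (hdiag : ∀ e ∈ F, ¬ e.IsDiag) (hdisj : ∀ e ∈ F, ∀ e' ∈ F, ∀ v, v ∈ e → v ∈ e' → e = e')
    (hFR : ∀ e ∈ F, ∀ v ∈ e, v ∉ R) :
    ∃ l : List E, l.Nodup ∧ (∀ v, v ∈ l ↔ (∃ e ∈ F, v ∈ e) ∨ v ∈ R) ∧
      pairLen l = ∑ e ∈ F, edgeLength e := by
  classical
  induction F using Finset.induction_on with
  | empty =>
    rcases hR.eq_empty_or_singleton with rfl | ⟨a, rfl⟩
    · exact ⟨[], by simp, by simp, rfl⟩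
    · exact ⟨[a], by simp, by simp, rfl⟩
  | insert e F he ih =>
    obtain ⟨l, hnd, hmem, hlen⟩ := ih (fun e' h => hdiag e' (Finset.mem_insert_of_mem h))
      (fun e₁ h₁ e₂ h₂ => hdisj e₁ (Finset.mem_insert_of_mem h₁) e₂ (Finset.mem_insert_of_mem h₂))
      (fun e' h => hFR e' (Finset.mem_insert_of_mem h))
    have hnot : ∀ v ∈ e, v ∉ l := fun v hv hvl => by
      rcases (hmem v).1 hvl with ⟨e', he', hve'⟩ | hvR
      · exact he (hdisj e (Finset.mem_insert_self e F) e' (Finset.mem_insert_of_mem he') v hv hve'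
          ▸ he')
      · exact hFR e (Finset.mem_insert_self e F) v hv hvR
    have hd := hdiag e (Finset.mem_insert_self e F)
    rw [Finset.sum_insert he]
    induction e using Sym2.inductionOn with
    | hf a b =>
      refine ⟨a :: b :: l, ?_, fun v => ?_, ?_⟩
      · rw [List.nodup_cons, List.nodup_cons, List.mem_cons, not_or]
        exact ⟨⟨fun h => hd (Sym2.mk_isDiag_iff.2 h), hnot a (Sym2.mem_mk_left a b)⟩,
          hnot b (Sym2.mem_mk_right a b), hnd⟩
      · simp only [List.mem_cons, hmem, Finset.exists_mem_insert, Sym2.mem_iff, or_assoc]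
      · rw [pairLen, hlen]; rfl

theorem exists_matching_of_nodup (l : List E) (hl : l.Nodup) :
    ∃ M : (⊤ : SimpleGraph E).Subgraph, M.IsMatching ∧ M.verts ⊆ {v | v ∈ l} ∧
      ({v | v ∈ l} \ M.verts).Subsingleton ∧ M.edgeSet.Finite ∧ matchingLength M = pairLen l := by
  induction l using List.twoStepInduction with
  | nil =>
    refine ⟨⊥, fun v hv => hv.elim, by simp, by simp, by simp, ?_⟩
    simp [matchingLength, pairLen]
  | singleton a =>
    refine ⟨⊥, fun v hv => hv.elim, by simp, by simp, by simp, ?_⟩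
    simp [matchingLength, pairLen]
  | cons_cons a b t ih _ =>
    rw [List.nodup_cons, List.nodup_cons, List.mem_cons, not_or] at hl
    obtain ⟨⟨hab, hat⟩, hbt, ht⟩ := hl
    obtain ⟨M, hM, hsub, hsing, hfin, hlen⟩ := ih ht
    have hadj : (⊤ : SimpleGraph E).Adj a b := hab
    have haM : a ∉ M.verts := fun h => hat (hsub h)
    have hbM : b ∉ M.verts := fun h => hbt (hsub h)
    refine ⟨(⊤ : SimpleGraph E).subgraphOfAdj hadj ⊔ M,
      (SimpleGraph.Subgraph.IsMatching.subgraphOfAdj hadj).sup hM ?_, ?_, ?_, ?_, ?_⟩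
    · rw [Set.disjoint_left]
      intro v hv hv'
      have h1 := SimpleGraph.Subgraph.support_subset_verts _ hv
      have h2 := SimpleGraph.Subgraph.support_subset_verts _ hv'
      rcases h1 with rfl | rfl
      · exact haM h2
      · exact hbM h2
    · rintro v (h | h)
      · rcases h with rfl | rfl <;> simp
      · exact List.mem_cons_of_mem _ (List.mem_cons_of_mem _ (hsub h))
    · refine hsing.anti ?_
      rintro v ⟨hv, hv'⟩
      rw [SimpleGraph.Subgraph.verts_sup, Set.mem_union, not_or,
        SimpleGraph.subgraphOfAdj_verts, Set.mem_insert_iff, not_or] at hv'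
      rcases List.mem_cons.1 hv with rfl | hv
      · exact absurd rfl hv'.1.1
      rcases List.mem_cons.1 hv with rfl | hv
      · exact absurd rfl hv'.1.2
      exact ⟨hv, hv'.2⟩
    · rw [SimpleGraph.Subgraph.edgeSet_sup, SimpleGraph.edgeSet_subgraphOfAdj]
      exact (Set.finite_singleton _).union hfin
    · have hnot : s(a, b) ∉ M.edgeSet := fun h => haM (M.edge_vert h)
      rw [matchingLength, SimpleGraph.Subgraph.edgeSet_sup, SimpleGraph.edgeSet_subgraphOfAdj,
        Set.singleton_union, finsum_mem_insert _ hnot hfin, pairLen, ← hlen]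
      rfl

theorem IsMatchingOf.permMin_le {X : Finset E} {M : (⊤ : SimpleGraph E).Subgraph}
    (h : IsMatchingOf X M) : permMin pairLen X.val ≤ matchingLength M := by
  obtain ⟨hM, hsub, hsing⟩ := h
  have hfin : M.edgeSet.Finite := by
    have : Finite M.verts := (X.finite_toSet.subset hsub).to_subtype
    have := Finite.of_surjective _ (SimpleGraph.Subgraph.IsMatching.toEdge.surjective hM)
    exact Set.toFinite _
  have hverts : ∀ e ∈ M.edgeSet, ∀ v ∈ e, v ∈ M.verts := fun e he v hv =>
    M.mem_verts_of_mem_edge he hv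
  obtain ⟨l, hnd, hmem, hlen⟩ := exists_list_of_pairwise_disjoint hfin.toFinset
    ((X : Set E) \ M.verts) hsing
    (fun e he => by
      rw [Set.Finite.mem_toFinset] at he
      exact (⊤ : SimpleGraph E).not_isDiag_of_mem_edgeSet (M.edgeSet_subset he))
    (fun e he e' he' v hv hv' => by
      rw [Set.Finite.mem_toFinset] at he he'
      obtain ⟨a, rfl⟩ := hv
      obtain ⟨b, rfl⟩ := hv'
      rw [hM.eq_of_adj_left (show M.Adj v a from he) he'])
    (fun e he v hv hvR => by
      rw [Set.Finite.mem_toFinset] at he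
      exact hvR.2 (hverts e he v hv))
  rw [matchingLength, finsum_mem_eq_finite_toFinset_sum _ hfin, ← hlen]
  refine _root_.permMin_le _ ((Multiset.Nodup.ext (Multiset.coe_nodup.2 hnd) X.nodup).2 fun v => ?_)
  rw [Multiset.mem_coe, hmem, Finset.mem_val]
  constructor
  · rintro (⟨e, he, hv⟩ | hv)
    · exact hsub (hverts e (hfin.mem_toFinset.1 he) v hv)
    · exact hv.1
  · intro hv
    by_cases hvM : v ∈ M.verts
    · obtain ⟨w, hw, -⟩ := hM hvM
      exact Or.inl ⟨s(v, w), hfin.mem_toFinset.2 hw, Sym2.mem_mk_left v w⟩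
    · exact Or.inr ⟨hv, hvM⟩

theorem minMatchingLength_eq_permMin (X : Finset E) :
    minMatchingLength X = permMin pairLen X.val := by
  have hex : ∀ l : List E, (l : Multiset E) = X.val →
      ∃ M, IsMatchingOf X M ∧ matchingLength M = pairLen l := fun l hl => by
    have hset : {v | v ∈ l} = (X : Set E) := by
      ext v
      rw [Finset.mem_coe, ← Finset.mem_val, ← hl]
      rfl
    obtain ⟨M, hM, hsub, hsing, -, hlen⟩ :=
      exists_matching_of_nodup l (Multiset.coe_nodup.1 (hl ▸ X.nodup))
    rw [hset] at hsub hsing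
    exact ⟨M, ⟨hM, hsub, hsing⟩, hlen⟩
  have hlb : permMin pairLen X.val ∈
      lowerBounds (matchingLength '' {M | IsMatchingOf X M}) := by
    rintro _ ⟨M, hM, rfl⟩
    exact IsMatchingOf.permMin_le hM
  apply le_antisymm
  · refine le_permMin fun l hl => ?_
    obtain ⟨M, hM, hlen⟩ := hex l hl
    exact hlen ▸ csInf_le ⟨_, hlb⟩ ⟨M, hM, rfl⟩
  · obtain ⟨l, hl, -⟩ := exists_eq_permMin pairLen X.val
    obtain ⟨M, hM, -⟩ := hex l hl
    exact le_csInf ⟨_, M, hM, rfl⟩ hlb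

theorem firstPoints_val {F : Type*} {x : ℕ → F} (hx : Function.Injective x) (n : ℕ) :
    (firstPoints x n).val = Finset.univ.val.map fun i : Fin n => x i := by
  classical
  have h : firstPoints x n = (Finset.univ : Finset (Fin n)).map
      ⟨fun i : Fin n => x i, hx.comp Fin.val_injective⟩ := by
    ext v
    simp only [firstPoints, Finset.mem_image, Finset.mem_range, Finset.mem_map, Finset.mem_univ,
      true_and, Function.Embedding.coeFn_mk]
    exact ⟨fun ⟨i, hi, h⟩ => ⟨⟨i, hi⟩, h⟩, fun ⟨i, h⟩ => ⟨i, i.2, h⟩⟩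
  rw [h]
  rfl

end Transfer

/-! ### The asymptotic constants -/

section Constants

variable {d : ℕ}

/-- Needed because `firstPoints` is a set and would merge coinciding points, whereas the means are
taken over multisets. -/
theorem ae_injective_uniformSequence (hd : 0 < d) :
    ∀ᵐ x ∂uniformSequence d, Function.Injective x := by
  have : Nonempty (Fin d) := ⟨⟨0, hd⟩⟩
  have : NullSingletonClass (uniformCube d) := by
    unfold uniformCube; infer_instance
  have hne : ∀ i j : ℕ, i ≠ j → ∀ᵐ x ∂uniformSequence d, x i ≠ x j := fun i j hij => by
    have hdiag : MeasurableSet (Set.diagonal (EuclideanSpace ℝ (Fin d))) := measurableSet_diagonal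
    have hnull : ((uniformCube d).prod (uniformCube d)) (Set.diagonal _) = 0 := by
      rw [Measure.prod_apply hdiag]
      refine (lintegral_congr fun v => ?_).trans lintegral_zero
      have : Prod.mk v ⁻¹' Set.diagonal (EuclideanSpace ℝ (Fin d)) = {v} := by
        ext w; simp [eq_comm]
      rw [this, measure_singleton]
    have hmap := Measure.infinitePi_map_eval_prod (P := fun _ : ℕ => uniformCube d) hij
    have hmeas : Measurable fun x : ℕ → EuclideanSpace ℝ (Fin d) => (x i, x j) := by fun_prop
    rw [← hmap, Measure.map_apply hmeas hdiag] at hnull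
    rw [ae_iff]
    simpa [uniformSequence, Set.preimage, Set.mem_diagonal_iff] using hnull
  have hall : ∀ᵐ x ∂uniformSequence d, ∀ i j : ℕ, i ≠ j → x i ≠ x j := by
    simp only [ae_all_iff]
    exact hne
  filter_upwards [hall] with x hx i j hij
  by_contra h
  exact hx i j h hij

theorem isAsymptoticConstant_of_tendsto_meanValue {L : Finset (EuclideanSpace ℝ (Fin d)) → ℝ}
    {c : List (EuclideanSpace ℝ (Fin d)) → ℝ} (hc : IsEuclideanFunctional (permMin c))
    (hd : 2 ≤ d) (h : ∀ X, L X = permMin c X.val) {β : ℝ}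
    (hβ : Tendsto (fun n : ℕ => meanValue d (permMin c) n / (n : ℝ) ^ growthExp d) atTop (𝓝 β)) :
    IsAsymptoticConstant d L β := by
  unfold IsAsymptoticConstant
  filter_upwards [ae_tendsto_of_tendsto_meanValue hc hd hβ,
    ae_injective_uniformSequence (by omega : 0 < d)] with x hx hinj
  simpa only [h, firstPoints_val hinj] using hx

end Constants

theorem theorem1p5 (d : ℕ) (hd : 2 ≤ d) :
    ∃ βMM βTSP : ℝ,
      IsAsymptoticConstant d minMatchingLength βMM ∧
      IsAsymptoticConstant d tspLength βTSP ∧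
      2 * βMM < βTSP := by
  obtain ⟨βMM, hMM⟩ := exists_tendsto_meanValue (d := d) isEuclideanFunctional_pair hd
  obtain ⟨βTSP, hTSP⟩ := exists_tendsto_meanValue (d := d) isEuclideanFunctional_tour hd
  exact ⟨βMM, βTSP,
    isAsymptoticConstant_of_tendsto_meanValue isEuclideanFunctional_pair hd
      minMatchingLength_eq_permMin hMM,
    isAsymptoticConstant_of_tendsto_meanValue isEuclideanFunctional_tour hd
      tspLength_eq_permMin hTSP,
    two_mul_lt_of_tendsto_meanValue hd hMM hTSP⟩
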